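/- Let $n\ge 1$, let $\mathbf m=(m_0,\dots,m_n)$ with all $m_\alpha\ge 1$, and put $L=m_0+\cdots+m_n$. Let $\Sigma(\mathbf m)$ be the set of $\sigma\in\{0,\dots,n\}^L$ in which each $\alpha$ occurs exactly $m_\alpha$ times. **$n$-ASEP.** On the periodic lattice $\mathbb Z_L$ let $H=\sum_{i\in\mathbb Z_L}H^{loc}_{i,i+1}$ with $H^{loc}|\alpha,\beta\rangle=t^{\theta(\alpha<\beta)}(|\beta,\alpha\rangle-|\alpha,\beta\rangle)$, where $\theta(\text{true})=1$ and $\theta(\text{false})=0$. **Multiline queues.** Put $l_i=m_i+\cdots+m_n$. A multiline queue $Q$ consists of a ball diagram with rows $1,\dots,n$ (from the top) and columns $1,\dots,L$ having $l_r$ balls in Row $r$, at most one per box, and, for $2\le r\le n$, an injection $\phi_{r-1,r}$ from the balls of Row $r$ to the balls of Row $r-1$. A ball of Row $r$ that is in the image of $\phi_{r,r+1}$ has the colour of its preimage; every other ball of Row $r$ has colour $r$. The balls of Row $r$ choose their partners in the order of decreasing colour, and from left to right within one colour; the balls of Row $r-1$ not yet chosen at that moment (including the one about to be chosen) are called free.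 It is required that a ball chooses the ball directly above it if that one is free. A pair consisting of a ball in column $j$ and its partner in column $j'$ has weight $1$ if $j=j'$, and otherwise weight $(1-t)\,t^{\#\text{skipped}}/(1-t^{\#\text{free}})$, where the skipped balls are the free balls in the columns $j'+1,\dots,j-1$ (mod $L$). Let $\mathrm{wt}(Q)$ be the product of the weights of all pairs, let $\pi(Q)\in\Sigma(\mathbf m)$ be the word of colours in Row 1 ($0$ for an empty box), and let $$P_{\rm MLQ}(\sigma)=\sum_{Q:\ \pi(Q)=\sigma}\mathrm{wt}(Q).$$ **Corner transfer matrices.** Let $F=\bigoplus_{d\ge0}K|d\rangle$, where $K$ is the coefficient field ($\mathbb Q(t)$ or $\mathbb R$ below), with $\mathbf k|d\rangle=t^d|d\rangle$, $\mathbf a^+|d\rangle=|d+1\rangle$, $\mathbf a^-|d\rangle=(1-t^d)|d-1\rangle$. Let $S^{ab}_{ij}$ (with $i$, $a$, $j$, $b$ the states of the left, right, bottom and top edge of a vertex) be given by $S^{00}_{00}=S^{10}_{11}=1$, $S^{01}_{01}=\mathbf k$, $S^{10}_{01}=\mathbf a^-$, $S^{00}_{10}=\mathbf a^+$, and $S^{ab}_{ij}=0$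 otherwise. Take $n$ lines; line $x$ enters from the bottom in the $x$-th column from the right, goes up, turns right in the $x$-th row from the top, and leaves on the right. These lines have $n(n-1)/2$ crossings (vertices). For $0\le\alpha\le n$ let $X_\alpha=X_\alpha(1)\in\mathrm{End}(F^{\otimes n(n-1)/2})$ be the sum, over all assignments of states in $\{0,1\}$ to the edges such that the outgoing edge of line $x$ has state $\delta_{\alpha,x}$ for all $x$ (the bottom edges being free), of the tensor product over the vertices of the operators $S^{ab}_{ij}$. **Three-dimensional system.** For $\sigma\in\Sigma(\mathbf m)$ take $L$ copies (layers) of this diagram, layer $k$ having the boundary condition $\alpha=\sigma_k$, and join the copies of each vertex in consecutive layers, periodically in $k$, by edges with states in $\{0,1,2,\dots\}$. The partition function $Z(\sigma)$ is the sum over all states of all edges of the product over all vertices of the matrix elements $\langle d|S^{ab}_{ij}|d'\rangle$, where $d$ and $d'$ are the states of the edges joining the vertex to the preceding and to the following layer. **Theorem.** Let $c(\mathbf m)=\prod_{1\le i\le j\le n-1}\bigl(1-t^{m_i+m_{i+1}+\cdots+m_j}\bigr)$. 1. If $t$ is an indeterminate, then $H\,\sum_{\sigma}P_{\rm MLQ}(\sigma)|\sigma\rangle=0$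 over $\mathbb Q(t)$, and for each $\sigma\in\Sigma(\mathbf m)$ one has $P_{\rm MLQ}(\sigma)\ne0$ and $$P_{\rm MLQ}(\sigma)=c(\mathbf m)\,\mathrm{tr}_{F^{\otimes n(n-1)/2}}(X_{\sigma_1}\cdots X_{\sigma_L})=c(\mathbf m)\,Z(\sigma),$$ where the trace (the sum of the diagonal matrix elements in the basis of the $\bigotimes_v|d_v\rangle$) and the sum $Z(\sigma)$ converge as formal series in $t$, i.e. in $\mathbb Q((t))$. 2. If $t\ge0$ is real and $t\neq1$, then $P_{\rm MLQ}(\sigma)>0$ for all $\sigma\in\Sigma(\mathbf m)$, and the vectors $|p\rangle\in\bigoplus_{\sigma\in\Sigma(\mathbf m)}\mathbb R|\sigma\rangle$ with $H|p\rangle=0$ are exactly the multiples of $\sum_\sigma P_{\rm MLQ}(\sigma)|\sigma\rangle$. If moreover $t<1$, then $c(\mathbf m)>0$, and for all $\sigma\in\Sigma(\mathbf m)$ the trace and the sum $Z(\sigma)$ converge in $\mathbb R$ and $P_{\rm MLQ}(\sigma)=c(\mathbf m)\,\mathrm{tr}(X_{\sigma_1}\cdots X_{\sigma_L})=c(\mathbf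 m)\,Z(\sigma)$. In particular, up to normalization the stationary probability of the $n$-ASEP in the sector $\mathbf m$ is $\mathbb P(\sigma)=\mathrm{tr}(X_{\sigma_1}\cdots X_{\sigma_L})=Z(\sigma)$. -/

import Mathlib

/-!
The number of species is `n = N + 1` throughout, so that the local states `0, …, n` form
`Fin (N + 2)` and a multiplicity `m = (m_0, …, m_n)` is a function `Fin (N + 2) → ℕ`.
The sites `1, …, L` of the periodic lattice are the elements of `Fin L`.
-/

namespace ASEP

noncomputable section

open scoped TensorProduct

/-! ### The multispecies ASEP -/

/-- Configurations `σ = (σ_1, …, σ_L)` with `σ_j ∈ {0, …, n}`. -/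
abbrev Config (N L : ℕ) : Type := Fin L → Fin (N + 2)

/-- `Σ(m)`: the configurations with exactly `m_α` sites in the local state `α`. -/
def sector {N L : ℕ} (m : Fin (N + 2) → ℕ) : Set (Config N L) :=
  {σ | ∀ α, (Finset.univ.filter (fun j => σ j = α)).card = m α}

/-- The configuration obtained by exchanging the local states at `i` and at its right
neighbour `i + 1` (cyclically). -/
def exchange {N L : ℕ} (i : Fin L) (σ : Config N L) : Config N L :=
  σ ∘ Equiv.swap i (finRotate L i)

/-- The Markov matrix `H = ∑_i H^{loc}_{i,i+1}`, where
`H^{loc} |α, β⟩ = t^{θ(α < β)} (|β, α⟩ - |α, β⟩)`. The column of `σ` is `H |σ⟩`. -/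
def markov {K : Type*} [Field K] (t : K) (N L : ℕ) : Matrix (Config N L) (Config N L) K :=
  Matrix.of fun τ σ => ∑ i : Fin L,
    t ^ (if σ i < σ (finRotate L i) then 1 else 0) *
      ((if τ = exchange i σ then 1 else 0) - (if τ = σ then 1 else 0))

/-! ### Multiline queues -/

/-- The collections of injections `φ_{s,s+1} : {balls in Row s+1} ↪ {balls in Row s}`.
Row `r + 1` of the ball diagram is `row r`, the set of columns that contain a ball. -/
abbrev Pairing {N L : ℕ} (row : Fin (N + 1) → Finset (Fin L)) : Type :=
  ∀ s : Fin N, {j // j ∈ row s.succ} ↪ {j // j ∈ row s.castSucc}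

/-- The colour of the box in Row `r + 1` and column `j` (`0` for an empty box): a ball that is
paired with a ball of the row below takes over its colour, any other ball in Row `r + 1`
has colour `r + 1`. -/
def color {N L : ℕ} (row : Fin (N + 1) → Finset (Fin L)) (φ : Pairing row)
    (r : Fin (N + 1)) : Fin L → Fin (N + 2) :=
  open Classical in
  Fin.reverseInduction (motive := fun _ => Fin L → Fin (N + 2))
    (fun j => if j ∈ row (Fin.last N) then Fin.last (N + 1) else 0)
    (fun s c j =>
      if j ∈ row s.castSucc then
        if h : ∃ d : {k // k ∈ row s.succ}, (φ s d : Fin L) = j then c h.choose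
        else s.castSucc.succ
      else 0)
    r

/-- Balls of one row look for their partners in the order of decreasing colour, and from left
to right among balls of the same colour: `d'` precedes `d`. -/
def precedes {N L : ℕ} (row : Fin (N + 1) → Finset (Fin L)) (φ : Pairing row) (s : Fin N)
    (d' d : {j // j ∈ row s.succ}) : Prop :=
  color row φ s.succ d < color row φ s.succ d' ∨
    (color row φ s.succ d' = color row φ s.succ d ∧ d' < d)

/-- The balls in the row above that are still unpaired when `d` looks for its partner. -/
def free {N L : ℕ} (row : Fin (N + 1) → Finset (Fin L)) (φ : Pairing row) (s : Fin N)
    (d : {j // j ∈ row s.succ}) : Finset (Fin L) :=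
  open Classical in
  (row s.castSucc).filter fun j => ∀ d', precedes row φ s d' d → (φ s d' : Fin L) ≠ j

/-- A multiline queue: a ball system in `B_{l_n} ⊗ ⋯ ⊗ B_{l_1}`, `l_i = m_i + ⋯ + m_n`, with a
pairing in which a ball must choose the ball directly above it whenever that one is free. -/
structure MLQ {N : ℕ} (L : ℕ) (m : Fin (N + 2) → ℕ) where
  row : Fin (N + 1) → Finset (Fin L)
  card_row : ∀ r, (row r).card = ∑ α ∈ Finset.Ici r.succ, m α
  pair : Pairing row
  trivial_pair : ∀ (s : Fin N) (d : {j // j ∈ row s.succ}),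
    (d : Fin L) ∈ free row pair s d → (pair s d : Fin L) = d

instance {N L : ℕ} (m : Fin (N + 2) → ℕ) : Fintype (MLQ L m) :=
  open Classical in
  Fintype.ofInjective
    (fun Q : MLQ L m => (⟨Q.row, Q.pair⟩ : Σ row : Fin (N + 1) → Finset (Fin L), Pairing row))
    (by
      rintro ⟨r, _, p, _⟩ ⟨r', _, p', _⟩ h
      simp only [Sigma.mk.injEq] at h
      obtain ⟨rfl, h⟩ := h
      obtain rfl := eq_of_heq h
      rfl)

/-- `π(Q)`: the colours in Row 1. -/
def MLQ.proj {N L : ℕ} {m : Fin (N + 2) → ℕ} (Q : MLQ L m) : Config N L :=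
  color Q.row Q.pair 0

/-- The free balls in the columns `j' + 1, …, j - 1` (cyclically), where the ball `d` in column
`j` is paired with a ball in column `j' ≠ j`. -/
def MLQ.skipped {N L : ℕ} {m : Fin (N + 2) → ℕ} (Q : MLQ L m) (s : Fin N)
    (d : {j // j ∈ Q.row s.succ}) : Finset (Fin L) :=
  (free Q.row Q.pair s d).filter fun x =>
    ((Q.pair s d : Fin L) < x ∧ x < d) ∨
      ((d : Fin L) < Q.pair s d ∧ ((Q.pair s d : Fin L) < x ∨ x < d))

/-- The weight of a multiline queue (at `q = 1`): the product over all pairs `d' ← d` of `1` if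
`d'` is directly above `d`, and of `(1 - t) t^{#skipped} / (1 - t^{#free})` otherwise. -/
def MLQ.weight {K : Type*} [Field K] (t : K) {N L : ℕ} {m : Fin (N + 2) → ℕ} (Q : MLQ L m) : K :=
  ∏ s : Fin N, ∏ d : {j // j ∈ Q.row s.succ},
    if (Q.pair s d : Fin L) = d then 1
    else (1 - t) * t ^ (Q.skipped s d).card / (1 - t ^ (free Q.row Q.pair s d).card)

/-- The coefficients of the state `∑_Q wt(Q) |π(Q)⟩`. -/
def mlqState {K : Type*} [Field K] (t : K) {N L : ℕ} (m : Fin (N + 2) → ℕ) : Config N L → K :=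
  fun σ => ∑ Q : MLQ L m, if Q.proj = σ then Q.weight t else 0

/-! ### The `t`-oscillator and the five vertex model -/

/-- The bosonic Fock space `F = ⨁_d K |d⟩`. -/
abbrev Fock (K : Type*) [Field K] : Type _ := ℕ →₀ K

/-- `k |d⟩ = t^d |d⟩` -/
def opK {K : Type*} [Field K] (t : K) : Module.End K (Fock K) :=
  Finsupp.linearCombination K fun d : ℕ => Finsupp.single d (t ^ d)

/-- `a⁺ |d⟩ = |d + 1⟩` -/
def aPlus (K : Type*) [Field K] : Module.End K (Fock K) :=
  Finsupp.linearCombination K fun d : ℕ => Finsupp.single (d + 1) (1 : K)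

/-- `a⁻ |d⟩ = (1 - t^d) |d - 1⟩`, which is `0` for `d = 0`. -/
def aMinus {K : Type*} [Field K] (t : K) : Module.End K (Fock K) :=
  Finsupp.linearCombination K fun d : ℕ => Finsupp.single (d - 1) (1 - t ^ d)

/-- The vertex weights `S^{ab}_{ij}`, with arguments in the order `i a j b`: `i` and `a` are the
left and right, `j` and `b` the bottom and top edges. -/
def vertexWeight {K : Type*} [Field K] (t : K) (i a j b : Fin 2) : Module.End K (Fock K) :=
  match i, a, j, b with
  | 0, 0, 0, 0 => 1
  | 1, 1, 1, 0 => 1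
  | 0, 0, 1, 1 => opK t
  | 0, 1, 1, 0 => aMinus t
  | 1, 0, 0, 0 => aPlus K
  | _, _, _, _ => 0

/-- The vertices of the corner transfer matrix diagram. It has `n = N + 1` lines `0, …, N`;
line `x` comes in from the bottom in the `x`-th column from the right, runs upwards, turns to the
right in the `x`-th row from the top and leaves on the right. For `x < y` the vertical part of
line `x` crosses the horizontal part of line `y`; this crossing is stored as `(x, y - 1)`. -/
abbrev Vertex (N : ℕ) : Type := {p : Fin N × Fin N // p.1 ≤ p.2}

/-- States of all edges of the diagram: `e x k` is the state of the edge of line `x` after which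
line `x` still has `k` crossings to go. So `e x N` is the bottom edge and `e x 0` the outgoing
right edge of line `x`. (The two segments next to a corner form one edge.) Line `x`, going up,
crosses the lines `N, …, x + 1` and then, going right, the lines `x - 1, …, 0`. -/
abbrev Edges (N : ℕ) : Type := Fin (N + 1) → Fin (N + 1) → Fin 2

/-- The boundary condition of type `α`: the outgoing edge of the line numbered `x + 1` from the
top is in the state `δ_{α, x + 1}`; the bottom edges are free. -/
def Boundary {N : ℕ} (α : Fin (N + 2)) (e : Edges N) : Prop :=
  ∀ x : Fin (N + 1), e x 0 = if α = x.succ then 1 else 0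

/-- The oscillator valued weight at the vertex `v = (x, y - 1)`, for the edge states `e`. -/
def localWeight {K : Type*} [Field K] (t : K) {N : ℕ} (e : Edges N) (v : Vertex N) :
    Module.End K (Fock K) :=
  vertexWeight t
    (e v.1.2.succ v.1.1.succ) (e v.1.2.succ v.1.1.castSucc)
    (e v.1.1.castSucc v.1.2.succ) (e v.1.1.castSucc v.1.2.castSucc)

/-- `F^{⊗ n(n-1)/2}`, one tensor factor for each vertex. -/
abbrev FockTensor (K : Type*) [Field K] (N : ℕ) : Type _ := ⨂[K] _ : Vertex N, Fock K

/-- The corner transfer matrix `X_α(z)`. -/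
def ctm {K : Type*} [Field K] (t z : K) {N : ℕ} (α : Fin (N + 2)) :
    Module.End K (FockTensor K N) :=
  open Classical in
  ∑ e ∈ (Finset.univ : Finset (Edges N)).filter (Boundary α),
    z ^ (∑ x, (e x (Fin.last N) : ℕ)) • PiTensorProduct.map (fun v => localWeight t e v)

/-- The basis `|d⟩ = ⨂_v |d_v⟩` of `F^{⊗ n(n-1)/2}`. -/
def fockBasis (K : Type*) [Field K] (N : ℕ) :
    Module.Basis (Vertex N → ℕ) K (FockTensor K N) :=
  Basis.piTensorProduct fun _ => Finsupp.basisSingleOne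

/-- `Tr A = τ`: the sum of the diagonal matrix elements of `A` converges to `τ`. The matrix
elements are in `K`, and convergence is in a topological field `E` containing `K`. -/
def HasFockTrace {K : Type*} [Field K] {N : ℕ} {E : Type*} [Field E] [TopologicalSpace E]
    [Algebra K E] (A : Module.End K (FockTensor K N)) (τ : E) : Prop :=
  HasSum (fun d : Vertex N → ℕ =>
    algebraMap K E ((fockBasis K N).repr (A (fockBasis K N d)) d)) τ

/-- The product `X_{σ_1} ⋯ X_{σ_L}` with `X_α = X_α(1)`. -/
def ctmProduct {K : Type*} [Field K] (t : K) {N L : ℕ} (σ : Config N L) :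
    Module.End K (FockTensor K N) :=
  (List.ofFn fun k => ctm t 1 (σ k)).prod

/-- States of all edges of the three dimensional system made of `L` layers, the `k`-th layer
being a corner transfer matrix diagram with boundary condition of type `σ_k`. The edges inside
the layers carry states in `{0, 1}`. In the third direction the lattice is periodic, and the edge
over the vertex `v` between the layers `k - 1` and `k` carries a state in `ℕ`. -/
def LayerStates {N L : ℕ} (σ : Config N L) : Type :=
  {c : (Fin L → Edges N) × (Fin L → Vertex N → ℕ) // ∀ k, Boundary (σ k) (c.1 k)}

/-- The Boltzmann weight: the product over all vertices of the matrix element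
`⟨d_k(v)| S^{ab}_{ij} |d_{k+1}(v)⟩`. -/
def boltzmann {K : Type*} [Field K] (t : K) {N L : ℕ} (σ : Config N L) (c : LayerStates σ) : K :=
  ∏ k : Fin L, ∏ v : Vertex N,
    localWeight t (c.1.1 k) v (Finsupp.single (c.1.2 (finRotate L k) v) 1) (c.1.2 k v)

/-- The partition function of the three dimensional system converges to `Z`. -/
def HasPartitionFunction {K : Type*} [Field K] (t : K) {N L : ℕ} {E : Type*} [Field E]
    [TopologicalSpace E] [Algebra K E] (σ : Config N L) (Z : E) : Prop :=
  HasSum (fun c : LayerStates σ => algebraMap K E (boltzmann t σ c)) Z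

/-- The product of the normalization factors `1 - t^{m_i + ⋯ + m_j}` over `1 ≤ i ≤ j ≤ n - 1`. -/
def normFactor {K : Type*} [Field K] (t : K) {N : ℕ} (m : Fin (N + 2) → ℕ) : K :=
  ∏ v : Vertex N,
    (1 - t ^ (∑ α ∈ Finset.Icc v.1.1.succ.castSucc v.1.2.succ.castSucc, m α))

end

end ASEP

open scoped RatFunc

/-!
The theorem rests on one computation: the trace of the product of the operators at a single vertex
of the corner transfer matrix diagram is, up to a factor `1 / (1 - t ^ f)`, the weighted number of
pairings of one colour class of balls between two neighbouring rows of a multiline queue.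

*Trace and pairings* (`hasTr_word`). Going through the layers at a fixed vertex, the left edge is
occupied where a ball of the lower row looks for a partner, the bottom edge where the upper row has
a ball that is free, and the right edge where such a ball gets chosen. If the ball above the first
chooser is free, the two operators agree with the forced choice. Otherwise the layer of this ball
carries `a⁺`. Moving it once round the trace gives a factor `t` for every free ball, and a remainder
`1 - t` at every layer where a ball is to be chosen, which is the vertex without that pair of balls.
The whole turn gives the factor `1 / (1 - t ^ #free)`, so that the weights of the pairings appear.
The geometric series and products of series are the only convergent sums that occur. They are
treated at once over the real numbers and over the Laurent series by means of `IsSummationField`.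

*Trace and partition function* (`hasFockTrace_ctmProduct`, `hasPartitionFunction`). As the balls
choose their partners in the order of decreasing colour, the colour classes decouple
(`queueSum_eq_prod`), and the state of the multiline queues becomes a sum over the colours of all
rows of products of single vertex traces (`mlqState_eq_sum`, `stepSum_eq`). On the other hand, the
states of the edges of the diagram for which no vertex has a vanishing trace are exactly those that
come from the colours of the rows of a multiline queue (`edgesOf`,
`exists_colors_of_diag_ne_zero`). All vertex weights map basis vectors to multiples of basis
vectors, so the sum over the vertical edges reduces to the traces (`exists_path`).

*Stationarity* (`markov_mulVec_mlqState`). The state of the multiline queues is a product of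
transfer matrices between neighbouring rows, applied to the constant vector of the system with one
kind of particles. The matrix elements of the vertex weights satisfy a local exchange relation
(`rowCoef_exchange_relation`). Summed over all pairs of neighbouring columns it telescopes, so that
the transfer matrices commute with the Markov matrix (`commute_markov_rowTransfer`). This covers the
indeterminate `t` and `0 ≤ t < 1`. For other real values `ℚ(t)` is embedded into `ℝ` by a
transcendental value of `t`, and one passes to the limit (`markov_mulVec_mlqState_real`).

*Positivity and uniqueness* (`mlqState_pos`, `exists_eq_smul_of_markov_mulVec_eq_zero`). All weights
are nonnegative, and for each configuration the queue in which all balls are paired with the ball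
directly above has weight `1`. A stationary vector is compared with the smallest multiple of the
positive one that dominates it; the difference vanishes by a flux argument, which also works at
`t = 0`, where part of the rates vanish.
-/

namespace ASEP

noncomputable section

/-! ### Traces over one oscillator -/

/-- A topological field `E ⊇ K` in which the geometric series in the powers of `t ∈ K` converge
and in which convergent series can be multiplied. Both the real numbers with `0 ≤ t < 1` and the
formal Laurent series in `t` are of this kind. -/
structure IsSummationField {K : Type*} [Field K] (t : K) (E : Type*) [Field E]
    [TopologicalSpace E] [Algebra K E] : Prop where
  pow_ne_one : ∀ c : ℕ, 1 ≤ c → t ^ c ≠ 1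
  hasSum_geometric : ∀ c : ℕ, 1 ≤ c →
    HasSum (fun d : ℕ => algebraMap K E (t ^ c) ^ d) (algebraMap K E (1 - t ^ c))⁻¹
  hasSum_mul : ∀ {X Y : Type} (f : X → E) (g : Y → E) (a b : E), HasSum f a → HasSum g b →
    HasSum (fun p : X × Y => f p.1 * g p.2) (a * b)

/-- The diagonal matrix element `⟨d|A|d⟩`. -/
def diag {K : Type*} [Field K] (A : Module.End K (Fock K)) (d : ℕ) : K :=
  A (Finsupp.single d 1) d

/-- The trace of `A` over the Fock space converges in `E` to `s ∈ K`. -/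
def HasTr {K : Type*} [Field K] (E : Type*) [Field E] [TopologicalSpace E] [Algebra K E]
    (A : Module.End K (Fock K)) (s : K) : Prop :=
  HasSum (fun d => algebraMap K E (diag A d)) (algebraMap K E s)

section Operators

variable {K : Type*} [Field K] (t : K)

@[simp] lemma opK_single (d : ℕ) (c : K) :
    opK t (Finsupp.single d c) = Finsupp.single d (c * t ^ d) := by
  simp [opK]

@[simp] lemma aPlus_single (d : ℕ) (c : K) :
    aPlus K (Finsupp.single d c) = Finsupp.single (d + 1) c := by
  simp [aPlus]

@[simp] lemma aMinus_single (d : ℕ) (c : K) :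
    aMinus t (Finsupp.single d c) = Finsupp.single (d - 1) (c * (1 - t ^ d)) := by
  rw [aMinus, Finsupp.linearCombination_single, Finsupp.smul_single, smul_eq_mul]

lemma opK_mul_aPlus : opK t * aPlus K = t • (aPlus K * opK t) := by
  refine Finsupp.lhom_ext fun d c => ?_
  simp only [Module.End.mul_apply, LinearMap.smul_apply, aPlus_single, opK_single,
    Finsupp.smul_single, smul_eq_mul]
  congr 1
  ring

lemma aMinus_mul_aPlus : aMinus t * aPlus K = t • (aPlus K * aMinus t) + (1 - t) • 1 := by
  refine Finsupp.lhom_ext fun d c => ?_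
  simp only [Module.End.mul_apply, LinearMap.smul_apply, aPlus_single, aMinus_single,
    Finsupp.smul_single, smul_eq_mul, LinearMap.add_apply, Module.End.one_apply]
  rcases d with _ | d
  · simp [mul_comm]
  · simp only [Nat.add_sub_cancel]
    rw [← Finsupp.single_add]
    congr 1
    ring

lemma aPlus_apply_zero (v : Fock K) : aPlus K v 0 = 0 := by
  induction v using Finsupp.induction_linear with
  | zero => simp
  | add f g hf hg => simp [hf, hg]
  | single d c => simp

lemma aPlus_apply_succ (v : Fock K) (d : ℕ) : aPlus K v (d + 1) = v d := by
  induction v using Finsupp.induction_linear with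
  | zero => simp
  | add f g hf hg => simp [hf, hg]
  | single d' c => simp [Finsupp.single_apply]

lemma opK_apply (v : Fock K) (d : ℕ) : opK t v d = t ^ d * v d := by
  induction v using Finsupp.induction_linear with
  | zero => simp
  | add f g hf hg => simp [hf, hg, mul_add]
  | single d' c =>
    simp only [opK_single, Finsupp.single_apply]
    split_ifs with h
    · rw [h, mul_comm]
    · simp

lemma aMinus_apply (v : Fock K) (d : ℕ) : aMinus t v d = (1 - t ^ (d + 1)) * v (d + 1) := by
  induction v using Finsupp.induction_linear with
  | zero => simp
  | add f g hf hg => simp [hf, hg, mul_add]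
  | single d' c =>
    rcases d' with _ | d'
    · simp
    · simp only [aMinus_single, Finsupp.single_apply, Nat.add_sub_cancel, add_left_inj]
      split_ifs with h
      · rw [h, mul_comm]
      · simp

lemma diag_aPlus_mul_zero (W : Module.End K (Fock K)) : diag (aPlus K * W) 0 = 0 := by
  simp [diag, Module.End.mul_apply, aPlus_apply_zero]

lemma diag_aPlus_mul_succ (W : Module.End K (Fock K)) (d : ℕ) :
    diag (aPlus K * W) (d + 1) = diag (W * aPlus K) d := by
  simp [diag, Module.End.mul_apply, aPlus_apply_succ]

lemma diag_add (A B : Module.End K (Fock K)) (d : ℕ) : diag (A + B) d = diag A d + diag B d := by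
  simp [diag]

lemma diag_smul (c : K) (A : Module.End K (Fock K)) (d : ℕ) :
    diag (c • A) d = c * diag A d := by
  simp [diag]

lemma diag_sum {ι : Type*} (s : Finset ι) (A : ι → Module.End K (Fock K)) (d : ℕ) :
    diag (∑ i ∈ s, A i) d = ∑ i ∈ s, diag (A i) d := by
  simp [diag, Finsupp.finsetSum_apply]

end Operators

section HasTr

variable {K : Type*} [Field K] {t : K} {E : Type*} [Field E] [TopologicalSpace E] [Algebra K E]

lemma HasTr.add [IsTopologicalRing E] {A B : Module.End K (Fock K)} {a b : K} (hA : HasTr E A a)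
    (hB : HasTr E B b) : HasTr E (A + B) (a + b) := by
  simpa [HasTr, diag_add] using HasSum.add hA hB

lemma HasTr.smul [IsTopologicalRing E] (c : K) {A : Module.End K (Fock K)} {a : K}
    (hA : HasTr E A a) : HasTr E (c • A) (c * a) := by
  simpa [HasTr, diag_smul] using HasSum.mul_left (algebraMap K E c) hA

lemma HasTr.sum [IsTopologicalRing E] {ι : Type*} (s : Finset ι)
    {A : ι → Module.End K (Fock K)} {a : ι → K} (hA : ∀ i ∈ s, HasTr E (A i) (a i)) :
    HasTr E (∑ i ∈ s, A i) (∑ i ∈ s, a i) := by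
  simpa [HasTr, diag_sum] using hasSum_sum hA

/-- The solution of a first order recurrence is the convolution of the inhomogeneity with a
geometric sequence, so its sum is a product of two sums. -/
lemma hasSum_of_recurrence [IsTopologicalRing E] [T3Space E] (hE : IsSummationField t E) {c : ℕ}
    (hc : 1 ≤ c) {h r : ℕ → K} {ρ : K} (h0 : h 0 = 0) (hs : ∀ d, h (d + 1) = t ^ c * h d + r d)
    (hr : HasSum (fun d => algebraMap K E (r d)) (algebraMap K E ρ)) :
    HasSum (fun d => algebraMap K E (h d)) (algebraMap K E (ρ / (1 - t ^ c))) := by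
  have key : ∀ n, h (n + 1) =
      ∑ p ∈ Finset.HasAntidiagonal.antidiagonal n, (t ^ c) ^ p.1 * r p.2 := by
    intro n
    induction n with
    | zero => simp [hs, h0]
    | succ n ih =>
      rw [hs, ih, Finset.Nat.antidiagonal_succ, Finset.sum_cons, Finset.sum_map, Finset.mul_sum,
        add_comm]
      simp [pow_succ', mul_assoc]
  have h1 := hE.hasSum_mul _ _ _ _ (hE.hasSum_geometric c hc) hr
  have h2 := (Finset.HasAntidiagonal.sigmaAntidiagonalEquivProd (A := ℕ)).hasSum_iff.mpr h1
  have h3 := h2.sigma (g := fun n => algebraMap K E (h (n + 1))) (fun n => by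
    have := hasSum_fintype (fun p : Finset.HasAntidiagonal.antidiagonal n =>
      algebraMap K E ((t ^ c) ^ p.1.1 * r p.1.2))
    rw [← map_sum, Finset.sum_coe_sort (Finset.HasAntidiagonal.antidiagonal n)
      (fun p => (t ^ c) ^ p.1 * r p.2), ← key] at this
    convert this using 2
    simp)
  rw [← hasSum_nat_add_iff' 1]
  simpa [h0, div_eq_inv_mul] using h3

lemma HasTr.unique [T2Space E] {A : Module.End K (Fock K)} {a b : K} (ha : HasTr E A a)
    (hb : HasTr E A b) : a = b :=
  (algebraMap K E).injective (HasSum.unique ha hb)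

lemma hasTr_zero : HasTr E (0 : Module.End K (Fock K)) 0 := by
  simp [HasTr, diag, hasSum_zero]

/-- Moving a creation operator once round the trace: if it picks up the factors `t ^ p`, `t ^ q` and
the remainders `RU`, `RV` on its way, the trace is determined by those of the remainders. -/
lemma hasTr_mul_aPlus_mul [IsTopologicalRing E] [T3Space E] (hE : IsSummationField t E)
    {U V RU RV : Module.End K (Fock K)} {p q : ℕ} {a b : K} (hpq : 1 ≤ p + q)
    (hU : U * aPlus K = t ^ p • (aPlus K * U) + RU)
    (hV : V * aPlus K = t ^ q • (aPlus K * V) + RV)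
    (ha : HasTr E (RU * V) a) (hb : HasTr E (U * RV) b) :
    HasTr E (U * aPlus K * V) ((a + t ^ p * b) / (1 - t ^ (p + q))) := by
  have h1 : U * aPlus K * V = t ^ p • (aPlus K * (U * V)) + RU * V := by
    rw [hU, add_mul, smul_mul_assoc, mul_assoc]
  have h2 : U * V * aPlus K = t ^ q • (U * aPlus K * V) + U * RV := by
    rw [mul_assoc, hV, mul_add, mul_smul_comm, mul_assoc]
  have h3 : HasTr E (aPlus K * (U * V)) ((t ^ q * a + b) / (1 - t ^ (p + q))) := by
    refine hasSum_of_recurrence hE hpq (r := fun d => t ^ q * diag (RU * V) d + diag (U * RV) d)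
      (diag_aPlus_mul_zero _) (fun d => ?_) ?_
    · rw [diag_aPlus_mul_succ, h2, h1, diag_add, diag_smul, diag_add, diag_smul]
      ring
    · have := (ha.smul (t ^ q)).add hb
      simpa [HasTr, diag_add, diag_smul] using this
  have h4 := (h3.smul (t ^ p)).add ha
  rw [← h1] at h4
  convert h4 using 1
  have hne : 1 - t ^ (p + q) ≠ 0 := sub_ne_zero.mpr (hE.pow_ne_one _ hpq).symm
  field_simp
  ring

end HasTr

/-! ### One vertex: the trace as a sum over pairings -/

/-- The state of an edge that is occupied precisely if `p` holds. -/
def bit (p : Prop) [Decidable p] : Fin 2 := if p then 1 else 0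

/-- The vertex weight in the layer `k`, where `I`, `J` are the layers in which the left and the
bottom edge are occupied, and `C ⊆ J` those in which the right edge is occupied. In terms of
pairings, `I` is the set of the balls that look for a partner, `J` the set of free balls in the row
above, and `C` the set of those that are going to be chosen. -/
def site {K : Type*} [Field K] (t : K) {L : ℕ} (I J C : Finset (Fin L)) (k : Fin L) :
    Module.End K (Fock K) :=
  vertexWeight t (bit (k ∈ I)) (bit (k ∈ C)) (bit (k ∈ J)) (bit (k ∈ J ∧ k ∉ C))

/-- The ordered product of the vertex weights `site t I J C k` over the layers. -/
def word {K : Type*} [Field K] (t : K) {L : ℕ} (I J C : Finset (Fin L)) :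
    Module.End K (Fock K) :=
  (List.ofFn (site t I J C)).prod

/-- The elements of `F` in the columns `j + 1, …, i - 1`, cyclically. -/
def between {L : ℕ} (j i : Fin L) (F : Finset (Fin L)) : Finset (Fin L) :=
  F.filter fun x => (j < x ∧ x < i) ∨ (i < j ∧ (j < x ∨ x < i))

/-- The weight of the pair of a ball in column `i` and its partner in column `j ≠ i`, if the balls
in `F` are free. -/
def hopWeight {K : Type*} [Field K] (t : K) {L : ℕ} (i j : Fin L) (F : Finset (Fin L)) : K :=
  (1 - t) * t ^ (between j i F).card / (1 - t ^ F.card)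

/-- The weighted number of the ways in which the balls in the list choose, one after the other,
their partners among the free balls `J` so that the set of chosen balls is `C`. -/
def chooseSum {K : Type*} [Field K] (t : K) {L : ℕ} :
    List (Fin L) → Finset (Fin L) → Finset (Fin L) → K
  | [], _, C => if C = ∅ then 1 else 0
  | i :: is, J, C =>
    if i ∈ J then (if i ∈ C then chooseSum t is (J.erase i) (C.erase i) else 0)
    else ∑ j ∈ C, hopWeight t i j J * chooseSum t is (J.erase j) (C.erase j)

section

variable {K : Type*} [Field K] {t : K} {L : ℕ}

/-- Commuting an element `a` to the left through a product of factors each of which commutes with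
`a` up to a scalar and a remainder. -/
lemma map_prod_mul_eq {R : Type*} [Ring R] [Algebra K R] (X Y : Fin L → R) (τ : Fin L → K) (a : R)
    (l : List (Fin L)) (hl : l.Pairwise (· < ·))
    (h : ∀ k ∈ l, X k * a = τ k • (a * X k) + Y k) :
    (l.map X).prod * a = (∏ k ∈ l.toFinset, τ k) • (a * (l.map X).prod) +
      ∑ k ∈ l.toFinset, (∏ x ∈ l.toFinset.filter (k < ·), τ x) •
        (l.map (Function.update X k (Y k))).prod := by
  induction l with
  | nil => simp
  | cons x l ih =>
    rw [List.pairwise_cons] at hl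
    have hx : x ∉ l.toFinset := fun hx => lt_irrefl x (hl.1 x (List.mem_toFinset.mp hx))
    have ih' := ih hl.2 fun k hk => h k (List.mem_cons_of_mem x hk)
    rw [List.map_cons, List.prod_cons, mul_assoc, ih', List.toFinset_cons, Finset.prod_insert hx,
      Finset.sum_insert hx, mul_add, mul_smul_comm, ← mul_assoc (X x), h x List.mem_cons_self]
    have e1 : (insert x l.toFinset).filter (x < ·) = l.toFinset := by
      ext y
      simp only [Finset.mem_filter, Finset.mem_insert, List.mem_toFinset]
      constructor
      · rintro ⟨rfl | hy, hxy⟩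
        · exact absurd hxy (lt_irrefl _)
        · exact hy
      · exact fun hy => ⟨Or.inr hy, hl.1 y hy⟩
    have e2 : (l.map (Function.update X x (Y x))) = l.map X := by
      refine List.map_congr_left fun y hy => ?_
      rw [Function.update_of_ne]
      rintro rfl
      exact lt_irrefl _ (hl.1 _ hy)
    have e3 : ∀ k ∈ l.toFinset, (∏ y ∈ (insert x l.toFinset).filter (k < ·), τ y) •
        ((x :: l).map (Function.update X k (Y k))).prod =
        X x * ((∏ y ∈ l.toFinset.filter (k < ·), τ y) •
          (l.map (Function.update X k (Y k))).prod) := by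
      intro k hk
      have hxk := hl.1 k (List.mem_toFinset.mp hk)
      rw [Finset.filter_insert, if_neg (not_lt.mpr hxk.le), List.map_cons, List.prod_cons,
        Function.update_of_ne hxk.ne, mul_smul_comm]
    rw [Finset.sum_congr rfl e3, ← Finset.mul_sum, e1, List.map_cons, List.prod_cons, e2,
      Function.update_self, add_mul, smul_add, smul_mul_assoc, smul_smul, mul_comm (τ x), mul_assoc,
      add_assoc]

/-- If the ball in column `i` has been taken care of by the ball in column `k`, both are removed
from the sets of balls that are still available. -/
lemma site_mul_aPlus {I J C : Finset (Fin L)} (hCJ : C ⊆ J) {i k : Fin L} (hki : k ≠ i) :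
    site t I J C k * aPlus K = (if k ∈ J then t else 1) • (aPlus K * site t I J C k) +
      if k ∈ C then (1 - t) • site t (I.erase i) (J.erase k) (C.erase k) k else 0 := by
  by_cases hI : k ∈ I <;> by_cases hJ : k ∈ J <;> by_cases hC : k ∈ C
  all_goals try exact absurd (hCJ hC) hJ
  all_goals simp [site, bit, vertexWeight, hI, hJ, hC, hki, opK_mul_aPlus, aMinus_mul_aPlus,
    ← add_smul]

lemma site_erase_of_ne {I J C : Finset (Fin L)} {i j k : Fin L} (hki : k ≠ i) (hkj : k ≠ j) :
    site t (I.erase i) (J.erase j) (C.erase j) k = site t I J C k := by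
  simp [site, hki, hkj]

lemma map_update_smul_prod {R : Type*} [Ring R] [Algebra K R] (X : Fin L → R) (k : Fin L) (c : K)
    (y : R) (l : List (Fin L)) (hl : l.Nodup) (hk : k ∈ l) :
    (l.map (Function.update X k (c • y))).prod = c • (l.map (Function.update X k y)).prod := by
  induction l with
  | nil => simp at hk
  | cons x l ih =>
    rw [List.nodup_cons] at hl
    simp only [List.map_cons, List.prod_cons]
    by_cases hx : x = k
    · subst hx
      have : ∀ z : R, l.map (Function.update X x z) = l.map X := fun z =>
        List.map_congr_left fun w hw => Function.update_of_ne (by rintro rfl; exact hl.1 hw) _ _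
      simp [this]
    · rw [ih hl.2 ((List.mem_cons.mp hk).resolve_left (Ne.symm hx)), Function.update_of_ne hx,
        Function.update_of_ne hx, mul_smul_comm]

lemma word_eq_map_prod (I J C : Finset (Fin L)) :
    word t I J C = ((List.finRange L).map (site t I J C)).prod := by
  rw [word, List.ofFn_eq_map]

lemma prod_ite_mem_eq_pow (S J : Finset (Fin L)) :
    ∏ x ∈ S, (if x ∈ J then t else 1) = t ^ (S ∩ J).card := by
  rw [Finset.prod_ite, Finset.prod_const_one, mul_one, Finset.prod_const,
    Finset.filter_mem_eq_inter]

/-- The trace of a word over the oscillator of one vertex counts the pairings of one colour class.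
The induction removes the first ball `i` of the list. If the ball above it is free, both sides
reduce at once. Otherwise the layer `i` carries a creation operator, which is moved round the
trace; the commutators with the layers `j ∈ C` correspond to the choice of the partner `j`. -/
theorem hasTr_word {E : Type*} [Field E] [TopologicalSpace E] [Algebra K E]
    [IsTopologicalRing E] [T3Space E] (hE : IsSummationField t E) (is : List (Fin L))
    (his : is.Nodup) (J C : Finset (Fin L)) (hCJ : C ⊆ J) (hf : 1 ≤ (J \ C).card) :
    HasTr E (word t is.toFinset J C) (chooseSum t is J C / (1 - t ^ (J \ C).card)) := by
  induction is generalizing J C with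
  | nil =>
    rw [chooseSum]
    by_cases hC : C = ∅
    · -- only factors `1` and `k` are left
      subst hC
      have hdiag : ∀ d, diag (word t [].toFinset J ∅) d = (t ^ J.card) ^ d := by
        intro d
        have : ∀ l : List (Fin L), l.Nodup →
            (l.map (site t [].toFinset J ∅)).prod (Finsupp.single d 1) =
              Finsupp.single d ((t ^ (l.toFinset ∩ J).card) ^ d) := by
          intro l hl
          induction l with
          | nil => simp
          | cons x l ih =>
            rw [List.nodup_cons] at hl
            rw [List.map_cons, List.prod_cons, Module.End.mul_apply, ih hl.2, List.toFinset_cons]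
            by_cases hx : x ∈ J
            · rw [Finset.insert_inter_of_mem hx, Finset.card_insert_of_notMem (by simp [hl.1])]
              simp [site, bit, vertexWeight, hx, pow_succ, mul_pow]
            · rw [Finset.insert_inter_of_notMem hx]
              simp [site, bit, vertexWeight, hx]
        rw [diag, word_eq_map_prod, this _ (List.nodup_finRange L)]
        simp [List.toFinset_finRange]
      rw [Finset.sdiff_empty] at hf ⊢
      simpa only [HasTr, hdiag, map_pow, map_inv₀, if_pos, one_div] using hE.hasSum_geometric _ hf
    · -- an annihilation operator is left, but no creation operator
      rw [if_neg hC, zero_div]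
      obtain ⟨c, hc⟩ := Finset.nonempty_iff_ne_empty.mpr hC
      have key : ∀ (l : List (Fin L)) (d : ℕ), ∃ (e : ℕ) (a : K),
          (l.map (site t [].toFinset J C)).prod (Finsupp.single d 1) = Finsupp.single e a ∧
            (a ≠ 0 → e + (l.filter (· ∈ C)).length = d) := by
        intro l d
        induction l with
        | nil => exact ⟨d, 1, by simp⟩
        | cons x l ih =>
          obtain ⟨e, a, h1, h2⟩ := ih
          rw [List.map_cons, List.prod_cons, Module.End.mul_apply, h1]
          by_cases hxC : x ∈ C
          · refine ⟨e - 1, a * (1 - t ^ e), ?_, fun h => ?_⟩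
            · simp [site, bit, vertexWeight, hxC, hCJ hxC]
            · have ha : a ≠ 0 := left_ne_zero_of_mul h
              have he : e ≠ 0 := by
                rintro rfl
                simp at h
              have := h2 ha
              simp only [hxC, decide_true, List.filter_cons_of_pos, List.length_cons]
              omega
          · by_cases hxJ : x ∈ J
            · refine ⟨e, a * t ^ e, ?_, fun h => ?_⟩
              · simp [site, bit, vertexWeight, hxC, hxJ]
              · simpa [hxC] using h2 (left_ne_zero_of_mul h)
            · refine ⟨e, a, ?_, fun h => ?_⟩
              · simp [site, bit, vertexWeight, hxC, hxJ]
              · simpa [hxC] using h2 h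
      have hdiag : ∀ d, diag (word t [].toFinset J C) d = 0 := by
        intro d
        obtain ⟨e, a, h1, h2⟩ := key (List.finRange L) d
        rw [diag, word_eq_map_prod, h1, Finsupp.single_apply]
        split_ifs with h
        · by_contra ha
          have h3 := h2 ha
          have : 0 < ((List.finRange L).filter (· ∈ C)).length :=
            List.length_pos_of_mem (a := c) (by simp [hc])
          omega
        · rfl
      simp only [HasTr, hdiag, map_zero, hasSum_zero]
  | cons i is ih =>
    rw [List.nodup_cons] at his
    have hI : (i :: is).toFinset.erase i = is.toFinset := by
      rw [List.toFinset_cons, Finset.erase_insert (by simp [his.1])]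
    have hiI : i ∈ (i :: is).toFinset := by simp
    generalize hIdef : (i :: is).toFinset = I at hI hiI
    -- the free balls that are never chosen remain the same
    have hsd : ∀ k ∈ C, J.erase k \ C.erase k = J \ C := by
      intro k hk
      ext x
      simp only [Finset.mem_sdiff, Finset.mem_erase]
      refine ⟨fun h => ⟨h.1.2, fun hx => h.2 ⟨h.1.1, hx⟩⟩, fun h => ⟨⟨?_, h.1⟩, fun hx => h.2 hx.2⟩⟩
      rintro rfl
      exact h.2 hk
    have ih' : ∀ k ∈ C, HasTr E (word t (I.erase i) (J.erase k) (C.erase k))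
        (chooseSum t is (J.erase k) (C.erase k) / (1 - t ^ (J \ C).card)) := by
      intro k hk
      have := ih his.2 (J.erase k) (C.erase k) (Finset.erase_subset_erase k hCJ)
        (by rw [hsd k hk]; exact hf)
      rwa [hsd k hk, ← hI] at this
    rw [chooseSum]
    by_cases hiJ : i ∈ J
    · rw [if_pos hiJ]
      by_cases hiC : i ∈ C
      · rw [if_pos hiC]
        convert ih' i hiC using 1
        rw [word, word]
        congr 2
        funext k
        by_cases hk : k = i
        · subst hk
          simp [site, bit, vertexWeight, hiI, hiJ, hiC]
        · rw [site_erase_of_ne hk hk]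
      · rw [if_neg hiC, zero_div]
        have : word t I J C = 0 := by
          rw [word, List.prod_eq_zero]
          rw [List.mem_ofFn]
          exact ⟨i, by simp [site, bit, vertexWeight, hiI, hiJ, hiC]⟩
        rw [this]
        exact hasTr_zero
    · rw [if_neg hiJ]
      have hiC : i ∉ C := fun h => hiJ (hCJ h)
      -- `l₁` and `l₂` are the layers before and after the layer `i`
      obtain ⟨l₁, l₂, hl⟩ := List.append_of_mem (List.mem_finRange i)
      have hsort := List.pairwise_lt_finRange L
      rw [hl, List.pairwise_append, List.pairwise_cons] at hsort
      obtain ⟨hs₁, ⟨hi₂, hs₂⟩, h₁₂⟩ := hsort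
      have hi₁ : ∀ k ∈ l₁, k < i := fun k hk => h₁₂ k hk i List.mem_cons_self
      have hm₁ : ∀ k, k ∈ l₁ ↔ k < i := by
        refine fun k => ⟨hi₁ k, fun hk => ?_⟩
        have := List.mem_finRange k
        rw [hl, List.mem_append, List.mem_cons] at this
        rcases this with h | rfl | h
        · exact h
        · exact absurd hk (lt_irrefl _)
        · exact absurd hk (hi₂ k h).asymm
      have hm₂ : ∀ k, k ∈ l₂ ↔ i < k := by
        refine fun k => ⟨hi₂ k, fun hk => ?_⟩
        have := List.mem_finRange k
        rw [hl, List.mem_append, List.mem_cons] at this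
        rcases this with h | rfl | h
        · exact absurd hk (hi₁ k h).asymm
        · exact absurd hk (lt_irrefl _)
        · exact h
      have hsplit : ∀ I' J' C' : Finset (Fin L), word t I' J' C' =
          (l₁.map (site t I' J' C')).prod * site t I' J' C' i *
            (l₂.map (site t I' J' C')).prod := by
        intro I' J' C'
        rw [word_eq_map_prod, hl, List.map_append, List.map_cons, List.prod_append, List.prod_cons,
          mul_assoc]
      have hsi : site t I J C i = aPlus K := by
        simp [site, bit, vertexWeight, hiI, hiJ, hiC]
      -- `Y k` is the remainder when the creation operator passes the layer `k`
      set Y : Fin L → Module.End K (Fock K) := fun k =>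
        (if k ∈ C then (1 - t) else 0) • site t (I.erase i) (J.erase k) (C.erase k) k with hY
      set τ : Fin L → K := fun k => if k ∈ J then t else 1 with hτ
      have hcomm : ∀ k, k ≠ i →
          site t I J C k * aPlus K = τ k • (aPlus K * site t I J C k) + Y k := by
        intro k hk
        rw [site_mul_aPlus hCJ hk]
        simp only [hY, hτ, ite_smul, zero_smul]
      have hU := map_prod_mul_eq (site t I J C) Y τ (aPlus K) l₁ hs₁
        fun k hk => hcomm k (hi₁ k hk).ne
      have hV := map_prod_mul_eq (site t I J C) Y τ (aPlus K) l₂ hs₂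
        fun k hk => hcomm k (hi₂ k hk).ne'
      have hone : ∀ k, site t (I.erase i) (J.erase k) (C.erase k) i = 1 := by
        intro k
        simp [site, bit, vertexWeight, hiJ, hiC]
      have hupd : ∀ l : List (Fin L), l.Nodup → i ∉ l → ∀ k ∈ l,
          (l.map (Function.update (site t I J C) k (Y k))).prod = (if k ∈ C then (1 - t) else 0) •
            (l.map (site t (I.erase i) (J.erase k) (C.erase k))).prod := by
        intro l hnd hil k hk
        refine (map_update_smul_prod (K := K) (site t I J C) k _ _ l hnd hk).trans ?_
        congr 2
        refine List.map_congr_left fun x hx => ?_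
        by_cases hxk : x = k
        · subst hxk
          rw [Function.update_self]
        · rw [Function.update_of_ne hxk, site_erase_of_ne (by rintro rfl; exact hil hx) hxk]
      have hkeep : ∀ l : List (Fin L), i ∉ l → ∀ k, k ∉ l →
          l.map (site t (I.erase i) (J.erase k) (C.erase k)) = l.map (site t I J C) := by
        intro l hil k hk
        refine List.map_congr_left fun x hx => ?_
        exact site_erase_of_ne (by rintro rfl; exact hil hx) (by rintro rfl; exact hk hx)
      have hi₁' : i ∉ l₁ := fun h => lt_irrefl _ (hi₁ i h)
      have hi₂' : i ∉ l₂ := fun h => lt_irrefl _ (hi₂ i h)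
      have hn₁ : l₁.Nodup := hs₁.imp fun h => h.ne
      have hn₂ : l₂.Nodup := hs₂.imp fun h => h.ne
      set val : Fin L → K := fun k =>
        chooseSum t is (J.erase k) (C.erase k) / (1 - t ^ (J \ C).card) with hval
      have hword₁ : ∀ k ∈ l₁, (l₁.map (site t (I.erase i) (J.erase k) (C.erase k))).prod *
          (l₂.map (site t I J C)).prod = word t (I.erase i) (J.erase k) (C.erase k) := by
        intro k hk
        rw [hsplit, hone, mul_one, hkeep l₂ hi₂' k
          (fun h => lt_irrefl _ ((hi₁ k hk).trans (hi₂ k h)))]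
      have hword₂ : ∀ k ∈ l₂, (l₁.map (site t I J C)).prod *
          (l₂.map (site t (I.erase i) (J.erase k) (C.erase k))).prod =
            word t (I.erase i) (J.erase k) (C.erase k) := by
        intro k hk
        rw [hsplit, hone, mul_one, hkeep l₁ hi₁' k
          (fun h => lt_irrefl _ ((hi₂ k hk).trans (hi₁ k h)))]
      have hterm : ∀ k (c : K), HasTr E
          ((c * if k ∈ C then (1 - t) else 0) • word t (I.erase i) (J.erase k) (C.erase k))
          ((c * if k ∈ C then (1 - t) else 0) * val k) := by
        intro k c
        by_cases hk : k ∈ C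
        · exact (ih' k hk).smul _
        · rw [if_neg hk, mul_zero, zero_smul, zero_mul]
          exact hasTr_zero
      have hτp : ∀ S : Finset (Fin L), ∏ x ∈ S, τ x = t ^ (S ∩ J).card :=
        fun S => prod_ite_mem_eq_pow S J
      have hcardJ : (l₁.toFinset ∩ J).card + (l₂.toFinset ∩ J).card = J.card := by
        rw [← Finset.card_union_of_disjoint]
        · congr 1
          ext x
          simp only [Finset.mem_union, Finset.mem_inter, List.mem_toFinset, hm₁, hm₂]
          refine ⟨fun h => h.elim And.right And.right, fun h => ?_⟩
          rcases lt_trichotomy x i with h' | rfl | h'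
          · exact Or.inl ⟨h', h⟩
          · exact absurd h hiJ
          · exact Or.inr ⟨h', h⟩
        · rw [Finset.disjoint_left]
          intro x hx hx'
          simp only [Finset.mem_inter, List.mem_toFinset, hm₁, hm₂] at hx hx'
          exact lt_irrefl _ (hx.1.trans hx'.1)
      have hJ1 : 1 ≤ (l₁.toFinset ∩ J).card + (l₂.toFinset ∩ J).card := by
        rw [hcardJ]
        exact hf.trans (Finset.card_le_card Finset.sdiff_subset)
      rw [hτp] at hU hV
      have hmain := hasTr_mul_aPlus_mul (E := E) hE hJ1 hU hV
        (a := ∑ k ∈ l₁.toFinset, (t ^ (l₁.toFinset.filter (k < ·) ∩ J).card *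
          if k ∈ C then (1 - t) else 0) * val k)
        (b := ∑ k ∈ l₂.toFinset, (t ^ (l₂.toFinset.filter (k < ·) ∩ J).card *
          if k ∈ C then (1 - t) else 0) * val k)
        (by
          rw [Finset.sum_mul]
          refine HasTr.sum _ fun k hk => ?_
          rw [List.mem_toFinset] at hk
          rw [hupd l₁ hn₁ hi₁' k hk, hτp, smul_smul, smul_mul_assoc, hword₁ k hk]
          exact hterm k _)
        (by
          rw [Finset.mul_sum]
          refine HasTr.sum _ fun k hk => ?_
          rw [List.mem_toFinset] at hk
          rw [hupd l₂ hn₂ hi₂' k hk, hτp, smul_smul, mul_smul_comm, hword₂ k hk]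
          exact hterm k _)
      rw [hsplit, hsi]
      convert hmain using 1
      rw [hcardJ, Finset.mul_sum, Finset.sum_div]
      -- the powers of `t` that are picked up on the way count the skipped balls
      have hb₁ : ∀ k ∈ l₁, l₁.toFinset.filter (k < ·) ∩ J = between k i J := by
        intro k hk
        ext x
        have := hi₁ k hk
        simp only [Finset.mem_inter, Finset.mem_filter, List.mem_toFinset, hm₁, between]
        constructor
        · rintro ⟨⟨h1, h2⟩, h3⟩
          exact ⟨h3, Or.inl ⟨h2, h1⟩⟩
        · rintro ⟨h3, ⟨h1, h2⟩ | ⟨h4, -⟩⟩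
          · exact ⟨⟨h2, h1⟩, h3⟩
          · exact absurd h4 this.asymm
      have hb₂ : ∀ k ∈ l₂, (l₁.toFinset ∩ J).card + (l₂.toFinset.filter (k < ·) ∩ J).card =
          (between k i J).card := by
        intro k hk
        have hik := hi₂ k hk
        rw [← Finset.card_union_of_disjoint]
        · congr 1
          ext x
          simp only [Finset.mem_union, Finset.mem_inter, Finset.mem_filter, List.mem_toFinset, hm₁,
            hm₂, between]
          constructor
          · rintro (⟨h1, h2⟩ | ⟨⟨h1, h2⟩, h3⟩)
            · exact ⟨h2, Or.inr ⟨hik, Or.inr h1⟩⟩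
            · exact ⟨h3, Or.inr ⟨hik, Or.inl h2⟩⟩
          · rintro ⟨h3, ⟨h1, h2⟩ | ⟨h4, h5 | h5⟩⟩
            · exact absurd (h1.trans h2) hik.asymm
            · exact Or.inr ⟨⟨hik.trans h5, h5⟩, h3⟩
            · exact Or.inl ⟨h5, h3⟩
        · rw [Finset.disjoint_left]
          intro x hx hx'
          simp only [Finset.mem_inter, Finset.mem_filter, List.mem_toFinset, hm₁, hm₂] at hx hx'
          exact lt_irrefl _ (hx.1.trans hx'.1.1)
      have hsum : ∀ g : Fin L → K, ∑ k ∈ C, g k =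
          (∑ k ∈ l₁.toFinset, if k ∈ C then g k else 0) +
            ∑ k ∈ l₂.toFinset, if k ∈ C then g k else 0 := by
        intro g
        rw [← Finset.sum_filter, ← Finset.sum_filter, ← Finset.sum_union]
        · refine Finset.sum_congr ?_ fun _ _ => rfl
          ext x
          simp only [Finset.mem_union, Finset.mem_filter, List.mem_toFinset, hm₁, hm₂]
          refine ⟨fun h => ?_, fun h => h.elim And.right And.right⟩
          rcases lt_trichotomy x i with h' | rfl | h'
          · exact Or.inl ⟨h', h⟩
          · exact absurd h hiC
          · exact Or.inr ⟨h', h⟩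
        · rw [Finset.disjoint_left]
          intro x hx hx'
          simp only [Finset.mem_filter, List.mem_toFinset, hm₁, hm₂] at hx hx'
          exact lt_irrefl _ (hx.1.trans hx'.1)
      rw [hsum, add_div, Finset.sum_div, Finset.sum_div]
      congr 1
      · refine Finset.sum_congr rfl fun k hk => ?_
        rw [List.mem_toFinset] at hk
        rw [hb₁ k hk]
        split_ifs
        · simp only [hopWeight, hval]
          ring
        · ring
      · refine Finset.sum_congr rfl fun k hk => ?_
        rw [List.mem_toFinset] at hk
        split_ifs
        · simp only [hopWeight, hval]
          rw [← hb₂ k hk, pow_add]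
          ring
        · ring

end

/-! ### Two rows: sums over all pairings -/

/-- The weighted number of the ways in which the balls in the list (the ball in column `i` having
the colour `τ i`) choose, one after the other, their partners among the free balls `J` so that the
resulting colours are given by `σ`, the balls that are left over having the colour `b`. -/
def queueSum {K : Type*} [Field K] (t : K) {N L : ℕ} (b : Fin (N + 2)) (τ σ : Config N L) :
    List (Fin L) → Finset (Fin L) → K
  | [], J => if ∀ j ∈ J, σ j = b then 1 else 0
  | i :: is, J =>
    if i ∈ J then (if σ i = τ i then queueSum t b τ σ is (J.erase i) else 0)
    else ∑ j ∈ J.filter (σ · = τ i), hopWeight t i j J * queueSum t b τ σ is (J.erase j)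

section

variable {K : Type*} [Field K] {t : K} {N L : ℕ}

/-- If there are as many balls of each colour `y > b` before and after, and the balls choose in the
order of decreasing colour, the colour classes decouple: for the colour `y` only the balls that end
up with a colour `≤ y` are free. -/
lemma queueSum_eq_prod (b : Fin (N + 2)) (τ σ : Config N L) (is : List (Fin L))
    (J : Finset (Fin L)) (hsort : is.Pairwise fun i j => τ j ≤ τ i) (hb : ∀ i ∈ is, b < τ i)
    (hJ : ∀ j ∈ J, b ≤ σ j)
    (hbal : ∀ y, b < y → (is.filter (τ · = y)).length = (J.filter (σ · = y)).card) :
    queueSum t b τ σ is J = ∏ y ∈ Finset.Ioi b,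
      chooseSum t (is.filter (τ · = y)) (J.filter (σ · ≤ y)) (J.filter (σ · = y)) := by
  induction is generalizing J with
  | nil =>
    have h0 : ∀ y, b < y → J.filter (σ · = y) = ∅ := fun y hy => by
      rw [← Finset.card_eq_zero, ← hbal y hy]; rfl
    rw [queueSum, if_pos]
    · refine (Finset.prod_eq_one fun y hy => ?_).symm
      rw [Finset.mem_Ioi] at hy
      simp [chooseSum, h0 y hy]
    · intro j hj
      by_contra hne
      have := h0 (σ j) (lt_of_le_of_ne (hJ j hj) (Ne.symm hne))
      exact Finset.notMem_empty j (this ▸ Finset.mem_filter.mpr ⟨hj, rfl⟩)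
  | cons i is ih =>
    rw [List.pairwise_cons] at hsort
    have hbi : b < τ i := hb i List.mem_cons_self
    have hle : ∀ j ∈ J, σ j ≤ τ i := by
      intro j hj
      by_contra hlt
      rw [not_le] at hlt
      have h1 : 0 < (J.filter (σ · = σ j)).card :=
        Finset.card_pos.mpr ⟨j, Finset.mem_filter.mpr ⟨hj, rfl⟩⟩
      rw [← hbal _ (hbi.trans hlt)] at h1
      obtain ⟨x, hx⟩ := List.exists_mem_of_length_pos h1
      rw [List.mem_filter, List.mem_cons, decide_eq_true_iff] at hx
      rcases hx with ⟨rfl | hx, hxj⟩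
      · exact absurd hxj hlt.ne
      · exact absurd (hsort.1 x hx) (by rw [hxj, not_le]; exact hlt)
    have hJi : J.filter (σ · ≤ τ i) = J := Finset.filter_true_of_mem hle
    have hmem : τ i ∈ Finset.Ioi b := Finset.mem_Ioi.mpr hbi
    -- the colour classes other than that of `i` are not affected by the choice of `i`
    have hstep : ∀ j ∈ J, σ j = τ i → queueSum t b τ σ is (J.erase j) =
        chooseSum t (is.filter (τ · = τ i)) (J.erase j) ((J.filter (σ · = τ i)).erase j) *
          ∏ y ∈ (Finset.Ioi b).erase (τ i), chooseSum t ((i :: is).filter (τ · = y))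
            (J.filter (σ · ≤ y)) (J.filter (σ · = y)) := by
      intro j hj hji
      have hne : ∀ y, y ≠ τ i → (J.erase j).filter (σ · = y) = J.filter (σ · = y) := by
        intro y hy
        rw [Finset.filter_erase, Finset.erase_eq_of_notMem]
        simp only [Finset.mem_filter, not_and]
        exact fun _ h => hy (h ▸ hji)
      rw [ih (J.erase j) hsort.2 (fun k hk => hb k (List.mem_cons_of_mem i hk))
        (fun k hk => hJ k (Finset.mem_of_mem_erase hk)), ← Finset.mul_prod_erase _ _ hmem]
      · congr 1
        · rw [Finset.filter_erase, Finset.filter_erase, hJi]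
        · refine Finset.prod_congr rfl fun y hy => ?_
          rw [Finset.mem_erase, Finset.mem_Ioi] at hy
          have hiy : (i :: is).filter (τ · = y) = is.filter (τ · = y) := by
            rw [List.filter_cons_of_neg]
            simpa using Ne.symm hy.1
          rw [hiy, hne y hy.1]
          rcases lt_or_gt_of_ne hy.1 with hlt | hgt
          · rw [Finset.filter_erase, Finset.erase_eq_of_notMem]
            simp only [Finset.mem_filter, not_and, not_le]
            exact fun _ => hji ▸ hlt
          · have h1 : J.filter (σ · = y) = ∅ := by
              refine Finset.filter_false_of_mem fun k hk h => ?_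
              exact absurd (hle k hk) (by rw [h, not_le]; exact hgt)
            have h2 : is.filter (τ · = y) = [] := by
              rw [List.filter_eq_nil_iff]
              intro k hk h
              rw [decide_eq_true_iff] at h
              exact absurd (hsort.1 k hk) (by rw [h, not_le]; exact hgt)
            rw [h1, h2, chooseSum, chooseSum]
      · intro y hy
        by_cases hyi : y = τ i
        · subst hyi
          have := hbal _ hbi
          rw [List.filter_cons_of_pos (by simp), List.length_cons] at this
          rw [Finset.filter_erase, Finset.card_erase_of_mem (Finset.mem_filter.mpr ⟨hj, hji⟩),
            ← this, Nat.add_sub_cancel]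
        · rw [hne y hyi, ← hbal y hy, List.filter_cons_of_neg]
          simpa using Ne.symm hyi
    rw [← Finset.mul_prod_erase _ _ hmem, List.filter_cons_of_pos (by simp), queueSum, chooseSum,
      hJi]
    by_cases hiJ : i ∈ J
    · rw [if_pos hiJ, if_pos hiJ]
      by_cases hii : σ i = τ i
      · rw [if_pos hii, if_pos (Finset.mem_filter.mpr ⟨hiJ, hii⟩), hstep i hiJ hii]
      · rw [if_neg hii, if_neg (fun h => hii (Finset.mem_filter.mp h).2 :
          i ∉ J.filter (σ · = τ i)), zero_mul]
    · rw [if_neg hiJ, if_neg hiJ, Finset.sum_mul]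
      refine Finset.sum_congr rfl fun j hj => ?_
      rw [Finset.mem_filter] at hj
      rw [hstep j hj.1 hj.2, mul_assoc]

/-- The balls in `J` that are still free after the choices `g l`, `l < k`. -/
def remaining {n : ℕ} (J : Finset (Fin L)) (g : Fin n → Fin L) (k : Fin n) : Finset (Fin L) :=
  J.filter fun j => ∀ l < k, g l ≠ j

/-- The weight of the choice `g k` made by the `k`-th ball, which is in column `p k`; it vanishes if
the choice is not allowed. -/
def choiceWeight (t : K) (τ σ : Config N L) {n : ℕ} (J : Finset (Fin L)) (p g : Fin n → Fin L)
    (k : Fin n) : K :=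
  if g k ∈ remaining J g k ∧ (p k ∈ remaining J g k → g k = p k) ∧ σ (g k) = τ (p k) then
    (if g k = p k then 1 else hopWeight t (p k) (g k) (remaining J g k)) else 0

lemma remaining_cons_zero {n : ℕ} (J : Finset (Fin L)) (x : Fin L) (g : Fin n → Fin L) :
    remaining J (Fin.cons x g : Fin (n + 1) → Fin L) 0 = J := by
  simp [remaining]

lemma remaining_cons_succ {n : ℕ} (J : Finset (Fin L)) (x : Fin L) (g : Fin n → Fin L)
    (k : Fin n) : remaining J (Fin.cons x g : Fin (n + 1) → Fin L) k.succ =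
      remaining (J.erase x) g k := by
  ext j
  simp only [remaining, Finset.mem_filter, Finset.mem_erase]
  constructor
  · intro h
    refine ⟨⟨fun hj => h.2 0 (Fin.succ_pos k) (by simp [hj]), h.1⟩, fun l hl => ?_⟩
    simpa using h.2 l.succ (Fin.succ_lt_succ_iff.mpr hl)
  · intro h
    refine ⟨h.1.2, fun l hl => ?_⟩
    cases l using Fin.cases with
    | zero => simpa using Ne.symm h.1.1
    | succ l => simpa using h.2 l (Fin.succ_lt_succ_iff.mp hl)

open Classical in
lemma sum_choiceWeight (b : Fin (N + 2)) (τ σ : Config N L) {n : ℕ} (p : Fin n → Fin L)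
    (J : Finset (Fin L)) :
    ∑ g : Fin n → Fin L, (if ∀ j ∈ J, (∀ l, g l ≠ j) → σ j = b then 1 else 0) *
      ∏ k, choiceWeight t τ σ J p g k = queueSum t b τ σ (List.ofFn p) J := by
  induction n generalizing J with
  | zero => simp [queueSum]
  | succ n ih =>
    rw [← (Fin.consEquiv fun _ : Fin (n + 1) => Fin L).sum_comp, Fintype.sum_prod_type,
      List.ofFn_succ, queueSum]
    have hc : ∀ (x : Fin L) (g : Fin n → Fin L),
        (Fin.consEquiv fun _ : Fin (n + 1) => Fin L) (x, g) =
        (Fin.cons x g : Fin (n + 1) → Fin L) := fun _ _ => rfl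
    have hx : ∀ x : Fin L, ∑ g : Fin n → Fin L,
        (if ∀ j ∈ J, (∀ l, (Fin.consEquiv fun _ : Fin (n + 1) => Fin L) (x, g) l ≠ j) → σ j = b
          then (1 : K) else 0) * ∏ k, choiceWeight t τ σ J p
            ((Fin.consEquiv fun _ : Fin (n + 1) => Fin L) (x, g)) k =
        (if x ∈ J ∧ (p 0 ∈ J → x = p 0) ∧ σ x = τ (p 0) then
          (if x = p 0 then 1 else hopWeight t (p 0) x J) else 0) *
            queueSum t b τ σ (List.ofFn fun k => p k.succ) (J.erase x) := by
      intro x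
      rw [← ih, Finset.mul_sum]
      refine Finset.sum_congr rfl fun g _ => ?_
      rw [Fin.prod_univ_succ]
      have h0 : choiceWeight t τ σ J p ((Fin.consEquiv fun _ : Fin (n + 1) => Fin L) (x, g)) 0 =
          if x ∈ J ∧ (p 0 ∈ J → x = p 0) ∧ σ x = τ (p 0) then
            (if x = p 0 then 1 else hopWeight t (p 0) x J) else 0 := by
        simp only [choiceWeight, hc, remaining_cons_zero, Fin.cons_zero]
      have hs : ∀ k : Fin n, choiceWeight t τ σ J p
          ((Fin.consEquiv fun _ : Fin (n + 1) => Fin L) (x, g)) k.succ =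
            choiceWeight t τ σ (J.erase x) (fun k => p k.succ) g k := by
        intro k
        simp only [choiceWeight, hc, remaining_cons_succ, Fin.cons_succ]
      have hf : (∀ j ∈ J, (∀ l, (Fin.consEquiv fun _ : Fin (n + 1) => Fin L) (x, g) l ≠ j) →
          σ j = b) ↔ ∀ j ∈ J.erase x, (∀ l, g l ≠ j) → σ j = b := by
        simp only [hc, Fin.forall_fin_succ, Fin.cons_zero, Fin.cons_succ,
          Finset.mem_erase]
        exact ⟨fun h j hj hg => h j hj.2 ⟨Ne.symm hj.1, hg⟩,
          fun h j hj hg => h j ⟨Ne.symm hg.1, hj⟩ hg.2⟩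
      rw [h0, Finset.prod_congr rfl fun k _ => hs k, if_congr hf rfl rfl]
      ring
    rw [Finset.sum_congr rfl fun x _ => hx x]
    by_cases hp : p 0 ∈ J
    · rw [if_pos hp, Finset.sum_eq_single (p 0)]
      · simp [hp]
      · intro x _ hx
        rw [if_neg (fun h => hx (h.2.1 hp)), zero_mul]
      · simp
    · rw [if_neg hp, Finset.sum_filter, ← Finset.sum_subset (Finset.subset_univ J)]
      · refine Finset.sum_congr rfl fun x hx => ?_
        have : x ≠ p 0 := fun h => hp (h ▸ hx)
        by_cases hσ : σ x = τ (p 0) <;> simp [hx, hp, this, hσ]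
      · intro x _ hx
        rw [if_neg (fun h => hx h.1), zero_mul]

/-- The columns that contain a ball. -/
def supp (σ : Config N L) : Finset (Fin L) := Finset.univ.filter (σ · ≠ 0)

/-- The ball `d'` looks for its partner before the ball `d`. -/
def Before (τ : Config N L) (d' d : Fin L) : Prop := τ d < τ d' ∨ (τ d' = τ d ∧ d' < d)

lemma exists_chooserOrder (τ : Config N L) :
    ∃ e : Fin (supp τ).card ≃ {j // j ∈ supp τ}, ∀ k l, k < l ↔ Before τ (e k) (e l) := by
  let key : {j // j ∈ supp τ} → (Fin (N + 2))ᵒᵈ ×ₗ Fin L :=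
    fun j => toLex (OrderDual.toDual (τ j), (j : Fin L))
  have hkey : Function.Injective key := by
    intro i j h
    have := congrArg (fun x => (ofLex x).2) h
    exact Subtype.ext this
  let o : LinearOrder {j // j ∈ supp τ} := LinearOrder.lift' key hkey
  have hlt : ∀ i j : {j // j ∈ supp τ}, o.lt i j ↔ Before τ i j := by
    intro i j
    have : o.lt i j ↔ key i < key j := Iff.rfl
    rw [this, Prod.Lex.lt_iff]
    simp [key, Before]
  let f := @monoEquivOfFin {j // j ∈ supp τ} _ o (supp τ).card (by simp)
  refine ⟨f.toEquiv, fun k l => ?_⟩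
  rw [← hlt]
  exact (@OrderIso.lt_iff_lt _ _ (inferInstanceAs (Preorder (Fin (supp τ).card)))
    o.toPartialOrder.toPreorder f k l).symm

/-- The order in which the balls of a row with the colours `τ` look for their partners. -/
def chooserOrder (τ : Config N L) : Fin (supp τ).card ≃ {j // j ∈ supp τ} :=
  (exists_chooserOrder τ).choose

lemma chooserOrder_lt (τ : Config N L) (k l : Fin (supp τ).card) :
    k < l ↔ Before τ (chooserOrder τ k) (chooserOrder τ l) :=
  (exists_chooserOrder τ).choose_spec k l

/-- The balls of a row with the colours `τ`, in the order in which they look for their partners. -/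
def chooserList (τ : Config N L) : List (Fin L) :=
  List.ofFn fun k => (chooserOrder τ k : Fin L)

lemma mem_chooserList (τ : Config N L) (j : Fin L) : j ∈ chooserList τ ↔ τ j ≠ 0 := by
  rw [chooserList, List.mem_ofFn]
  constructor
  · rintro ⟨k, rfl⟩
    exact (Finset.mem_filter.mp (chooserOrder τ k).2).2
  · intro h
    exact ⟨(chooserOrder τ).symm ⟨j, by simp [supp, h]⟩, by simp⟩

lemma nodup_chooserList (τ : Config N L) : (chooserList τ).Nodup := by
  rw [chooserList, List.nodup_ofFn]
  exact Subtype.val_injective.comp (chooserOrder τ).injective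

lemma sorted_chooserList (τ : Config N L) : (chooserList τ).Pairwise fun i j => τ j ≤ τ i := by
  rw [chooserList, List.pairwise_ofFn]
  intro k l hkl
  rcases (chooserOrder_lt τ k l).mp hkl with h | h
  · exact h.le
  · exact h.1.ge

/-- The balls of the upper row (with the columns `J`) that are free when `d` looks for its
partner. -/
def freeFor (τ : Config N L) {I J : Finset (Fin L)} (φ : {j // j ∈ I} ↪ {j // j ∈ J})
    (d : {j // j ∈ I}) : Finset (Fin L) :=
  open Classical in J.filter fun j => ∀ d' : {j // j ∈ I}, Before τ d' d → (φ d' : Fin L) ≠ j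

/-- The pairing `φ` between a row with the colours `τ` and the row above is allowed and gives the
colours `σ` to the latter, where unpaired balls get the colour `b`. -/
def IsQueue (b : Fin (N + 2)) (τ σ : Config N L)
    (φ : {j // j ∈ supp τ} ↪ {j // j ∈ supp σ}) : Prop :=
  (∀ d, (d : Fin L) ∈ freeFor τ φ d → (φ d : Fin L) = d) ∧ (∀ d, σ (φ d) = τ d) ∧
    ∀ j ∈ supp σ, (∀ d, (φ d : Fin L) ≠ j) → σ j = b

/-- The product of the weights of all pairs. -/
def queueWeight (t : K) (τ : Config N L) {I J : Finset (Fin L)}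
    (φ : {j // j ∈ I} ↪ {j // j ∈ J}) : K :=
  ∏ d : {j // j ∈ I}, if (φ d : Fin L) = d then 1 else hopWeight t d (φ d) (freeFor τ φ d)

open Classical in
/-- Choosing the partners one after the other gives each pairing once. -/
lemma sum_queueWeight (b : Fin (N + 2)) (τ σ : Config N L) :
    ∑ φ : {j // j ∈ supp τ} ↪ {j // j ∈ supp σ},
      (if IsQueue b τ σ φ then queueWeight t τ φ else 0) =
        queueSum t b τ σ (chooserList τ) (supp σ) := by
  rw [chooserList, ← sum_choiceWeight]
  set e := chooserOrder τ with he
  have hrem : ∀ (φ : {j // j ∈ supp τ} ↪ {j // j ∈ supp σ}) k,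
      remaining (supp σ) (fun k => (φ (e k) : Fin L)) k = freeFor τ φ (e k) := by
    intro φ k
    simp only [remaining, freeFor]
    refine Finset.filter_congr fun j _ => ?_
    rw [← e.forall_congr_right]
    refine forall_congr' fun l => ?_
    rw [chooserOrder_lt]
  refine Fintype.sum_of_injective (fun φ k => (φ (e k) : Fin L)) ?_ _ _ ?_ ?_
  · intro φ ψ h
    refine DFunLike.ext _ _ fun d => Subtype.ext ?_
    simpa using congrFun h (e.symm d)
  · intro g hg
    by_contra hne
    rw [mul_eq_zero, not_or, Finset.prod_eq_zero_iff, not_exists] at hne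
    have hk : ∀ k, g k ∈ remaining (supp σ) g k := by
      intro k
      by_contra h
      exact hne.2 k ⟨Finset.mem_univ _, if_neg fun h' => h h'.1⟩
    have hinj : Function.Injective g := by
      intro k l hkl
      rcases lt_trichotomy k l with h | h | h
      · exact absurd hkl ((Finset.mem_filter.mp (hk l)).2 k h)
      · exact h
      · exact absurd hkl.symm ((Finset.mem_filter.mp (hk k)).2 l h)
    refine hg ⟨⟨fun d => ⟨g (e.symm d), (Finset.mem_filter.mp (hk _)).1⟩, ?_⟩, ?_⟩
    · intro d d' h
      exact e.symm.injective (hinj (Subtype.mk.inj h))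
    · funext k
      change g (e.symm (e k)) = g k
      rw [e.symm_apply_apply]
  · intro φ
    have hfin : (∀ j ∈ supp σ, (∀ l, (φ (e l) : Fin L) ≠ j) → σ j = b) ↔
        ∀ j ∈ supp σ, (∀ d, (φ d : Fin L) ≠ j) → σ j = b := by
      refine forall₂_congr fun j _ => ?_
      rw [← e.forall_congr_right]
    rw [if_congr hfin rfl rfl]
    by_cases hq : IsQueue b τ σ φ
    · rw [if_pos hq, if_pos hq.2.2, one_mul, queueWeight, ← e.prod_comp]
      refine Finset.prod_congr rfl fun k _ => ?_
      have hfree : (φ (e k) : Fin L) ∈ freeFor τ φ (e k) := by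
        refine Finset.mem_filter.mpr ⟨(φ (e k)).2, fun d' hd' h => ?_⟩
        have := φ.injective (Subtype.ext h)
        subst this
        exact absurd ((chooserOrder_lt τ k k).mpr hd') (lt_irrefl k)
      have hpos : (φ (e k) : Fin L) ∈ freeFor τ φ (e k) ∧ (((e k : Fin L) ∈ freeFor τ φ (e k)) →
          (φ (e k) : Fin L) = e k) ∧ σ (φ (e k)) = τ (e k) := ⟨hfree, hq.1 (e k), hq.2.1 (e k)⟩
      rw [choiceWeight, hrem, if_pos hpos]
    · rw [if_neg hq]
      by_cases h3 : ∀ j ∈ supp σ, (∀ d, (φ d : Fin L) ≠ j) → σ j = b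
      · have : ∃ d, ¬ (((d : Fin L) ∈ freeFor τ φ d → (φ d : Fin L) = d) ∧ σ (φ d) = τ d) := by
          by_contra hcon
          simp only [not_exists, not_not] at hcon
          exact hq ⟨fun d => (hcon d).1, fun d => (hcon d).2, h3⟩
        obtain ⟨d, hd⟩ := this
        rw [Finset.prod_eq_zero (Finset.mem_univ (e.symm d)), mul_zero]
        rw [choiceWeight, hrem, if_neg]
        simp only [Equiv.apply_symm_apply]
        exact fun h => hd h.2
      · rw [if_neg h3, zero_mul]

end

/-! ### Multiline queues as families of coloured rows -/

/-- The configurations of the row `r` of a multiline queue: of each colour `y > r` there are `m y`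
balls, and there are no balls of the other colours. -/
def levelSector {N L : ℕ} (m : Fin (N + 2) → ℕ) (r : Fin (N + 1)) : Set (Config N L) :=
  {τ | ∀ y, y ≠ 0 → (Finset.univ.filter (τ · = y)).card = if r.succ ≤ y then m y else 0}

/-- The weighted number of pairings between the row `s + 1` with the colours `τ` and the row `s`
with the colours `σ`. -/
def stepSum {K : Type*} [Field K] (t : K) {N L : ℕ} (s : Fin N) (τ σ : Config N L) : K :=
  queueSum t s.castSucc.succ τ σ (chooserList τ) (supp σ)

section

variable {N L : ℕ} {row : Fin (N + 1) → Finset (Fin L)} (φ : Pairing row)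

lemma color_last (j : Fin L) : color row φ (Fin.last N) j =
    if j ∈ row (Fin.last N) then Fin.last (N + 1) else 0 := by
  classical
  simp only [color, Fin.reverseInduction_last]

lemma color_castSucc_of_notMem (s : Fin N) (j : Fin L) (hj : j ∉ row s.castSucc) :
    color row φ s.castSucc j = 0 := by
  simp only [color, Fin.reverseInduction_castSucc, if_neg hj]

lemma color_castSucc_pair (s : Fin N) (d : {k // k ∈ row s.succ}) :
    color row φ s.castSucc (φ s d) = color row φ s.succ d := by
  have h : ∃ d' : {k // k ∈ row s.succ}, (φ s d' : Fin L) = φ s d := ⟨d, rfl⟩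
  have hd : h.choose = d := (φ s).injective (Subtype.ext h.choose_spec)
  conv_lhs => rw [color]
  simp only [Fin.reverseInduction_castSucc, if_pos (φ s d).2, dif_pos h, hd]
  rfl

lemma color_castSucc_unpaired (s : Fin N) (j : Fin L) (hj : j ∈ row s.castSucc)
    (h : ∀ d, (φ s d : Fin L) ≠ j) : color row φ s.castSucc j = s.castSucc.succ := by
  have h' : ¬ ∃ d : {k // k ∈ row s.succ}, (φ s d : Fin L) = j := fun ⟨d, hd⟩ => h d hd
  simp only [color, Fin.reverseInduction_castSucc, if_pos hj, dif_neg h']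

lemma color_of_notMem (r : Fin (N + 1)) (j : Fin L) (hj : j ∉ row r) : color row φ r j = 0 := by
  cases r using Fin.lastCases with
  | last => rw [color_last, if_neg hj]
  | cast s => exact color_castSucc_of_notMem φ s j hj

lemma le_color (r : Fin (N + 1)) (j : Fin L) (hj : j ∈ row r) : r.succ ≤ color row φ r j := by
  induction r using Fin.reverseInduction generalizing j with
  | last => rw [color_last, if_pos hj]; exact le_of_eq rfl
  | cast s ih =>
    by_cases h : ∃ d : {k // k ∈ row s.succ}, (φ s d : Fin L) = j
    · obtain ⟨d, rfl⟩ := h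
      rw [color_castSucc_pair]
      refine le_trans ?_ (ih d d.2)
      rw [Fin.le_def]
      simp
    · rw [color_castSucc_unpaired φ s j hj (fun d hd => h ⟨d, hd⟩)]

lemma color_ne_zero_iff (r : Fin (N + 1)) (j : Fin L) : color row φ r j ≠ 0 ↔ j ∈ row r := by
  refine ⟨fun h => ?_, fun h h0 => ?_⟩
  · by_contra hj
    exact h (color_of_notMem φ r j hj)
  · have := le_color φ r j h
    rw [h0] at this
    exact absurd this (by simp)

lemma supp_color (r : Fin (N + 1)) : supp (color row φ r) = row r := by
  ext j
  rw [supp, Finset.mem_filter, color_ne_zero_iff]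
  simp

lemma color_mem_levelSector (m : Fin (N + 2) → ℕ)
    (hc : ∀ r, (row r).card = ∑ α ∈ Finset.Ici r.succ, m α) (r : Fin (N + 1)) :
    color row φ r ∈ levelSector m r := by
  induction r using Fin.reverseInduction with
  | last =>
    intro y hy
    have h1 : Finset.univ.filter (color row φ (Fin.last N) · = y) =
        if y = Fin.last (N + 1) then row (Fin.last N) else ∅ := by
      ext j
      rw [Finset.mem_filter, color_last]
      by_cases hj : j ∈ row (Fin.last N) <;> by_cases hy' : y = Fin.last (N + 1) <;>
        simp [hj, hy', Ne.symm hy, eq_comm]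
    have h2 : Finset.Ici (Fin.last N).succ = {Fin.last (N + 1)} := by
      rw [Fin.succ_last]
      ext x
      simp [Fin.last_le_iff]
    rw [h1]
    by_cases hy' : y = Fin.last (N + 1)
    · subst hy'
      rw [if_pos rfl, hc, h2, Finset.sum_singleton, if_pos (by rw [Fin.succ_last])]
    · rw [if_neg hy', if_neg, Finset.card_empty]
      rw [Fin.succ_last, Fin.last_le_iff]
      exact hy'
  | cast s ih =>
    have hlt : s.castSucc.succ < s.succ.succ := by
      rw [Fin.lt_def]
      simp
    -- paired balls
    have h1 : ∀ y, s.castSucc.succ < y →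
        (Finset.univ.filter (color row φ s.castSucc · = y)).card = m y := by
      intro y hy
      have hy0 : y ≠ 0 := (lt_of_le_of_lt (Fin.zero_le _) hy).ne'
      have hle : s.succ.succ ≤ y := by
        rw [Fin.lt_def] at hy
        rw [Fin.le_def]
        simp only [Fin.val_succ, Fin.val_castSucc] at hy ⊢
        omega
      have := ih y hy0
      rw [if_pos hle] at this
      rw [← this]
      symm
      refine Finset.card_bij (fun j hj => (φ s ⟨j, ?_⟩ : Fin L)) ?_ ?_ ?_
      · rw [← color_ne_zero_iff φ, (Finset.mem_filter.mp hj).2]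
        exact hy0
      · intro j hj
        rw [Finset.mem_filter, color_castSucc_pair]
        exact ⟨Finset.mem_univ _, (Finset.mem_filter.mp hj).2⟩
      · intro j hj j' hj' h
        exact Subtype.mk.inj ((φ s).injective (Subtype.ext h))
      · intro k hk
        have hk' := (Finset.mem_filter.mp hk).2
        by_cases h : ∃ d : {k // k ∈ row s.succ}, (φ s d : Fin L) = k
        · obtain ⟨d, rfl⟩ := h
          rw [color_castSucc_pair] at hk'
          exact ⟨d, Finset.mem_filter.mpr ⟨Finset.mem_univ _, hk'⟩, rfl⟩
        · rw [color_castSucc_unpaired φ s k _ (fun d hd => h ⟨d, hd⟩)] at hk'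
          · exact absurd hk' hy.ne
          · rw [← color_ne_zero_iff φ, hk']
            exact hy0
    intro y hy
    rcases lt_trichotomy s.castSucc.succ y with h | h | h
    · rw [if_pos h.le, h1 y h]
    · subst h
      rw [if_pos le_rfl]
      have h2 : (row s.castSucc).card = ∑ y ∈ Finset.Ici s.castSucc.succ,
          (Finset.univ.filter (color row φ s.castSucc · = y)).card := by
        rw [Finset.card_eq_sum_card_fiberwise (f := color row φ s.castSucc)
          (t := Finset.Ici s.castSucc.succ)]
        · refine Finset.sum_congr rfl fun y hy => congrArg Finset.card ?_
          ext j
          simp only [Finset.mem_filter, Finset.mem_univ, true_and, and_iff_right_iff_imp]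
          rintro rfl
          rw [← color_ne_zero_iff φ]
          rw [Finset.mem_Ici] at hy
          exact (lt_of_lt_of_le (Fin.succ_pos _) hy).ne'
        · intro j hj
          rw [Finset.mem_coe, Finset.mem_Ici]
          exact le_color φ _ j hj
      rw [hc, ← Finset.Ioi_insert, Finset.sum_insert (by simp), Finset.sum_insert (by simp)] at h2
      rw [Finset.sum_congr rfl fun y hy => h1 y (Finset.mem_Ioi.mp hy)] at h2
      exact (add_right_cancel h2).symm
    · rw [if_neg (not_le.mpr h), Finset.card_eq_zero, Finset.filter_eq_empty_iff]
      rintro j - hj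
      have := le_color φ s.castSucc j (by rw [← color_ne_zero_iff φ, hj]; exact hy)
      rw [hj] at this
      exact absurd h this.not_gt

lemma free_eq_freeFor (c : Fin (N + 1) → Config N L) (hc : ∀ r, color row φ r = c r) (s : Fin N)
    (d : {j // j ∈ row s.succ}) : free row φ s d = freeFor (c s.succ) (φ s) d := by
  classical
  ext j
  rw [free, freeFor, Finset.mem_filter, Finset.mem_filter]
  simp only [precedes, Before, hc]
  rfl

lemma isQueue_of_color (c : Fin (N + 1) → Config N L) (hc : ∀ r, color row φ r = c r) (s : Fin N) :
    (∀ d, c s.castSucc (φ s d) = c s.succ d) ∧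
      ∀ j ∈ row s.castSucc, (∀ d, (φ s d : Fin L) ≠ j) → c s.castSucc j = s.castSucc.succ := by
  simp only [← hc]
  exact ⟨color_castSucc_pair φ s, color_castSucc_unpaired φ s⟩

lemma color_eq_of_isQueue (c : Fin (N + 1) → Config N L) (hrow : ∀ r, row r = supp (c r))
    (hlast : ∀ j ∈ row (Fin.last N), c (Fin.last N) j = Fin.last (N + 1))
    (h : ∀ s : Fin N, (∀ d, c s.castSucc (φ s d) = c s.succ d) ∧
      ∀ j ∈ row s.castSucc, (∀ d, (φ s d : Fin L) ≠ j) → c s.castSucc j = s.castSucc.succ)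
    (r : Fin (N + 1)) : color row φ r = c r := by
  have h0 : ∀ r j, j ∉ row r → c r j = 0 := by
    intro r j hj
    rw [hrow, supp, Finset.mem_filter] at hj
    simpa using hj
  induction r using Fin.reverseInduction with
  | last =>
    funext j
    rw [color_last]
    split_ifs with hj
    · exact (hlast j hj).symm
    · exact (h0 _ _ hj).symm
  | cast s ih =>
    funext j
    by_cases hj : j ∈ row s.castSucc
    · by_cases hd : ∃ d : {k // k ∈ row s.succ}, (φ s d : Fin L) = j
      · obtain ⟨d, rfl⟩ := hd
        rw [color_castSucc_pair, ih, (h s).1]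
      · rw [color_castSucc_unpaired φ s j hj (fun d hd' => hd ⟨d, hd'⟩),
          (h s).2 j hj (fun d hd' => hd ⟨d, hd'⟩)]
    · rw [color_of_notMem φ _ j hj, h0 _ _ hj]

end

section

variable {N L : ℕ} {m : Fin (N + 2) → ℕ}

lemma levelSector_le {r : Fin (N + 1)} {τ : Config N L} (hτ : τ ∈ levelSector m r) {j : Fin L}
    (hj : τ j ≠ 0) : r.succ ≤ τ j := by
  by_contra h
  have := hτ (τ j) hj
  rw [if_neg h, Finset.card_eq_zero] at this
  exact Finset.notMem_empty j (this ▸ Finset.mem_filter.mpr ⟨Finset.mem_univ j, rfl⟩)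

lemma card_supp_of_mem_levelSector {r : Fin (N + 1)} {τ : Config N L} (hτ : τ ∈ levelSector m r) :
    (supp τ).card = ∑ α ∈ Finset.Ici r.succ, m α := by
  rw [Finset.card_eq_sum_card_fiberwise (f := τ) (t := Finset.Ici r.succ)]
  · refine Finset.sum_congr rfl fun y hy => ?_
    rw [Finset.mem_Ici] at hy
    have hy0 : y ≠ 0 := (lt_of_lt_of_le (Fin.succ_pos _) hy).ne'
    rw [← (hτ y hy0).trans (if_pos hy), supp, Finset.filter_filter]
    refine congrArg Finset.card (Finset.filter_congr fun j _ => ?_)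
    exact ⟨fun h => h.2, fun h => ⟨h ▸ hy0, h⟩⟩
  · intro j hj
    rw [Finset.mem_coe, Finset.mem_Ici]
    exact levelSector_le hτ (Finset.mem_filter.mp hj).2

lemma MLQ.weight_mk {K : Type*} [Field K] (t : K) (row : Fin (N + 1) → Finset (Fin L))
    (hcard : ∀ r, (row r).card = ∑ α ∈ Finset.Ici r.succ, m α) (φ : Pairing row)
    (htriv : ∀ (s : Fin N) (d : {j // j ∈ row s.succ}),
      (d : Fin L) ∈ free row φ s d → (φ s d : Fin L) = d) (c : Fin (N + 1) → Config N L)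
    (hc : ∀ r, color row φ r = c r) :
    (⟨row, hcard, φ, htriv⟩ : MLQ L m).weight t =
      ∏ s : Fin N, queueWeight t (c s.succ) (φ s) := by
  refine Finset.prod_congr rfl fun s _ => Finset.prod_congr rfl fun d _ => ?_
  rw [hopWeight, MLQ.skipped, free_eq_freeFor _ c hc]
  rfl

open Classical in
/-- The multiline queues with given colours: the pairings of different pairs of neighbouring rows
are independent of each other. -/
lemma sum_weight_of_color {K : Type*} [Field K] (t : K) (c : Fin (N + 1) → Config N L)
    (hlevel : ∀ r, c r ∈ levelSector m r) :
    ∑ Q : MLQ L m, (if (fun r => color Q.row Q.pair r) = c then Q.weight t else 0) =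
      ∏ s : Fin N, stepSum t s (c s.succ) (c s.castSucc) := by
  have hR : ∏ s : Fin N, stepSum t s (c s.succ) (c s.castSucc) =
      ∑ φ : Pairing (fun r => supp (c r)),
        if ∀ s, IsQueue s.castSucc.succ (c s.succ) (c s.castSucc) (φ s) then
          ∏ s, queueWeight t (c s.succ) (φ s) else 0 := by
    simp only [stepSum, ← sum_queueWeight]
    rw [Finset.prod_univ_sum, Fintype.piFinset_univ]
    refine Finset.sum_congr rfl fun φ _ => ?_
    split_ifs with h
    · exact Finset.prod_congr rfl fun s _ => if_pos (h s)
    · obtain ⟨s, hs⟩ := not_forall.mp h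
      exact Finset.prod_eq_zero (Finset.mem_univ s) (if_neg hs)
  rw [hR, ← Finset.sum_filter, ← Finset.sum_filter]
  have hlast : ∀ j ∈ supp (c (Fin.last N)), c (Fin.last N) j = Fin.last (N + 1) := by
    intro j hj
    have := levelSector_le (hlevel (Fin.last N)) (Finset.mem_filter.mp hj).2
    rwa [Fin.succ_last, Fin.last_le_iff] at this
  have hcol : ∀ φ ∈ Finset.univ.filter (fun φ : Pairing (fun r => supp (c r)) =>
      ∀ s, IsQueue s.castSucc.succ (c s.succ) (c s.castSucc) (φ s)),
      ∀ r, color (fun r => supp (c r)) φ r = c r := by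
    intro φ hφ
    have hφ := (Finset.mem_filter.mp hφ).2
    exact color_eq_of_isQueue φ c (fun _ => rfl) hlast fun s => (hφ s).2
  symm
  refine Finset.sum_bij (fun φ hφ => (⟨fun r => supp (c r),
    fun r => card_supp_of_mem_levelSector (hlevel r), φ, fun s d hd => ?_⟩ : MLQ L m)) ?_ ?_ ?_ ?_
  · rw [free_eq_freeFor φ c (hcol φ hφ)] at hd
    exact ((Finset.mem_filter.mp hφ).2 s).1 d hd
  · intro φ hφ
    refine Finset.mem_filter.mpr ⟨Finset.mem_univ _, funext fun r => ?_⟩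
    exact hcol φ hφ r
  · intro φ _ ψ _ h
    simpa using h
  · rintro ⟨row, hcard, φ, htriv⟩ hQ
    have hQ' : (fun r => color row φ r) = c := (Finset.mem_filter.mp hQ).2
    obtain rfl : row = fun r => supp (c r) := by
      funext r
      rw [← hQ']
      exact (supp_color φ r).symm
    refine ⟨φ, Finset.mem_filter.mpr ⟨Finset.mem_univ _, fun s => ⟨fun d hd => ?_, ?_⟩⟩, rfl⟩
    · rw [← free_eq_freeFor φ c (congrFun hQ')] at hd
      exact htriv s d hd
    · exact isQueue_of_color φ c (congrFun hQ') s
  · intro φ hφ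
    exact (MLQ.weight_mk t _ _ _ _ c (hcol φ hφ)).symm

open Classical in
/-- The multiline queue state as a sum over the colours of all rows. -/
theorem mlqState_eq_sum {K : Type*} [Field K] (t : K) (σ : Config N L) :
    mlqState t m σ = ∑ c : Fin (N + 1) → Config N L,
      if c 0 = σ ∧ ∀ r, c r ∈ levelSector m r then
        ∏ s : Fin N, stepSum t s (c s.succ) (c s.castSucc) else 0 := by
  have h1 : mlqState t m σ = ∑ Q : MLQ L m, ∑ c : Fin (N + 1) → Config N L,
      if (fun r => color Q.row Q.pair r) = c then (if c 0 = σ then Q.weight t else 0) else 0 := by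
    refine Finset.sum_congr rfl fun Q _ => ?_
    rw [Finset.sum_ite_eq, if_pos (Finset.mem_univ _)]
    congr
  rw [h1, Finset.sum_comm]
  refine Finset.sum_congr rfl fun c _ => ?_
  by_cases h : ∀ r, c r ∈ levelSector m r
  · rw [← sum_weight_of_color t c h]
    by_cases h0 : c 0 = σ
    · simp [h0, h]
    · simp [h0]
  · rw [if_neg (fun h' => h h'.2)]
    refine Finset.sum_eq_zero fun Q _ => if_neg fun hQ => h fun r => ?_
    rw [← hQ]
    exact color_mem_levelSector Q.pair m Q.card_row r

end

/-! ### The trace at a vertex of the corner transfer matrix diagram -/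

/-- The vertex weight at the crossing of the horizontal line of the colour `y` with the vertical
line that belongs to a row of balls, in a layer in which this row has the colour `α` and the row
below has the colour `γ`. -/
def letter {K : Type*} [Field K] (t : K) {N : ℕ} (y α γ : Fin (N + 2)) :
    Module.End K (Fock K) :=
  vertexWeight t (bit (γ = y)) (bit (α = y)) (bit (α ≠ 0 ∧ α ≤ y)) (bit (α ≠ 0 ∧ α < y))

/-- The product over the layers of the weights at the crossing described at `letter`. -/
def letterWord {K : Type*} [Field K] (t : K) {N L : ℕ} (y : Fin (N + 2)) (τ σ : Config N L) :
    Module.End K (Fock K) :=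
  (List.ofFn fun k => letter t y (σ k) (τ k)).prod

/-- The number `m_{s+1} + ⋯ + m_{z+1}` of the balls of the row `s` that are still free when the
balls of the colour `z + 2` have chosen their partners. -/
def leftOver {N : ℕ} (m : Fin (N + 2) → ℕ) (s z : Fin N) : ℕ :=
  ∑ α ∈ Finset.Icc s.succ.castSucc z.succ.castSucc, m α

/-- The trace of `letterWord t (z + 2) τ σ`, in terms of pairings. -/
def vertexValue {K : Type*} [Field K] (t : K) {N L : ℕ} (m : Fin (N + 2) → ℕ) (s z : Fin N)
    (τ σ : Config N L) : K :=
  chooseSum t ((chooserList τ).filter (τ · = z.succ.succ)) ((supp σ).filter (σ · ≤ z.succ.succ))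
    ((supp σ).filter (σ · = z.succ.succ)) / (1 - t ^ leftOver m s z)

section

variable {K : Type*} [Field K] {t : K} {N L : ℕ} {m : Fin (N + 2) → ℕ}

lemma prod_Ioi_eq_prod_Ici {M : Type*} [CommMonoid M] (s : Fin N) (f : Fin (N + 2) → M) :
    ∏ y ∈ Finset.Ioi s.castSucc.succ, f y = ∏ z ∈ Finset.Ici s, f z.succ.succ := by
  symm
  refine Finset.prod_bij (fun z _ => z.succ.succ) ?_ ?_ ?_ (fun _ _ => rfl)
  · intro z hz
    rw [Finset.mem_Ici, Fin.le_def] at hz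
    rw [Finset.mem_Ioi, Fin.lt_def]
    simp only [Fin.val_succ, Fin.val_castSucc]
    omega
  · intro z _ z' _ h
    exact Fin.succ_injective _ (Fin.succ_injective _ h)
  · intro y hy
    rw [Finset.mem_Ioi, Fin.lt_def] at hy
    simp only [Fin.val_succ, Fin.val_castSucc] at hy
    refine ⟨⟨(y : ℕ) - 2, by have := y.2; omega⟩, ?_, ?_⟩
    · rw [Finset.mem_Ici, Fin.le_def]
      simp only
      omega
    · ext
      simp only [Fin.val_succ]
      omega

lemma prod_vertex {M : Type*} [CommMonoid M] (f : Fin N → Fin N → M) :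
    ∏ v : Vertex N, f v.1.1 v.1.2 = ∏ s, ∏ z ∈ Finset.Ici s, f s z := by
  have h1 : ∏ v : Vertex N, f v.1.1 v.1.2 =
      ∏ p ∈ Finset.univ.filter (fun p : Fin N × Fin N => p.1 ≤ p.2), f p.1 p.2 := by
    rw [Finset.prod_subtype (p := fun p : Fin N × Fin N => p.1 ≤ p.2) _ (by simp)]
  rw [h1, Finset.prod_filter, ← Finset.univ_product_univ, Finset.prod_product]
  refine Finset.prod_congr rfl fun s _ => ?_
  rw [← Finset.prod_filter]
  congr 1
  ext z
  simp

lemma card_filter_lt {s : Fin N} {σ : Config N L} (hσ : σ ∈ levelSector m s.castSucc) (z : Fin N) :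
    (Finset.univ.filter fun j => σ j ≠ 0 ∧ σ j < z.succ.succ).card = leftOver m s z := by
  rw [Finset.card_eq_sum_card_fiberwise (f := σ)
    (t := Finset.Icc s.succ.castSucc z.succ.castSucc), leftOver]
  · refine Finset.sum_congr rfl fun y hy => ?_
    rw [Finset.mem_Icc, Fin.le_def, Fin.le_def] at hy
    simp only [Fin.val_succ, Fin.val_castSucc] at hy
    have hy0 : y ≠ 0 := by
      rintro rfl
      simp at hy
    have h := hσ y hy0
    rw [if_pos (by rw [Fin.le_def]; simp only [Fin.val_succ, Fin.val_castSucc]; omega)] at h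
    rw [← h, Finset.filter_filter]
    refine congrArg Finset.card (Finset.filter_congr fun j _ => ?_)
    refine ⟨fun h => h.2, ?_⟩
    rintro rfl
    refine ⟨⟨hy0, ?_⟩, rfl⟩
    rw [Fin.lt_def]
    simp only [Fin.val_succ]
    omega
  · intro j hj
    have hj' := (Finset.mem_filter.mp (Finset.mem_coe.mp hj)).2
    have h1 := levelSector_le hσ hj'.1
    have h2 := hj'.2
    rw [Fin.le_def] at h1
    rw [Fin.lt_def] at h2
    rw [Finset.mem_coe, Finset.mem_Icc, Fin.le_def, Fin.le_def]
    simp only [Fin.val_succ, Fin.val_castSucc] at h1 h2 ⊢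
    omega

lemma one_le_leftOver (hm : ∀ α, 1 ≤ m α) {s z : Fin N} (hsz : s ≤ z) : 1 ≤ leftOver m s z := by
  rw [leftOver]
  refine (hm s.succ.castSucc).trans (Finset.single_le_sum (f := m) (fun _ _ => Nat.zero_le _) ?_)
  rw [Finset.mem_Icc]
  exact ⟨le_rfl, by simpa using hsz⟩

/-- In `hasTr_word` the choosers are the balls of the colour `z + 2`, and the balls above that are
free for them are those which end up with a colour `≤ z + 2`. -/
lemma hasTr_letterWord {E : Type*} [Field E] [TopologicalSpace E] [Algebra K E]
    [IsTopologicalRing E] [T3Space E] (hE : IsSummationField t E) (hm : ∀ α, 1 ≤ m α)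
    {s z : Fin N} (hsz : s ≤ z) {τ σ : Config N L} (hσ : σ ∈ levelSector m s.castSucc) :
    HasTr E (letterWord t z.succ.succ τ σ) (vertexValue t m s z τ σ) := by
  have hJC : (supp σ).filter (σ · ≤ z.succ.succ) \ (supp σ).filter (σ · = z.succ.succ) =
      Finset.univ.filter fun j => σ j ≠ 0 ∧ σ j < z.succ.succ := by
    ext j
    simp only [supp, Finset.mem_sdiff, Finset.mem_filter, Finset.mem_univ, true_and, not_and]
    refine ⟨fun h => ⟨h.1.1, lt_of_le_of_ne h.1.2 (h.2 h.1.1)⟩,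
      fun h => ⟨⟨h.1, h.2.le⟩, fun _ => h.2.ne⟩⟩
  have h := hasTr_word (t := t) (E := E) hE ((chooserList τ).filter (τ · = z.succ.succ))
    ((nodup_chooserList τ).filter _) ((supp σ).filter (σ · ≤ z.succ.succ))
    ((supp σ).filter (σ · = z.succ.succ))
    (Finset.monotone_filter_right _ fun _ _ h => le_of_eq h)
    (by rw [hJC, card_filter_lt hσ]; exact one_le_leftOver hm hsz)
  rw [hJC, card_filter_lt hσ] at h
  rw [vertexValue]
  convert h using 1
  rw [letterWord, word]
  congr 2
  funext k
  have h0 : σ k = z.succ.succ → σ k ≠ 0 := fun h => h ▸ Fin.succ_ne_zero _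
  have h0' : τ k = z.succ.succ → τ k ≠ 0 := fun h => h ▸ Fin.succ_ne_zero _
  rw [letter, site]
  congr 1
  · refine if_congr ?_ rfl rfl
    simp only [List.mem_toFinset, List.mem_filter, mem_chooserList, decide_eq_true_iff]
    exact ⟨fun h => ⟨h0' h, h⟩, fun h => h.2⟩
  · refine if_congr ?_ rfl rfl
    simp only [supp, Finset.mem_filter, Finset.mem_univ, true_and]
    exact ⟨fun h => ⟨h0 h, h⟩, fun h => h.2⟩
  · refine if_congr ?_ rfl rfl
    simp only [supp, Finset.mem_filter, Finset.mem_univ, true_and]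
  · refine if_congr ?_ rfl rfl
    simp only [supp, Finset.mem_filter, Finset.mem_univ, true_and, not_and]
    exact ⟨fun h => ⟨⟨h.1, h.2.le⟩, fun _ => h.2.ne⟩,
      fun h => ⟨h.1.1, lt_of_le_of_ne h.1.2 (h.2 h.1.1)⟩⟩

/-- The pairings of two neighbouring rows, as a product over the colours of vertex traces. -/
lemma stepSum_eq (hp : ∀ c, 1 ≤ c → t ^ c ≠ 1) (hm : ∀ α, 1 ≤ m α) {s : Fin N} {τ σ : Config N L}
    (hσ : σ ∈ levelSector m s.castSucc) (hτ : τ ∈ levelSector m s.succ) :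
    stepSum t s τ σ =
      ∏ z ∈ Finset.Ici s, ((1 - t ^ leftOver m s z) * vertexValue t m s z τ σ) := by
  rw [stepSum, queueSum_eq_prod, prod_Ioi_eq_prod_Ici]
  · refine Finset.prod_congr rfl fun z hz => ?_
    rw [vertexValue, mul_div_cancel₀]
    exact sub_ne_zero.mpr (hp _ (one_le_leftOver hm (Finset.mem_Ici.mp hz))).symm
  · exact sorted_chooserList τ
  · intro i hi
    rw [mem_chooserList] at hi
    have := levelSector_le hτ hi
    refine lt_of_lt_of_le ?_ this
    rw [Fin.lt_def]
    simp
  · intro j hj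
    exact levelSector_le hσ (Finset.mem_filter.mp hj).2
  · intro y hy
    have hy0 : y ≠ 0 := (lt_of_le_of_lt (Fin.zero_le _) hy).ne'
    rw [Fin.lt_def] at hy
    simp only [Fin.val_succ, Fin.val_castSucc] at hy
    have h1 := hσ y hy0
    have h2 := hτ y hy0
    rw [if_pos (by rw [Fin.le_def]; simp only [Fin.val_succ, Fin.val_castSucc]; omega)] at h1 h2
    have h3 : ((chooserList τ).filter (τ · = y)).length =
        (Finset.univ.filter (τ · = y)).card := by
      rw [← List.toFinset_card_of_nodup ((nodup_chooserList τ).filter _)]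
      congr 1
      ext j
      simp only [List.mem_toFinset, List.mem_filter, mem_chooserList, decide_eq_true_iff,
        Finset.mem_filter, Finset.mem_univ, true_and]
      exact ⟨fun h => h.2, fun h => ⟨h ▸ hy0, h⟩⟩
    have h4 : (supp σ).filter (σ · = y) = Finset.univ.filter (σ · = y) := by
      ext j
      simp only [supp, Finset.mem_filter, Finset.mem_univ, true_and]
      exact ⟨fun h => h.2, fun h => ⟨h ▸ hy0, h⟩⟩
    rw [h3, h4, h1, h2]

lemma normFactor_eq : normFactor t m = ∏ s, ∏ z ∈ Finset.Ici s, (1 - t ^ leftOver m s z) := by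
  rw [← prod_vertex (N := N) fun s z => 1 - t ^ leftOver m s z]
  rfl

lemma normFactor_ne_zero (hp : ∀ c, 1 ≤ c → t ^ c ≠ 1) (hm : ∀ α, 1 ≤ m α) :
    normFactor t m ≠ 0 := by
  refine Finset.prod_ne_zero_iff.mpr fun v _ => ?_
  exact sub_ne_zero.mpr (hp _ (one_le_leftOver hm v.2)).symm

end

/-! ### Layers of the corner transfer matrix diagram -/

section

variable {K : Type*} [Field K] {t : K}

/-- Each vertex weight maps a basis vector to a multiple of a basis vector. -/
lemma vertexWeight_single (i a j b : Fin 2) (d : ℕ) : ∃ x : K,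
    vertexWeight t i a j b (Finsupp.single d 1) = Finsupp.single (d + i - a) x ∧
      (x ≠ 0 → (a : ℕ) ≤ d + i) := by
  fin_cases i <;> fin_cases a <;> fin_cases j <;> fin_cases b
  all_goals first
    | (refine ⟨0, ?_⟩; simp [vertexWeight]; done)
    | (refine ⟨1, ?_⟩; simp [vertexWeight]; done)
    | (refine ⟨t ^ d, ?_⟩; simp [vertexWeight]; done)
    | (refine ⟨1 - t ^ d, by simp [vertexWeight, -Finsupp.single_sub], fun h => ?_⟩
       rcases d with _ | d
       · simp at h
       · simp)

lemma vertexWeight_ne_zero {i a j b : Fin 2} (h : vertexWeight t i a j b ≠ 0) :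
    (j : ℕ) = a + b := by
  fin_cases i <;> fin_cases a <;> fin_cases j <;> fin_cases b
  all_goals first | rfl | exact absurd rfl h

/-- A product of vertex weights changes the state by the difference of the numbers of occupied left
and right edges. -/
lemma prod_vertexWeight_single {ι : Type*} (i a j b : ι → Fin 2) (l : List ι) (d : ℕ) :
    ∃ (e : ℕ) (x : K), (l.map fun k => vertexWeight t (i k) (a k) (j k) (b k)).prod
      (Finsupp.single d 1) = Finsupp.single e x ∧
        (x ≠ 0 → e + (l.map fun k => (a k : ℕ)).sum = d + (l.map fun k => (i k : ℕ)).sum) := by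
  induction l with
  | nil => exact ⟨d, 1, by simp⟩
  | cons k l ih =>
    obtain ⟨e, x, h1, h2⟩ := ih
    obtain ⟨y, h3, h4⟩ := vertexWeight_single (t := t) (i k) (a k) (j k) (b k) e
    refine ⟨e + i k - a k, x * y, ?_, fun h => ?_⟩
    · rw [List.map_cons, List.prod_cons, Module.End.mul_apply, h1,
        ← Finsupp.smul_single_one, map_smul, h3, Finsupp.smul_single, smul_eq_mul]
    · have := h2 (left_ne_zero_of_mul h)
      have := h4 (right_ne_zero_of_mul h)
      rw [List.map_cons, List.sum_cons, List.map_cons, List.sum_cons]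
      omega

lemma sum_eq_of_diag_ne_zero {L : ℕ} (i a j b : Fin L → Fin 2) {d : ℕ}
    (h : diag (List.ofFn fun k => vertexWeight t (i k) (a k) (j k) (b k)).prod d ≠ 0) :
    ∑ k, (a k : ℕ) = ∑ k, (i k : ℕ) := by
  obtain ⟨e, x, h1, h2⟩ := prod_vertexWeight_single (t := t) i a j b (List.finRange L) d
  rw [diag, List.ofFn_eq_map, h1, Finsupp.single_apply] at h
  have he : e = d := by
    by_contra hne
    exact h (if_neg hne)
  rw [if_pos he] at h
  have h3 := h2 h
  rw [he, add_right_inj, ← List.ofFn_eq_map, ← List.ofFn_eq_map, List.sum_ofFn, List.sum_ofFn] at h3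
  exact h3

end

section

variable {K : Type*} [Field K] (t : K) {N L : ℕ}

/-- The product over the layers of the weights at the vertex `v`. -/
def vertexWord (e : Fin L → Edges N) (v : Vertex N) : Module.End K (Fock K) :=
  (List.ofFn fun k => localWeight t (e k) v).prod

/-- The edge states of a layer for given colours `c r` of the balls in the column of this layer:
the vertical part of the line `x` is occupied before its crossing with the line `j` if the ball of
the row `x` is free when the balls of the colour `j + 1` look for their partners, and the horizontal
part of the line `x` is occupied if the ball in the corresponding row has the colour `x + 1`. -/
def edgesOf (c : Fin (N + 1) → Fin (N + 2)) : Edges N := fun x j =>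
  if j ≤ x then bit (c j = x.succ) else bit (c x ≠ 0 ∧ c x ≤ j.succ)

lemma bit_eq_one_iff (p : Prop) [Decidable p] : bit p = 1 ↔ p := by
  rw [bit]
  split_ifs with h <;> simp [h]

lemma fin_two_ext {a b : Fin 2} (h : a = 1 ↔ b = 1) : a = b := by
  revert a b
  decide

variable {t}

lemma localWeight_edgesOf (c : Fin (N + 1) → Fin (N + 2)) (hc : ∀ r, c r ≠ 0 → r.succ ≤ c r)
    (v : Vertex N) : localWeight t (edgesOf c) v =
      letter t v.1.2.succ.succ (c v.1.1.castSucc) (c v.1.1.succ) := by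
  obtain ⟨⟨x, z⟩, hxz⟩ := v
  simp only at hxz ⊢
  have hxz' : (x : ℕ) ≤ z := hxz
  have h1 : x.succ ≤ z.succ := by simpa using hxz
  have h2 : x.castSucc ≤ z.succ := by
    rw [Fin.le_def]
    simp only [Fin.val_castSucc, Fin.val_succ]
    omega
  have h3 : ¬ z.succ ≤ x.castSucc := by
    rw [Fin.le_def]; simp only [Fin.val_castSucc, Fin.val_succ]; omega
  simp only [localWeight, letter, edgesOf, if_pos h1, if_pos h2, if_neg h3]
  congr 1
  by_cases h4 : z.castSucc ≤ x.castSucc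
  · have hzx : z = x := le_antisymm (by simpa using h4) hxz
    subst hzx
    rw [if_pos h4]
    refine if_congr ?_ rfl rfl
    constructor
    · intro h
      rw [h]
      refine ⟨Fin.succ_ne_zero _, ?_⟩
      rw [Fin.lt_def]
      simp
    · rintro ⟨h, h'⟩
      have := hc _ h
      rw [Fin.le_def] at this
      rw [Fin.lt_def] at h'
      ext
      simp only [Fin.val_succ, Fin.val_castSucc] at this h' ⊢
      omega
  · rw [if_neg h4]
    refine if_congr (and_congr_right fun _ => ?_) rfl rfl
    rw [Fin.le_def, Fin.lt_def]
    simp only [Fin.val_succ, Fin.val_castSucc]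
    omega

lemma edgesOf_injOn {c c' : Fin (N + 1) → Fin (N + 2)} (hc : ∀ r, c r ≠ 0 → r.succ ≤ c r)
    (hc' : ∀ r, c' r ≠ 0 → r.succ ≤ c' r) (h : edgesOf c = edgesOf c') : c = c' := by
  have key : ∀ r x, r ≤ x → (c r = x.succ ↔ c' r = x.succ) := by
    intro r x hrx
    have := congrFun (congrFun h x) r
    rw [edgesOf, edgesOf, if_pos hrx, if_pos hrx] at this
    rw [← bit_eq_one_iff (c r = x.succ), this, bit_eq_one_iff]
  have key' : ∀ c : Fin (N + 1) → Fin (N + 2), (∀ r, c r ≠ 0 → r.succ ≤ c r) → ∀ r, c r ≠ 0 →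
      ∃ x, r ≤ x ∧ c r = x.succ := by
    intro c hc r hr
    obtain ⟨x, hx⟩ := Fin.exists_succ_eq.mpr hr
    refine ⟨x, ?_, hx.symm⟩
    have := hc r hr
    rwa [← hx, Fin.succ_le_succ_iff] at this
  funext r
  by_cases hr : c r = 0
  · by_cases hr' : c' r = 0
    · rw [hr, hr']
    · obtain ⟨x, h1, h2⟩ := key' c' hc' r hr'
      rw [h2, (key r x h1).mpr h2]
  · obtain ⟨x, h1, h2⟩ := key' c hc r hr
    rw [h2, (key r x h1).mp h2]

/-- In a layer of non-vanishing weight, the edge states come from colours of the rows. -/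
lemma exists_eq_edgesOf (e : Edges N) (he : ∀ v, localWeight t e v ≠ 0) :
    ∃ c : Fin (N + 1) → Fin (N + 2), (∀ r, c r ≠ 0 → r.succ ≤ c r) ∧ e = edgesOf c := by
  -- on the vertical part of the line `x`, the particles that turn off are subtracted one by one
  have hsum : ∀ (x : Fin (N + 1)) (n : ℕ) (hn : (x : ℕ) + n < N + 1),
      (e x ⟨x + n, hn⟩ : ℕ) = ∑ k : Fin (n + 1), (e ⟨x + k, by omega⟩ x : ℕ) := by
    intro x n
    induction n with
    | zero => simp
    | succ n ih =>
      intro hn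
      rw [Fin.sum_univ_castSucc]
      have h := vertexWeight_ne_zero (he ⟨(⟨x, by omega⟩, ⟨x + n, by omega⟩), by
        rw [Fin.le_def]; simp⟩)
      have h' := ih (by omega)
      simp only [Fin.val_castSucc, Fin.val_last] at h' ⊢
      rw [← h']
      exact h.trans (add_comm _ _)
  have huniq : ∀ (x y y' : Fin (N + 1)), x ≤ y → y < y' → e y x = 1 → e y' x = 1 → False := by
    intro x y y' hxy hyy h1 h2
    rw [Fin.le_def] at hxy
    rw [Fin.lt_def] at hyy
    have h := hsum x (y' - x) (by omega)
    have h3 : ∑ k : Fin (y' - x + 1), (e ⟨x + k, by omega⟩ x : ℕ) ≥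
        ∑ k ∈ ({⟨y - x, by omega⟩, ⟨y' - x, by omega⟩} : Finset (Fin (y' - x + 1))),
          (e ⟨x + k, by omega⟩ x : ℕ) :=
      Finset.sum_le_sum_of_subset (Finset.subset_univ _)
    rw [Finset.sum_pair (by rw [Ne, Fin.mk.injEq]; omega)] at h3
    have e1 : (⟨x + (y - x), by omega⟩ : Fin (N + 1)) = y := by ext; simp only; omega
    have e2 : (⟨x + (y' - x), by omega⟩ : Fin (N + 1)) = y' := by ext; simp only; omega
    simp only [e1, e2, h1, h2] at h3
    rw [← h] at h3
    have := (e x ⟨x + (y' - x), by omega⟩).2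
    simp only [Fin.val_one] at h3
    omega
  have hex : ∀ x j : Fin (N + 1), x ≤ j → (e x j = 1 ↔ ∃ y, x ≤ y ∧ y ≤ j ∧ e y x = 1) := by
    intro x j hxj
    rw [Fin.le_def] at hxj
    have h := hsum x (j - x) (by omega)
    have e1 : (⟨x + (j - x), by omega⟩ : Fin (N + 1)) = j := by ext; simp only; omega
    rw [e1] at h
    constructor
    · intro h1
      rw [h1] at h
      have hne : ∑ k : Fin (j - x + 1), (e ⟨x + k, by omega⟩ x : ℕ) ≠ 0 := by
        rw [← h]
        simp
      obtain ⟨k, -, hk⟩ := Finset.exists_ne_zero_of_sum_ne_zero hne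
      refine ⟨⟨x + k, by omega⟩, ?_, ?_, ?_⟩
      · rw [Fin.le_def]; simp
      · rw [Fin.le_def]; simp only; omega
      · have := (e ⟨x + k, by omega⟩ x).2
        ext
        simp only [Fin.val_one]
        omega
    · rintro ⟨y, h1, h2, h3⟩
      rw [Fin.le_def] at h1 h2
      have h4 := Finset.single_le_sum (f := fun k : Fin (j - x + 1) => (e ⟨x + k, by omega⟩ x : ℕ))
        (fun _ _ => Nat.zero_le _) (Finset.mem_univ (⟨y - x, by omega⟩ : Fin (j - x + 1)))
      have e2 : (⟨x + (y - x), by omega⟩ : Fin (N + 1)) = y := by ext; simp only; omega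
      simp only [e2, h3, Fin.val_one] at h4
      have := (e x j).2
      ext
      simp only [Fin.val_one]
      omega
  classical
  let c : Fin (N + 1) → Fin (N + 2) := fun r =>
    if h : ∃ y, r ≤ y ∧ e y r = 1 then h.choose.succ else 0
  have hc : ∀ r y, r ≤ y → (c r = y.succ ↔ e y r = 1) := by
    intro r y hry
    simp only [c]
    split_ifs with h
    · obtain ⟨h1, h2⟩ := h.choose_spec
      rw [Fin.succ_inj]
      constructor
      · rintro rfl
        exact h2
      · intro h3
        by_contra hne
        rcases lt_or_gt_of_ne hne with h' | h'
        · exact huniq r _ _ h1 h' h2 h3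
        · exact huniq r _ _ hry h' h3 h2
    · refine ⟨fun h' => absurd h'.symm (Fin.succ_ne_zero y), fun h' => absurd ⟨y, hry, h'⟩ h⟩
  have hc0 : ∀ r, c r ≠ 0 → ∃ y, r ≤ y ∧ c r = y.succ := by
    intro r hr
    simp only [c] at hr ⊢
    split_ifs at hr ⊢ with h
    · exact ⟨_, h.choose_spec.1, rfl⟩
    · exact absurd rfl hr
  refine ⟨c, fun r hr => ?_, ?_⟩
  · obtain ⟨y, h1, h2⟩ := hc0 r hr
    rw [h2]
    simpa using h1
  · funext x j
    refine fin_two_ext ?_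
    rw [edgesOf]
    split_ifs with hjx
    · rw [bit_eq_one_iff, hc j x hjx]
    · rw [bit_eq_one_iff, hex x j (not_le.mp hjx).le]
      constructor
      · rintro ⟨y, h1, h2, h3⟩
        have := (hc x y h1).mpr h3
        rw [this]
        exact ⟨Fin.succ_ne_zero y, by simpa using h2⟩
      · rintro ⟨h1, h2⟩
        obtain ⟨y, h3, h4⟩ := hc0 x h1
        rw [h4] at h2
        exact ⟨y, h3, by simpa using h2, (hc x y h3).mp h4⟩

lemma boundary_edgesOf {c : Fin (N + 1) → Fin (N + 2)} (α : Fin (N + 2)) :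
    Boundary α (edgesOf c) ↔ c 0 = α := by
  have h1 : ∀ x : Fin (N + 1), edgesOf c x 0 = bit (c 0 = x.succ) := fun x => by
    rw [edgesOf, if_pos (Fin.zero_le _)]
  constructor
  · intro h
    have h2 : ∀ x : Fin (N + 1), c 0 = x.succ ↔ α = x.succ := by
      intro x
      have := h x
      rw [h1] at this
      rw [← bit_eq_one_iff (c 0 = x.succ), ← bit_eq_one_iff (α = x.succ), this]
      rfl
    by_cases h0 : α = 0
    · by_contra hne
      rw [h0] at hne
      obtain ⟨x, hx⟩ := Fin.exists_succ_eq.mpr hne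
      have := (h2 x).mp hx.symm
      exact Fin.succ_ne_zero x (this ▸ h0)
    · obtain ⟨x, hx⟩ := Fin.exists_succ_eq.mpr h0
      rw [(h2 x).mpr hx.symm, hx]
  · rintro rfl x
    exact h1 x

variable {m : Fin (N + 2) → ℕ}

/-- A choice of edge states in all layers for which no vertex has a vanishing trace comes from
colours of the rows with the numbers of balls of a multiline queue. -/
lemma exists_colors_of_diag_ne_zero {σ : Config N L} (hσ : σ ∈ sector m) (e : Fin L → Edges N)
    (hB : ∀ k, Boundary (σ k) (e k)) (he : ∀ v, ∃ d, diag (vertexWord t e v) d ≠ 0) :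
    ∃ c : Fin (N + 1) → Config N L, (c 0 = σ ∧ ∀ r, c r ∈ levelSector m r) ∧
      e = fun k => edgesOf fun r => c r k := by
  have h1 : ∀ k v, localWeight t (e k) v ≠ 0 := by
    intro k v h0
    obtain ⟨d, hd⟩ := he v
    refine hd ?_
    have : vertexWord t e v = 0 := List.prod_eq_zero (List.mem_ofFn.mpr ⟨k, h0⟩)
    rw [this]
    rfl
  choose c hc using fun k => exists_eq_edgesOf (e k) (h1 k)
  have he' : e = fun k => edgesOf (c k) := funext fun k => (hc k).2
  have hc0 : ∀ k, c k 0 = σ k := fun k => by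
    rw [← boundary_edgesOf, ← (hc k).2]
    exact hB k
  have hbal : ∀ v : Vertex N,
      (Finset.univ.filter fun k => c k v.1.1.castSucc = v.1.2.succ.succ).card =
      (Finset.univ.filter fun k => c k v.1.1.succ = v.1.2.succ.succ).card := by
    intro v
    obtain ⟨d, hd⟩ := he v
    rw [vertexWord, he'] at hd
    simp only [localWeight_edgesOf _ (hc _).1, letter] at hd
    have := sum_eq_of_diag_ne_zero _ _ _ _ hd
    rw [Finset.card_filter, Finset.card_filter]
    convert this using 2 with k _ k _
    · rw [bit]; split_ifs <;> rfl
    · rw [bit]; split_ifs <;> rfl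
  have hlow : ∀ (r : Fin (N + 1)) (y : Fin (N + 2)), y ≠ 0 → ¬ r.succ ≤ y →
      (Finset.univ.filter fun k => c k r = y).card = 0 := by
    intro r y hy hry
    rw [Finset.card_eq_zero, Finset.filter_eq_empty_iff]
    rintro k - rfl
    exact hry ((hc k).1 r hy)
  refine ⟨fun r k => c k r, ⟨funext hc0, fun r => ?_⟩, he'⟩
  induction r using Fin.induction with
  | zero =>
    intro y hy
    have h3 := hσ y
    have h4 : Fin.succ (0 : Fin (N + 1)) ≤ y := by
      rw [Fin.le_def]
      have : (y : ℕ) ≠ 0 := fun h => hy (Fin.ext h)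
      simp only [Fin.val_succ, Fin.val_zero]
      omega
    rw [if_pos h4, ← h3]
    simp only [hc0]
  | succ s ih =>
    intro y hy
    by_cases hsy : s.succ.succ ≤ y
    · have h2 : s.castSucc.succ ≤ y := by
        refine le_trans ?_ hsy
        rw [Fin.le_def]
        simp
      have h3 := ih y hy
      rw [if_pos h2] at h3
      rw [if_pos hsy, ← h3]
      obtain ⟨y', rfl⟩ := Fin.exists_succ_eq.mpr hy
      have hy' : y' ≠ 0 := by
        rintro rfl
        rw [Fin.succ_le_succ_iff] at hsy
        exact absurd hsy (by simp)
      obtain ⟨z, rfl⟩ := Fin.exists_succ_eq.mpr hy'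
      have hsz : s ≤ z := by simpa using hsy
      exact (hbal ⟨(s, z), hsz⟩).symm
    · rw [if_neg hsy]
      exact hlow s.succ y hy hsy

lemma vertexWord_edgesOf {c : Fin (N + 1) → Config N L} (hc : ∀ r, c r ∈ levelSector m r)
    (v : Vertex N) : vertexWord t (fun k => edgesOf fun r => c r k) v =
      letterWord t v.1.2.succ.succ (c v.1.1.succ) (c v.1.1.castSucc) := by
  rw [vertexWord, letterWord]
  congr 2
  funext k
  exact localWeight_edgesOf (fun r => c r k) (fun r hr => levelSector_le (hc r) hr) v

end

/-! ### Summation over the states of the vertical edges -/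

section

variable {K : Type*} [Field K] {t : K} {E : Type*} [Field E] [TopologicalSpace E] [Algebra K E]

lemma hasSum_pi_fin (hE : IsSummationField t E) {X : Type} (n : ℕ) (f : Fin n → X → E)
    (s : Fin n → E) (h : ∀ i, HasSum (f i) (s i)) :
    HasSum (fun d : Fin n → X => ∏ i, f i (d i)) (∏ i, s i) := by
  induction n with
  | zero =>
    simp only [Finset.univ_eq_empty, Finset.prod_empty]
    exact hasSum_unique (fun _ : Fin 0 → X => (1 : E))
  | succ n ih =>
    have h1 := hE.hasSum_mul _ _ _ _ (h 0)
      (ih (fun i => f i.succ) (fun i => s i.succ) fun i => h i.succ)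
    rw [Fin.prod_univ_succ, ← (Fin.consEquiv fun _ : Fin (n + 1) => X).hasSum_iff]
    convert h1 using 2 with p
    simp only [Function.comp_apply, Fin.prod_univ_succ]
    rfl

lemma hasSum_pi (hE : IsSummationField t E) {ι : Type} [Fintype ι] {X : Type} (f : ι → X → E)
    (s : ι → E) (h : ∀ i, HasSum (f i) (s i)) :
    HasSum (fun d : ι → X => ∏ i, f i (d i)) (∏ i, s i) := by
  have e := Fintype.equivFin ι
  have h1 := hasSum_pi_fin hE _ (fun i => f (e.symm i)) (fun i => s (e.symm i)) fun i => h _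
  rw [e.symm.prod_comp s] at h1
  rw [← (e.arrowCongr (Equiv.refl X)).hasSum_iff] at h1
  convert h1 using 2 with d
  simp only [Function.comp_apply, Equiv.arrowCongr_apply, Equiv.coe_refl, id_eq,
    e.symm.prod_comp fun i => f i (d i)]

/-- A cyclic product of matrix elements of operators that map basis vectors to multiples of basis
vectors. All states are determined by one of them, so that the sum over all states is a trace. -/
lemma exists_path {n : ℕ} (S : Fin (n + 1) → Module.End K (Fock K))
    (hS : ∀ k, ∃ (τ : ℕ → ℕ) (x : ℕ → K), ∀ d,
      S k (Finsupp.single d 1) = Finsupp.single (τ d) (x d)) :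
    ∃ path : ℕ → Fin (n + 1) → ℕ, Function.Injective path ∧
      (∀ d, ∏ k, S k (Finsupp.single (path d (finRotate (n + 1) k)) 1) (path d k) =
        diag (List.ofFn S).prod d) ∧
      ∀ D ∉ Set.range path, ∏ k, S k (Finsupp.single (D (finRotate (n + 1) k)) 1) (D k) = 0 := by
  choose τ x hτ using hS
  let P : ℕ → Fin (n + 2) → ℕ := fun d =>
    Fin.reverseInduction (motive := fun _ => ℕ) d fun k e => τ k e
  have hPl : ∀ d, P d (Fin.last (n + 1)) = d := fun d => by
    simp only [P, Fin.reverseInduction_last]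
  have hPs : ∀ d k, P d k.castSucc = τ k (P d k.succ) := fun d k => by
    simp only [P, Fin.reverseInduction_castSucc]
  have hprod : ∀ (l : ℕ) (S : Fin l → Module.End K (Fock K)) (τ : Fin l → ℕ → ℕ)
      (x : Fin l → ℕ → K) (_ : ∀ k d, S k (Finsupp.single d 1) = Finsupp.single (τ k d) (x k d))
      (p : Fin (l + 1) → ℕ) (_ : ∀ k, p k.castSucc = τ k (p k.succ)),
      (List.ofFn S).prod (Finsupp.single (p (Fin.last l)) 1) =
        Finsupp.single (p 0) (∏ k, x k (p k.succ)) := by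
    intro l
    induction l with
    | zero =>
      intro S τ x _ p _
      simp
    | succ l ih =>
      intro S τ x hS p hp
      rw [List.ofFn_succ, List.prod_cons, Module.End.mul_apply, Fin.prod_univ_succ]
      have h1 := ih (fun k => S k.succ) (fun k => τ k.succ) (fun k => x k.succ)
        (fun k => hS k.succ) (fun k => p k.succ) (fun k => by
          rw [← hp k.succ, Fin.succ_castSucc])
      rw [Fin.succ_last] at h1
      rw [h1, ← Finsupp.smul_single_one, map_smul, hS, Finsupp.smul_single, smul_eq_mul, mul_comm]
      congr 1
      exact (hp 0).symm
  have hrot : ∀ k : Fin n, finRotate (n + 1) k.castSucc = k.succ := fun k => by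
    rw [finRotate_apply, Fin.coeSucc_eq_succ]
  refine ⟨fun d k => if k = 0 then d else P d k.castSucc, fun d d' h => by
    simpa using congrFun h 0, fun d => ?_, fun D hD => ?_⟩
  · have h1 : ∀ k : Fin (n + 1), (if finRotate (n + 1) k = 0 then d else
        P d (finRotate (n + 1) k).castSucc) = P d k.succ := by
      intro k
      cases k using Fin.lastCases with
      | last => rw [finRotate_last, if_pos rfl, Fin.succ_last, hPl]
      | cast k => rw [hrot, if_neg (Fin.succ_ne_zero k), Fin.succ_castSucc]
    have h2 := hprod (n + 1) S τ x hτ (P d) (hPs d)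
    rw [hPl] at h2
    rw [diag, h2]
    simp only [h1]
    rw [Fin.prod_univ_succ, Fin.prod_univ_succ, if_pos rfl, hτ, Finsupp.single_apply,
      Finsupp.single_apply, ← hPs, Fin.castSucc_zero]
    have h3 : ∀ k : Fin n, S k.succ (Finsupp.single (P d k.succ.succ) 1)
        (if k.succ = 0 then d else P d k.succ.castSucc) = x k.succ (P d k.succ.succ) := by
      intro k
      rw [if_neg (Fin.succ_ne_zero k), hτ, hPs, Finsupp.single_eq_same]
    simp only [h3]
    split_ifs <;> simp
  · by_contra hne
    rw [Finset.prod_eq_zero_iff, not_exists] at hne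
    have h1 : ∀ k, D k = τ k (D (finRotate (n + 1) k)) := by
      intro k
      by_contra h
      refine hne k ⟨Finset.mem_univ _, ?_⟩
      rw [hτ, Finsupp.single_apply, if_neg (Ne.symm h)]
    have h2 : ∀ k, P (D 0) (Fin.succ k) = D (finRotate (n + 1) k) := by
      intro k
      induction k using Fin.reverseInduction with
      | last => rw [finRotate_last, Fin.succ_last, hPl]
      | cast k ih => rw [hrot, Fin.succ_castSucc, hPs, ih, ← h1]
    refine hD ⟨D 0, funext fun k => ?_⟩
    simp only
    split_ifs with hk
    · rw [hk]
    · obtain ⟨k, rfl⟩ := Fin.exists_succ_eq.mpr hk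
      rw [← Fin.succ_castSucc, h2, hrot]

end

section

variable {K : Type*} [Field K] {t : K} {N L : ℕ}

lemma prod_ofFn_sum {R : Type*} [Semiring R] {ι : Type*} [Fintype ι] {n : ℕ} (f : Fin n → ι → R) :
    (List.ofFn fun k => ∑ i, f k i).prod =
      ∑ g : Fin n → ι, (List.ofFn fun k => f k (g k)).prod := by
  induction n with
  | zero => simp
  | succ n ih =>
    rw [List.ofFn_succ, List.prod_cons, ih, ← (Fin.consEquiv fun _ : Fin (n + 1) => ι).sum_comp,
      Fintype.sum_prod_type, Finset.sum_mul_sum]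
    refine Finset.sum_congr rfl fun i _ => Finset.sum_congr rfl fun g _ => ?_
    rw [List.ofFn_succ, List.prod_cons]
    rfl

lemma prod_ofFn_map {ι : Type*} {n : ℕ} (f : Fin n → ι → Module.End K (Fock K)) :
    (List.ofFn fun k => PiTensorProduct.map (f k)).prod =
      (PiTensorProduct.map fun v => (List.ofFn fun k => f k v).prod :
        Module.End K (PiTensorProduct K fun _ : ι => Fock K)) := by
  induction n with
  | zero =>
    simp only [List.ofFn_zero, List.prod_nil]
    exact PiTensorProduct.map_one.symm
  | succ n ih =>
    simp only [List.ofFn_succ, List.prod_cons]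
    rw [ih]
    exact (PiTensorProduct.map_mul _ _).symm

open Classical in
lemma repr_ctmProduct (σ : Config N L) (d : Vertex N → ℕ) :
    (fockBasis K N).repr (ctmProduct t σ (fockBasis K N d)) d =
      ∑ e : Fin L → Edges N, if ∀ k, Boundary (σ k) (e k) then
        ∏ v, diag (vertexWord t e v) (d v) else 0 := by
  have h1 : ctmProduct t σ = ∑ e : Fin L → Edges N, if ∀ k, Boundary (σ k) (e k) then
      PiTensorProduct.map (fun v => vertexWord t e v) else 0 := by
    rw [ctmProduct]
    simp only [ctm, one_pow, one_smul]
    simp only [Finset.sum_filter]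
    rw [prod_ofFn_sum]
    refine Finset.sum_congr rfl fun e _ => ?_
    split_ifs with h
    · simp only [h, if_true]
      rw [prod_ofFn_map]
      rfl
    · obtain ⟨k, hk⟩ := not_forall.mp h
      exact List.prod_eq_zero (List.mem_ofFn.mpr ⟨k, if_neg hk⟩)
  rw [h1, LinearMap.sum_apply, map_sum, Finsupp.finsetSum_apply]
  refine Finset.sum_congr rfl fun e _ => ?_
  split_ifs
  · rw [fockBasis, Basis.piTensorProduct_apply, PiTensorProduct.map_tprod,
      Basis.piTensorProduct_repr_tprod_apply]
    simp [diag]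
  · simp

end

/-! ### Trace and partition function -/

open Classical in
/-- The contribution of the edge states `e` of all layers to the trace. -/
def edgeValue {K : Type*} [Field K] (t : K) {N L : ℕ} (m : Fin (N + 2) → ℕ) (σ : Config N L)
    (e : Fin L → Edges N) : K :=
  ∑ c : Fin (N + 1) → Config N L,
    if (c 0 = σ ∧ ∀ r, c r ∈ levelSector m r) ∧ e = (fun k => edgesOf fun r => c r k) then
      ∏ v : Vertex N, vertexValue t m v.1.1 v.1.2 (c v.1.1.succ) (c v.1.1.castSucc) else 0

section

variable {K : Type*} [Field K] {t : K} {N L : ℕ} {m : Fin (N + 2) → ℕ} {E : Type*} [Field E]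
  [TopologicalSpace E] [Algebra K E]

lemma edgeValue_edgesOf (σ : Config N L) (c : Fin (N + 1) → Config N L) (h0 : c 0 = σ)
    (hc : ∀ r, c r ∈ levelSector m r) :
    edgeValue t m σ (fun k => edgesOf fun r => c r k) =
      ∏ v : Vertex N, vertexValue t m v.1.1 v.1.2 (c v.1.1.succ) (c v.1.1.castSucc) := by
  rw [edgeValue, Finset.sum_eq_single c, if_pos ⟨⟨h0, hc⟩, rfl⟩]
  · intro c' _ hne
    rw [if_neg]
    rintro ⟨⟨-, hc'⟩, h⟩
    refine hne (funext fun r => funext fun k => ?_)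
    have := edgesOf_injOn (fun r hr => levelSector_le (hc r) hr)
      (fun r hr => levelSector_le (hc' r) hr) (congrFun h k)
    exact (congrFun this r).symm
  · simp

/-- If the function `F v` sums up to the trace of the word at the vertex `v`, the product over all
vertices sums up to `edgeValue`. -/
lemma hasSum_prod_vertex [IsTopologicalRing E] [T3Space E] (hE : IsSummationField t E)
    (hm : ∀ α, 1 ≤ m α) {σ : Config N L} (hσ : σ ∈ sector m) {X : Type} (e : Fin L → Edges N)
    (hB : ∀ k, Boundary (σ k) (e k)) (F : Vertex N → X → K)
    (hF : ∀ v s, HasTr E (vertexWord t e v) s →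
      HasSum (fun x => algebraMap K E (F v x)) (algebraMap K E s))
    (hF0 : ∀ v, (∀ d, diag (vertexWord t e v) d = 0) → ∀ x, F v x = 0) :
    HasSum (fun D : Vertex N → X => algebraMap K E (∏ v, F v (D v)))
      (algebraMap K E (edgeValue t m σ e)) := by
  by_cases h : ∃ c : Fin (N + 1) → Config N L, (c 0 = σ ∧ ∀ r, c r ∈ levelSector m r) ∧
      e = fun k => edgesOf fun r => c r k
  · obtain ⟨c, ⟨h0, hc⟩, rfl⟩ := h
    rw [edgeValue_edgesOf σ c h0 hc]
    simp only [map_prod]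
    refine hasSum_pi hE (fun v x => algebraMap K E (F v x)) (fun v => algebraMap K E
      (vertexValue t m v.1.1 v.1.2 (c v.1.1.succ) (c v.1.1.castSucc))) fun v => hF v _ ?_
    rw [vertexWord_edgesOf hc]
    exact hasTr_letterWord hE hm v.2 (hc _)
  · have h1 : edgeValue t m σ e = 0 :=
      Finset.sum_eq_zero fun c _ => if_neg fun hc => h ⟨c, hc⟩
    have h2 : ∃ v, ∀ d, diag (vertexWord t e v) d = 0 := by
      by_contra hcon
      simp only [not_exists, not_forall] at hcon
      exact h (exists_colors_of_diag_ne_zero hσ e hB hcon)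
    obtain ⟨v, hv⟩ := h2
    have h3 : ∀ D : Vertex N → X, ∏ v, F v (D v) = 0 := fun D =>
      Finset.prod_eq_zero (Finset.mem_univ v) (hF0 v hv _)
    simp only [h1, h3, map_zero, hasSum_zero]

lemma prod_vertexValue (hp : ∀ c, 1 ≤ c → t ^ c ≠ 1) (hm : ∀ α, 1 ≤ m α)
    {c : Fin (N + 1) → Config N L} (hc : ∀ r, c r ∈ levelSector m r) :
    ∏ v : Vertex N, vertexValue t m v.1.1 v.1.2 (c v.1.1.succ) (c v.1.1.castSucc) =
      (∏ s : Fin N, stepSum t s (c s.succ) (c s.castSucc)) / normFactor t m := by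
  rw [eq_div_iff (normFactor_ne_zero hp hm), normFactor_eq,
    prod_vertex fun s z => vertexValue t m s z (c s.succ) (c s.castSucc), ← Finset.prod_mul_distrib]
  refine Finset.prod_congr rfl fun s _ => ?_
  rw [stepSum_eq hp hm (hc _) (hc _), ← Finset.prod_mul_distrib]
  exact Finset.prod_congr rfl fun z _ => mul_comm _ _

open Classical in
/-- The sum over the edge states is the sum over the colours in `mlqState_eq_sum`. -/
lemma sum_edgeValue (hp : ∀ c, 1 ≤ c → t ^ c ≠ 1) (hm : ∀ α, 1 ≤ m α) (σ : Config N L) :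
    ∑ e ∈ (Finset.univ : Finset (Fin L → Edges N)).filter (fun e => ∀ k, Boundary (σ k) (e k)),
      edgeValue t m σ e = mlqState t m σ / normFactor t m := by
  rw [mlqState_eq_sum, Finset.sum_div]
  simp only [edgeValue]
  rw [Finset.sum_comm]
  refine Finset.sum_congr rfl fun c _ => ?_
  by_cases hc : c 0 = σ ∧ ∀ r, c r ∈ levelSector m r
  · rw [if_pos hc, ← prod_vertexValue hp hm hc.2]
    rw [Finset.sum_eq_single fun k => edgesOf fun r => c r k, if_pos ⟨hc, rfl⟩]
    · exact fun e _ he => if_neg fun h => he h.2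
    · intro h
      refine absurd (Finset.mem_filter.mpr ⟨Finset.mem_univ _, fun k => ?_⟩) h
      rw [boundary_edgesOf]
      exact congrFun hc.1 k
  · rw [if_neg hc, zero_div]
    exact Finset.sum_eq_zero fun e _ => if_neg fun h => hc h.1

theorem hasFockTrace_ctmProduct [IsTopologicalRing E] [T3Space E] (hE : IsSummationField t E)
    (hm : ∀ α, 1 ≤ m α) {σ : Config N L} (hσ : σ ∈ sector m) :
    HasFockTrace (ctmProduct t σ) (algebraMap K E (mlqState t m σ / normFactor t m)) := by
  classical
  rw [← sum_edgeValue hE.pow_ne_one hm, map_sum, HasFockTrace]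
  simp only [repr_ctmProduct, ← Finset.sum_filter, map_sum]
  refine hasSum_sum fun e he => ?_
  exact hasSum_prod_vertex hE hm hσ e (Finset.mem_filter.mp he).2
    (fun v d => diag (vertexWord t e v) d) (fun v s h => h) (fun v h => h)

theorem hasPartitionFunction [IsTopologicalRing E] [T3Space E] (hE : IsSummationField t E)
    (hm : ∀ α, 1 ≤ m α) (hL : ∑ α, m α = L) {σ : Config N L} (hσ : σ ∈ sector m) :
    HasPartitionFunction t σ (algebraMap K E (mlqState t m σ / normFactor t m)) := by
  classical
  obtain ⟨n, rfl⟩ : ∃ n, L = n + 1 := by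
    refine Nat.exists_eq_succ_of_ne_zero ?_
    rintro rfl
    rw [Finset.sum_eq_zero_iff] at hL
    exact absurd (hm 0) (by rw [hL 0 (Finset.mem_univ _)]; simp)
  rw [← sum_edgeValue hE.pow_ne_one hm, map_sum, HasPartitionFunction]
  -- the states of the vertical edges, vertex by vertex
  let F : (Fin (n + 1) → Edges N) → Vertex N → (Fin (n + 1) → ℕ) → K := fun e v D =>
    ∏ k, localWeight t (e k) v (Finsupp.single (D (finRotate (n + 1) k)) 1) (D k)
  have hmono : ∀ (e : Fin (n + 1) → Edges N) (v : Vertex N) (k : Fin (n + 1)),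
      ∃ (τ : ℕ → ℕ) (x : ℕ → K), ∀ d,
        localWeight t (e k) v (Finsupp.single d 1) = Finsupp.single (τ d) (x d) := by
    intro e v k
    choose x hx using vertexWeight_single (t := t) (e k v.1.2.succ v.1.1.succ)
      (e k v.1.2.succ v.1.1.castSucc) (e k v.1.1.castSucc v.1.2.succ)
      (e k v.1.1.castSucc v.1.2.castSucc)
    exact ⟨_, x, fun d => (hx d).1⟩
  have hvertex : ∀ e : Fin (n + 1) → Edges N, (∀ k, Boundary (σ k) (e k)) →
      HasSum (fun D : Vertex N → Fin (n + 1) → ℕ => algebraMap K E (∏ v, F e v (D v)))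
        (algebraMap K E (edgeValue t m σ e)) := by
    intro e he
    refine hasSum_prod_vertex hE hm hσ e he (F e) (fun v s h => ?_) fun v h D => ?_
    · obtain ⟨path, h1, h2, h3⟩ := exists_path _ (hmono e v)
      rw [← h1.hasSum_iff]
      · rw [show (fun D => algebraMap K E (F e v D)) ∘ path =
          fun d => algebraMap K E (diag (vertexWord t e v) d) from
            funext fun d => congrArg _ (h2 d)]
        exact h
      · intro D hD
        exact (congrArg _ (h3 D hD)).trans (map_zero _)
    · obtain ⟨path, h1, h2, h3⟩ := exists_path _ (hmono e v)
      by_cases hD : D ∈ Set.range path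
      · obtain ⟨d, rfl⟩ := hD
        exact (h2 d).trans (h d)
      · exact h3 D hD
  -- for fixed edge states of the layers
  have hlayer : ∀ e : Fin (n + 1) → Edges N, (∀ k, Boundary (σ k) (e k)) →
      HasSum (fun D : Fin (n + 1) → Vertex N → ℕ => algebraMap K E
        (∏ k, ∏ v, localWeight t (e k) v (Finsupp.single (D (finRotate (n + 1) k) v) 1) (D k v)))
        (algebraMap K E (edgeValue t m σ e)) := by
    intro e he
    have h1 := hvertex e he
    rw [← (Equiv.piComm fun (_ : Fin (n + 1)) (_ : Vertex N) => ℕ).hasSum_iff] at h1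
    convert h1 using 2 with D
    simp only [Function.comp_apply, F]
    rw [Finset.prod_comm]
    rfl
  have hsum := hasSum_sum (s := (Finset.univ : Finset (Fin (n + 1) → Edges N)).filter
      (fun e => ∀ k, Boundary (σ k) (e k)))
    (f := fun e (p : (Fin (n + 1) → Edges N) × (Fin (n + 1) → Vertex N → ℕ)) =>
      if p.1 = e then algebraMap K E (∏ k, ∏ v, localWeight t (e k) v
        (Finsupp.single (p.2 (finRotate (n + 1) k) v) 1) (p.2 k v)) else 0)
    (a := fun e => algebraMap K E (edgeValue t m σ e)) (by
      intro e he
      have hinj : Function.Injective fun D : Fin (n + 1) → Vertex N → ℕ => (e, D) :=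
        Prod.mk_right_injective e
      rw [← hinj.hasSum_iff]
      · convert hlayer e (Finset.mem_filter.mp he).2 using 2 with D
        simp
      · rintro ⟨e', D⟩ hD
        refine if_neg ?_
        rintro rfl
        exact hD ⟨D, rfl⟩)
  have hcoe := (hasSum_subtype_iff_indicator (f := fun p : (Fin (n + 1) → Edges N) ×
    (Fin (n + 1) → Vertex N → ℕ) => algebraMap K E (∏ k, ∏ v, localWeight t (p.1 k) v
      (Finsupp.single (p.2 (finRotate (n + 1) k) v) 1) (p.2 k v)))
    (s := {p | ∀ k, Boundary (σ k) (p.1 k)})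
    (a := ∑ e ∈ (Finset.univ : Finset (Fin (n + 1) → Edges N)).filter
      (fun e => ∀ k, Boundary (σ k) (e k)), algebraMap K E (edgeValue t m σ e))).mpr (by
      convert hsum using 2 with p
      rw [Set.indicator_apply, Finset.sum_ite_eq]
      simp)
  exact hcoe

end

/-! ### The local exchange relation -/

section

variable {K : Type*} [Field K] (t : K) {n : ℕ}

/-- The matrix element of `letter t y α γ` at the state `e`. -/
def letterCoef (y α γ : Fin n.succ) (e : ℕ) : K :=
  if α = 0 ∨ y < α then 1
  else if α = y then (if γ = y then 1 else 1 - t ^ e)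
  else if γ = y then 0 else t ^ e

/-- The product of the matrix elements `letterCoef` over the colours `y > b`. -/
def rowCoef (b α γ : Fin n.succ) (e : Fin n.succ → ℕ) : K :=
  ∏ y ∈ Finset.Ioi b, letterCoef t y α γ (e y)

/-- The states after the action of the letters for `β` and `δ`. -/
def shift (β δ : Fin n.succ) (e : Fin n.succ → ℕ) (y : Fin n.succ) : ℕ :=
  e y + (if δ = y then 1 else 0) - (if β = y then 1 else 0)

/-- The sum of the states of the colours above `α`. -/
def above (α : Fin n.succ) (e : Fin n.succ → ℕ) : ℕ := ∑ y ∈ Finset.Ioi α, e y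

/-- `t` to the state of the colour `β`; there is no such state for the lowest colour `b`, for which
the value `0` is the convenient one. -/
def stateVar (b β : Fin n.succ) (e : Fin n.succ → ℕ) : K := if β = b then 0 else t ^ e β

variable {t} {b α β γ δ : Fin n.succ} {e : Fin n.succ → ℕ}

lemma rowCoef_zero : rowCoef t b 0 γ e = 1 :=
  Finset.prod_eq_one fun y _ => by simp [letterCoef]

lemma rowCoef_of_gt (hb : b ≤ α) (hα : α ≠ 0) (h : α < γ) : rowCoef t b α γ e = 0 := by
  refine Finset.prod_eq_zero (Finset.mem_Ioi.mpr (lt_of_le_of_lt hb h)) ?_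
  simp [letterCoef, hα, h.not_gt, h.ne]

lemma prod_letterCoef_Ioi (hα : α ≠ 0) (h : γ ≤ α) :
    ∏ y ∈ Finset.Ioi α, letterCoef t y α γ (e y) = t ^ above α e := by
  rw [above, ← Finset.prod_pow_eq_pow_sum]
  refine Finset.prod_congr rfl fun y hy => ?_
  rw [Finset.mem_Ioi] at hy
  simp [letterCoef, hα, hy.not_gt, hy.ne, (lt_of_le_of_lt h hy).ne]

lemma rowCoef_split (hb : b < α) :
    rowCoef t b α γ e =
      letterCoef t α α γ (e α) * ∏ y ∈ Finset.Ioi α, letterCoef t y α γ (e y) := by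
  have h1 : Finset.Ioi b = Finset.Ioo b α ∪ Finset.Ici α := by
    ext y
    simp only [Finset.mem_Ioi, Finset.mem_union, Finset.mem_Ioo, Finset.mem_Ici]
    exact ⟨fun h => (lt_or_ge y α).imp (fun h' => ⟨h, h'⟩) id,
      fun h => h.elim And.left fun h => lt_of_lt_of_le hb h⟩
  have h2 : Disjoint (Finset.Ioo b α) (Finset.Ici α) := by
    rw [Finset.disjoint_left]
    intro y hy hy'
    exact absurd (Finset.mem_Ioo.mp hy).2 (Finset.mem_Ici.mp hy').not_gt
  rw [rowCoef, h1, Finset.prod_union h2, Finset.prod_eq_one, one_mul, ← Finset.Ioi_insert,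
    Finset.prod_insert (by simp)]
  intro y hy
  simp [letterCoef, (Finset.mem_Ioo.mp hy).2]

lemma rowCoef_self (hb : b < α) : rowCoef t b α α e = t ^ above α e := by
  have hα : α ≠ 0 := (lt_of_le_of_lt (Fin.zero_le _) hb).ne'
  rw [rowCoef_split hb, prod_letterCoef_Ioi hα le_rfl]
  simp [letterCoef, hα]

lemma rowCoef_of_lt (hb : b ≤ α) (hα : α ≠ 0) (h : γ < α) :
    rowCoef t b α γ e = t ^ above α e * (1 - stateVar t b α e) := by
  rcases hb.eq_or_lt with rfl | hb
  · rw [rowCoef, prod_letterCoef_Ioi hα h.le, stateVar, if_pos rfl, sub_zero, mul_one]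
  · rw [rowCoef_split hb, prod_letterCoef_Ioi hα h.le, stateVar, if_neg hb.ne', mul_comm]
    simp [letterCoef, hα, h.ne]

lemma above_add (hβ : α < β → δ = β ∨ 1 ≤ e β) :
    above α (shift β δ e) + (if α < β then 1 else 0) = above α e + if α < δ then 1 else 0 := by
  have h1 : ∀ x : Fin n.succ, (if α < x then 1 else 0) =
      ∑ y ∈ Finset.Ioi α, if x = y then 1 else 0 := by
    intro x
    rw [Finset.sum_ite_eq]
    simp
  rw [h1 β, h1 δ, above, above, ← Finset.sum_add_distrib, ← Finset.sum_add_distrib]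
  refine Finset.sum_congr rfl fun y hy => ?_
  rw [Finset.mem_Ioi] at hy
  rw [shift]
  by_cases h : β = y
  · subst h
    have := hβ hy
    by_cases h' : δ = β
    · simp [h']
    · rw [if_pos rfl, if_neg h']
      have := this.resolve_left h'
      omega
  · rw [if_neg h]
    omega

lemma above_shift_of_le (h : β ≤ α) :
    above α (shift β δ e) = above α e + if α < δ then 1 else 0 := by
  have := above_add (α := α) (β := β) (δ := δ) (e := e) fun h' => absurd h' h.not_gt
  rwa [if_neg h.not_gt, add_zero] at this

lemma above_shift_self (h : α < β) : above α (shift β β e) = above α e := by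
  have := above_add (α := α) (β := β) (δ := β) (e := e) fun _ => Or.inl rfl
  rw [if_pos h] at this
  omega

lemma above_shift_succ (h : α < β) (he : 1 ≤ e β) :
    above α (shift β δ e) + 1 = above α e + if α < δ then 1 else 0 := by
  have := above_add (α := α) (β := β) (δ := δ) (e := e) fun _ => Or.inr he
  rwa [if_pos h] at this

lemma stateVar_shift (h : α ≠ β) : stateVar t b α (shift β δ e) =
    if δ = α then t * stateVar t b α e else stateVar t b α e := by
  rw [stateVar, stateVar, shift, if_neg (Ne.symm h), Nat.sub_zero]
  by_cases h1 : α = b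
  · simp [h1]
  · simp only [if_neg h1]
    split_ifs
    · rw [pow_succ']
    · rw [add_zero]

lemma stateVar_of_eq_zero (hb : b < α) (he : e α = 0) : stateVar t b α e = 1 := by
  rw [stateVar, if_neg hb.ne', he, pow_zero]

/-- The exchange relation if one of the two balls of the upper row is missing. -/
lemma rowCoef_exchange (hb : b ≤ α) (hα : α ≠ 0) (hγ : γ ≠ b) (hδ : δ ≠ b) :
    rowCoef t b α γ (shift 0 δ e) - rowCoef t b α δ e =
      t ^ (if γ < δ then 1 else 0) * (rowCoef t b α γ e - rowCoef t b α δ e) := by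
  have hbα : ∀ {x : Fin n.succ}, x ≠ b → x = α → b < α := fun h h' =>
    lt_of_le_of_ne hb (h' ▸ Ne.symm h)
  have hab : above α (shift 0 δ e) = above α e + if α < δ then 1 else 0 :=
    above_shift_of_le (Fin.zero_le _)
  have hst : stateVar t b α (shift 0 δ e) =
      if δ = α then t * stateVar t b α e else stateVar t b α e := stateVar_shift hα
  rcases lt_trichotomy γ α with hg | hg | hg <;> rcases lt_trichotomy δ α with hd | hd | hd
  · rw [rowCoef_of_lt hb hα hg, rowCoef_of_lt hb hα hd, rowCoef_of_lt hb hα hg, hab, hst,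
      if_neg hd.not_gt, if_neg hd.ne]
    ring
  · have hb' := hbα hδ hd
    subst hd
    rw [rowCoef_of_lt hb hα hg, rowCoef_self hb', rowCoef_of_lt hb hα hg, hab, hst,
      if_neg (lt_irrefl _), if_pos rfl, if_pos hg]
    ring
  · rw [rowCoef_of_lt hb hα hg, rowCoef_of_gt hb hα hd, rowCoef_of_lt hb hα hg, hab, hst,
      if_pos hd, if_neg hd.ne', if_pos (hg.trans hd)]
    ring
  · have hb' := hbα hγ hg
    subst hg
    rw [rowCoef_self hb', rowCoef_of_lt hb hα hd, rowCoef_self hb', hab, if_neg hd.not_gt]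
    ring
  · have hb' := hbα hγ hg
    subst hg
    subst hd
    rw [rowCoef_self hb', rowCoef_self hb', hab, if_neg (lt_irrefl _)]
    ring
  · have hb' := hbα hγ hg
    subst hg
    rw [rowCoef_self hb', rowCoef_of_gt hb hα hd, rowCoef_self hb', hab, if_pos hd]
    ring
  · rw [rowCoef_of_gt hb hα hg, rowCoef_of_gt hb hα hg, if_neg (hd.trans hg).not_gt]
    ring
  · rw [rowCoef_of_gt hb hα hg, rowCoef_of_gt hb hα hg, if_neg (by rw [hd]; exact hg.not_gt)]
    ring
  · rw [rowCoef_of_gt hb hα hg, rowCoef_of_gt hb hα hg, rowCoef_of_gt hb hα hd]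
    ring

lemma rowCoef_comm (hb : b ≤ α) (hα : α ≠ 0) (hγ : γ ≠ b) (hδ : δ ≠ b) :
    rowCoef t b α δ (shift α γ e) * rowCoef t b α γ e =
      rowCoef t b α γ (shift α δ e) * rowCoef t b α δ e := by
  have hbα : ∀ {x : Fin n.succ}, x ≠ b → x = α → b < α := fun h h' =>
    lt_of_le_of_ne hb (h' ▸ Ne.symm h)
  have hab : ∀ x, x ≤ α → above α (shift α x e) = above α e := by
    intro x hx
    rw [above_shift_of_le le_rfl, if_neg hx.not_gt, add_zero]
  have hst : stateVar t b α (shift α α e) = stateVar t b α e := by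
    rw [stateVar, stateVar, shift, if_pos rfl, Nat.add_sub_cancel]
  have hst' : ∀ x, x < α → stateVar t b α (shift α x e) = if α = b then 0 else t ^ (e α - 1) := by
    intro x hx
    rw [stateVar, shift, if_pos rfl, if_neg hx.ne, add_zero]
  rcases lt_trichotomy γ α with hg | hg | hg <;> rcases lt_trichotomy δ α with hd | hd | hd
  · rw [rowCoef_of_lt hb hα hd, rowCoef_of_lt hb hα hg, rowCoef_of_lt hb hα hg,
      rowCoef_of_lt hb hα hd, hab _ hg.le, hab _ hd.le, hst' _ hg, hst' _ hd]
  · have hb' := hbα hδ hd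
    subst hd
    rw [rowCoef_self hb', rowCoef_self hb', rowCoef_of_lt hb hα hg, rowCoef_of_lt hb hα hg,
      hab _ hg.le, hab _ le_rfl, hst]
    ring
  · rw [rowCoef_of_gt hb hα hd, rowCoef_of_gt hb hα hd]
    ring
  · have hb' := hbα hγ hg
    subst hg
    rw [rowCoef_self hb', rowCoef_self hb', rowCoef_of_lt hb hα hd, rowCoef_of_lt hb hα hd,
      hab _ hd.le, hab _ le_rfl, hst]
    ring
  · rw [hg, hd]
  · rw [rowCoef_of_gt hb hα hd, rowCoef_of_gt hb hα hd]
    ring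
  all_goals
    rw [rowCoef_of_gt hb hα hg, rowCoef_of_gt hb hα hg]
    ring

/-- The exchange relation if the upper row has the colours `α < β`. -/
lemma rowCoef_exchange_of_lt (hb : b ≤ α) (hα : α ≠ 0) (hγ : γ ≠ b) (hδ : δ ≠ b) (hαβ : α < β) :
    rowCoef t b β γ (shift α δ e) * rowCoef t b α δ e -
        t * (rowCoef t b α γ (shift β δ e) * rowCoef t b β δ e) =
      t ^ (if γ < δ then 1 else 0) * (rowCoef t b α δ (shift β γ e) * rowCoef t b β γ e -
        rowCoef t b α γ (shift β δ e) * rowCoef t b β δ e) := by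
  have hbβ : b < β := lt_of_le_of_lt hb hαβ
  have hβ : β ≠ 0 := (lt_of_le_of_lt (Fin.zero_le _) hbβ).ne'
  have hbα : ∀ {x : Fin n.succ}, x ≠ b → x = α → b < α := fun h h' =>
    lt_of_le_of_ne hb (h' ▸ Ne.symm h)
  -- the state of `β` is not zero unless the factor `1 - t ^ e β` vanishes
  have hone : e β = 0 ∨ 1 ≤ e β := Nat.eq_zero_or_pos _
  have hβ0 : ∀ x, x < β → e β = 0 → rowCoef t b β x e = 0 := by
    intro x hx h0
    rw [rowCoef_of_lt hbβ.le hβ hx, stateVar_of_eq_zero hbβ h0, sub_self, mul_zero]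
  have hβ0' : ∀ x, x < β → δ ≤ α → e β = 0 → rowCoef t b β x (shift α δ e) = 0 := by
    intro x hx hd h0
    rw [rowCoef_of_lt hbβ.le hβ hx, stateVar_shift hαβ.ne', if_neg (lt_of_le_of_lt hd hαβ).ne,
      stateVar_of_eq_zero hbβ h0, sub_self, mul_zero]
  have hD : ∀ x, x ≤ α → 1 ≤ e β → above α (shift β x e) + 1 = above α e := by
    intro x hx h
    rw [above_shift_succ hαβ h, if_neg hx.not_gt, add_zero]
  have hD' : ∀ x, α < x → 1 ≤ e β → above α (shift β x e) = above α e := by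
    intro x hx h
    have := above_shift_succ (δ := x) hαβ h
    rw [if_pos hx] at this
    omega
  have hBβ : δ ≤ α → above β (shift α δ e) = above β e := by
    intro h
    rw [above_shift_of_le hαβ.le, if_neg (lt_of_le_of_lt h hαβ).not_gt, add_zero]
  have hSβ : δ ≤ α → stateVar t b β (shift α δ e) = stateVar t b β e := by
    intro h
    rw [stateVar_shift hαβ.ne', if_neg (lt_of_le_of_lt h hαβ).ne]
  rcases le_or_gt γ α with hg | hg
  · have hgβ := lt_of_le_of_lt hg hαβ
    rcases le_or_gt δ α with hd | hd
    · have hdβ := lt_of_le_of_lt hd hαβ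
      rcases hone with h0 | h1
      · rw [hβ0 γ hgβ h0, hβ0 δ hdβ h0, hβ0' γ hgβ hd h0]
        ring
      · have e1 : t ^ above α e = t * t ^ above α (shift β γ e) := by
          rw [← hD γ hg h1, pow_succ']
        have e2 : above α (shift β δ e) = above α (shift β γ e) := by
          have := hD γ hg h1
          have := hD δ hd h1
          omega
        rw [rowCoef_of_lt hbβ.le hβ hgβ, rowCoef_of_lt hbβ.le hβ hgβ, rowCoef_of_lt hbβ.le hβ hdβ,
          hBβ hd, hSβ hd]
        rcases hg.lt_or_eq with hg' | hg' <;> rcases hd.lt_or_eq with hd' | hd'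
        · rw [rowCoef_of_lt hb hα hg', rowCoef_of_lt hb hα hd', rowCoef_of_lt hb hα hd', e1, e2,
            stateVar_shift hαβ.ne, stateVar_shift hαβ.ne, if_neg hd'.ne, if_neg hg'.ne]
          ring
        · have hb' := hbα hδ hd'
          subst hd'
          rw [rowCoef_of_lt hb hα hg', rowCoef_self hb', rowCoef_self hb', e1, e2,
            stateVar_shift hαβ.ne, if_pos rfl, if_pos hg']
          ring
        · have hb' := hbα hγ hg'
          subst hg'
          rw [rowCoef_self hb', rowCoef_of_lt hb hα hd', rowCoef_of_lt hb hα hd', e1, e2,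
            stateVar_shift hαβ.ne, if_pos rfl, if_neg hd'.not_gt]
          ring
        · have hb' := hbα hγ hg'
          subst hg'
          subst hd'
          rw [rowCoef_self hb', rowCoef_self hb', e1, if_neg (lt_irrefl _)]
          ring
    · rw [rowCoef_of_gt hb hα hd, rowCoef_of_gt hb hα hd, if_pos (lt_of_le_of_lt hg hd)]
      ring
  · rw [rowCoef_of_gt hb hα hg]
    rcases le_or_gt δ α with hd | hd
    · rw [if_neg (lt_of_le_of_lt hd hg).not_gt]
      rcases lt_trichotomy γ β with hgβ | hgβ | hgβ
      · rcases hone with h0 | h1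
        · rw [hβ0 γ hgβ h0, hβ0' γ hgβ hd h0]
          ring
        · rw [rowCoef_of_lt hbβ.le hβ hgβ, rowCoef_of_lt hbβ.le hβ hgβ, hBβ hd, hSβ hd]
          rcases hd.lt_or_eq with hd' | hd'
          · rw [rowCoef_of_lt hb hα hd', rowCoef_of_lt hb hα hd', hD' γ hg h1,
              stateVar_shift hαβ.ne, if_neg hg.ne']
            ring
          · have hb' := hbα hδ hd'
            subst hd'
            rw [rowCoef_self hb', rowCoef_self hb', hD' γ hg h1]
            ring
      · subst hgβ
        rw [rowCoef_self hbβ, rowCoef_self hbβ, hBβ hd]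
        rcases hd.lt_or_eq with hd' | hd'
        · rw [rowCoef_of_lt hb hα hd', rowCoef_of_lt hb hα hd', above_shift_self hαβ,
            stateVar_shift hαβ.ne, if_neg hαβ.ne']
          ring
        · have hb' := hbα hδ hd'
          subst hd'
          rw [rowCoef_self hb', rowCoef_self hb', above_shift_self hαβ]
          ring
      · rw [rowCoef_of_gt hbβ.le hβ hgβ, rowCoef_of_gt hbβ.le hβ hgβ]
        ring
    · rw [rowCoef_of_gt hb hα hd, rowCoef_of_gt hb hα hd]
      ring

/-- The exchange relation if the upper row has the colours `α > β`, both of them balls. -/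
lemma rowCoef_exchange_of_gt (hb : b ≤ β) (hβ : β ≠ 0) (hγ : γ ≠ b) (hδ : δ ≠ b) (hβα : β < α) :
    t * (rowCoef t b β γ (shift α δ e) * rowCoef t b α δ e) -
        rowCoef t b α γ (shift β δ e) * rowCoef t b β δ e =
      t ^ (if γ < δ then 1 else 0) * (rowCoef t b α δ (shift β γ e) * rowCoef t b β γ e -
        rowCoef t b α γ (shift β δ e) * rowCoef t b β δ e) := by
  have hbα : b < α := lt_of_le_of_lt hb hβα
  have hα : α ≠ 0 := (lt_of_le_of_lt (Fin.zero_le _) hbα).ne'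
  have hbβ : ∀ {x : Fin n.succ}, x ≠ b → x = β → b < β := fun h h' =>
    lt_of_le_of_ne hb (h' ▸ Ne.symm h)
  have hone : e α = 0 ∨ 1 ≤ e α := Nat.eq_zero_or_pos _
  have hα0 : ∀ x, x < α → e α = 0 → rowCoef t b α x e = 0 := by
    intro x hx h0
    rw [rowCoef_of_lt hbα.le hα hx, stateVar_of_eq_zero hbα h0, sub_self, mul_zero]
  have hα0' : ∀ x z, x < α → z ≤ β → e α = 0 → rowCoef t b α x (shift β z e) = 0 := by
    intro x z hx hz h0
    rw [rowCoef_of_lt hbα.le hα hx, stateVar_shift hβα.ne', if_neg (lt_of_le_of_lt hz hβα).ne,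
      stateVar_of_eq_zero hbα h0, sub_self, mul_zero]
  have hD : 1 ≤ e α → δ ≤ β → above β (shift α δ e) + 1 = above β e := by
    intro h hx
    rw [above_shift_succ hβα h, if_neg hx.not_gt, add_zero]
  have hD' : 1 ≤ e α → β < δ → above β (shift α δ e) = above β e := by
    intro h hx
    have := above_shift_succ (δ := δ) hβα h
    rw [if_pos hx] at this
    omega
  have hAα : ∀ x, x ≤ β → above α (shift β x e) = above α e := by
    intro x hx
    rw [above_shift_of_le hβα.le, if_neg (lt_of_le_of_lt hx hβα).not_gt, add_zero]
  have hSα : ∀ x, x ≤ β → stateVar t b α (shift β x e) = stateVar t b α e := by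
    intro x hx
    rw [stateVar_shift hβα.ne', if_neg (lt_of_le_of_lt hx hβα).ne]
  rcases le_or_gt γ β with hg | hg
  · have hgα := lt_of_le_of_lt hg hβα
    rcases le_or_gt δ β with hd | hd
    · have hdα := lt_of_le_of_lt hd hβα
      rcases hone with h0 | h1
      · rw [hα0 δ hdα h0, hα0' γ δ hgα hd h0, hα0' δ γ hdα hg h0]
        ring
      · have e1 : t ^ above β e = t * t ^ above β (shift α δ e) := by
          rw [← hD h1 hd, pow_succ']
        rw [rowCoef_of_lt hbα.le hα hdα, rowCoef_of_lt hbα.le hα hgα, rowCoef_of_lt hbα.le hα hdα,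
          hAα γ hg, hAα δ hd, hSα γ hg, hSα δ hd]
        rcases hg.lt_or_eq with hg' | hg' <;> rcases hd.lt_or_eq with hd' | hd'
        · rw [rowCoef_of_lt hb hβ hg', rowCoef_of_lt hb hβ hg', rowCoef_of_lt hb hβ hd', e1,
            stateVar_shift hβα.ne, if_neg hd'.ne]
          ring
        · have hb' := hbβ hδ hd'
          subst hd'
          rw [rowCoef_of_lt hb hβ hg', rowCoef_of_lt hb hβ hg', rowCoef_self hb', e1,
            stateVar_shift hβα.ne, if_pos rfl, if_pos hg']
          ring
        · have hb' := hbβ hγ hg'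
          subst hg'
          rw [rowCoef_self hb', rowCoef_self hb', rowCoef_of_lt hb hβ hd', e1,
            if_neg hd'.not_gt]
          ring
        · have hb' := hbβ hγ hg'
          subst hg'
          subst hd'
          rw [rowCoef_self hb', rowCoef_self hb', e1, if_neg (lt_irrefl _)]
          ring
    · rw [rowCoef_of_gt hb hβ hd, if_pos (lt_of_le_of_lt hg hd)]
      rcases lt_trichotomy δ α with hdα | hdα | hdα
      · rcases hone with h0 | h1
        · rw [hα0 δ hdα h0, hα0' δ γ hdα hg h0]
          ring
        · rw [rowCoef_of_lt hbα.le hα hdα, rowCoef_of_lt hbα.le hα hdα, hAα γ hg, hSα γ hg]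
          rcases hg.lt_or_eq with hg' | hg'
          · rw [rowCoef_of_lt hb hβ hg', rowCoef_of_lt hb hβ hg', hD' h1 hd,
              stateVar_shift hβα.ne, if_neg hd.ne']
            ring
          · have hb' := hbβ hγ hg'
            subst hg'
            rw [rowCoef_self hb', rowCoef_self hb', hD' h1 hd]
            ring
      · subst hdα
        rw [rowCoef_self hbα, rowCoef_self hbα, hAα γ hg]
        rcases hg.lt_or_eq with hg' | hg'
        · rw [rowCoef_of_lt hb hβ hg', rowCoef_of_lt hb hβ hg', above_shift_self hβα,
            stateVar_shift hβα.ne, if_neg hβα.ne']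
          ring
        · have hb' := hbβ hγ hg'
          subst hg'
          rw [rowCoef_self hb', rowCoef_self hb', above_shift_self hβα]
          ring
      · rw [rowCoef_of_gt hbα.le hα hdα, rowCoef_of_gt hbα.le hα hdα]
        ring
  · rw [rowCoef_of_gt hb hβ hg, rowCoef_of_gt hb hβ hg]
    rcases le_or_gt δ β with hd | hd
    · rw [if_neg (lt_of_le_of_lt hd hg).not_gt]
      ring
    · rw [rowCoef_of_gt hb hβ hd]
      ring

/-- The exchange relation between two neighbouring columns: exchanging the colours `α`, `β` in the
upper row amounts to exchanging the colours `γ`, `δ` in the lower row, up to a difference of terms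
that count the balls in the upper row. -/
theorem rowCoef_exchange_relation (hα : α ≠ 0 → b ≤ α) (hβ : β ≠ 0 → b ≤ β) (hγ : γ ≠ b)
    (hδ : δ ≠ b) :
    t ^ (if β < α then 1 else 0) * (rowCoef t b β γ (shift α δ e) * rowCoef t b α δ e) -
        t ^ (if α < β then 1 else 0) * (rowCoef t b α γ (shift β δ e) * rowCoef t b β δ e) -
        t ^ (if γ < δ then 1 else 0) * (rowCoef t b α δ (shift β γ e) * rowCoef t b β γ e -
          rowCoef t b α γ (shift β δ e) * rowCoef t b β δ e) =
      (1 - t) * (((if β ≠ 0 then 1 else 0) - (if α ≠ 0 then 1 else 0)) *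
        (rowCoef t b α γ (shift β δ e) * rowCoef t b β δ e)) := by
  by_cases hα0 : α = 0
  · subst hα0
    by_cases hβ0 : β = 0
    · subst hβ0
      simp only [rowCoef_zero]
      ring
    · have := rowCoef_exchange (t := t) (e := e) (hβ hβ0) hβ0 hγ hδ
      have hpos : (0 : Fin n.succ) < β := Fin.pos_of_ne_zero hβ0
      simp only [rowCoef_zero, hpos, hpos.not_gt, hβ0, if_true, if_false, ne_eq, not_true_eq_false,
        not_false_eq_true, pow_zero, pow_one]
      linear_combination this
  · by_cases hβ0 : β = 0
    · subst hβ0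
      have h1 := rowCoef_exchange (t := t) (e := e) (hα hα0) hα0 hγ hδ
      have h2 := rowCoef_exchange (t := t) (e := e) (hα hα0) hα0 hδ hγ
      have hpos : (0 : Fin n.succ) < α := Fin.pos_of_ne_zero hα0
      simp only [rowCoef_zero, hpos, hpos.not_gt, hα0, if_true, if_false, ne_eq, not_true_eq_false,
        not_false_eq_true, pow_zero, pow_one]
      rcases lt_trichotomy γ δ with h | h | h
      · simp only [h, h.not_gt, if_true, if_false, pow_zero, pow_one] at h1 h2 ⊢
        linear_combination (-t) * h2
      · subst h
        simp only [lt_irrefl, if_false, pow_zero] at h1 h2 ⊢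
        linear_combination (-t) * h1
      · simp only [h, h.not_gt, if_true, if_false, pow_zero, pow_one] at h1 h2 ⊢
        linear_combination (1-t) * h1 - h2
    · rcases lt_trichotomy α β with h | h | h
      · have := rowCoef_exchange_of_lt (t := t) (e := e) (hα hα0) hα0 hγ hδ h
        simp only [h, h.not_gt, hα0, hβ0, if_true, if_false, ne_eq, not_false_eq_true, pow_zero,
          pow_one]
        linear_combination this
      · subst h
        have := rowCoef_comm (t := t) (e := e) (hα hα0) hα0 hγ hδ
        simp only [lt_irrefl, if_false, pow_zero, hα0, ne_eq, not_false_eq_true, if_true]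
        linear_combination (-t ^ (if γ < δ then 1 else 0)) * this
      · have := rowCoef_exchange_of_gt (t := t) (e := e) (hβ hβ0) hβ0 hγ hδ h
        simp only [h, h.not_gt, hα0, hβ0, if_true, if_false, ne_eq, not_false_eq_true, pow_zero,
          pow_one]
        linear_combination this

end

/-! ### Cyclic invariance of the trace -/

section

variable {K : Type*} [Field K] {t : K} {E : Type*} [Field E] [TopologicalSpace E] [Algebra K E]

lemma vertexWeight_cases (i a j b : Fin 2) : vertexWeight t i a j b = 0 ∨
    vertexWeight t i a j b = 1 ∨ vertexWeight t i a j b = opK t ∨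
    vertexWeight t i a j b = aMinus t ∨ vertexWeight t i a j b = aPlus K := by
  fin_cases i <;> fin_cases a <;> fin_cases j <;> fin_cases b <;> simp [vertexWeight]

/-- As the sums over `d` are infinite, cyclicity of the trace is proved for one vertex weight at a
time; it shifts the summation by at most one step. -/
lemma HasTr.vertexWeight_mul_comm [IsTopologicalRing E] {i a j b : Fin 2}
    {W : Module.End K (Fock K)} {s : K} (h : HasTr E (vertexWeight t i a j b * W) s) :
    HasTr E (W * vertexWeight t i a j b) s := by
  rcases vertexWeight_cases (t := t) i a j b with h1 | h1 | h1 | h1 | h1 <;> rw [h1] at h ⊢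
  · rw [zero_mul] at h
    rwa [mul_zero]
  · rw [one_mul] at h
    rwa [mul_one]
  · rw [HasTr] at h ⊢
    convert h using 3 with d
    rw [diag, diag, Module.End.mul_apply, Module.End.mul_apply, opK_apply, opK_single, one_mul,
      ← Finsupp.smul_single_one, map_smul, Finsupp.smul_apply, smul_eq_mul]
  · have h0 : diag (W * aMinus t) 0 = 0 := by
      rw [diag, Module.End.mul_apply, aMinus_single]
      simp
    have h2 : ∀ d, diag (W * aMinus t) (d + 1) = diag (aMinus t * W) d := by
      intro d
      rw [diag, diag, Module.End.mul_apply, Module.End.mul_apply, aMinus_apply, aMinus_single,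
        one_mul, ← Finsupp.smul_single_one, map_smul, Finsupp.smul_apply, smul_eq_mul,
        Nat.add_sub_cancel]
    rw [HasTr, ← hasSum_nat_add_iff' 1, Finset.sum_range_one, h0, map_zero, sub_zero]
    simp only [h2]
    exact h
  · rw [HasTr, ← hasSum_nat_add_iff' 1] at h
    rw [Finset.sum_range_one, diag_aPlus_mul_zero, map_zero, sub_zero] at h
    rw [HasTr]
    simpa only [diag_aPlus_mul_succ] using h

lemma HasTr.letterWord_rotate [IsTopologicalRing E] {N n : ℕ} {y : Fin (N + 2)}
    {τ σ : Config N (n + 1)} {s : K} (h : HasTr E (letterWord t y τ σ) s) :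
    HasTr E (letterWord t y (τ ∘ finRotate (n + 1)) (σ ∘ finRotate (n + 1))) s := by
  rw [letterWord, List.ofFn_succ, List.prod_cons] at h
  have h1 := h.vertexWeight_mul_comm
  rw [letterWord, List.ofFn_succ', List.concat_eq_append, List.prod_append, List.prod_singleton]
  have hrot : ∀ k : Fin n, finRotate (n + 1) k.castSucc = k.succ := fun k => by
    rw [finRotate_apply, Fin.coeSucc_eq_succ]
  simp only [Function.comp_apply, hrot, finRotate_last]
  exact h1

end

/-! ### The transfer matrices between rows commute with the Markov matrix -/

section

variable {N L : ℕ} {m : Fin (N + 2) → ℕ}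

lemma comp_mem_levelSector_iff {r : Fin (N + 1)} (σ : Config N L) (ρ : Equiv.Perm (Fin L)) :
    σ ∘ ρ ∈ levelSector m r ↔ σ ∈ levelSector m r := by
  refine forall₂_congr fun y _ => ?_
  have : (Finset.univ.filter fun j => (σ ∘ ρ) j = y).card =
      (Finset.univ.filter fun j => σ j = y).card := by
    refine Finset.card_bij (fun j _ => ρ j) (fun j hj => by simpa using hj)
      (fun _ _ _ _ h => ρ.injective h) fun j hj => ⟨ρ.symm j, ?_, by simp⟩
    simpa using hj
  rw [this]

lemma exchange_mem_levelSector_iff {r : Fin (N + 1)} (σ : Config N L) (i : Fin L) :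
    exchange i σ ∈ levelSector m r ↔ σ ∈ levelSector m r :=
  comp_mem_levelSector_iff σ _

lemma exchange_exchange (i : Fin L) (σ : Config N L) : exchange i (exchange i σ) = σ := by
  funext j
  simp [exchange]

lemma eq_exchange_iff (i : Fin L) (σ τ : Config N L) : σ = exchange i τ ↔ τ = exchange i σ := by
  constructor <;> (rintro rfl; rw [exchange_exchange])

lemma exchange_apply_left (i : Fin L) (σ : Config N L) : exchange i σ i = σ (finRotate L i) := by
  simp [exchange]

lemma exchange_apply_right (i : Fin L) (σ : Config N L) : exchange i σ (finRotate L i) = σ i := by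
  simp [exchange]

lemma finRotate_pow_zero {n : ℕ} (i : Fin (n + 1)) : (finRotate (n + 1) ^ (i : ℕ)) 0 = i := by
  have : ∀ k : ℕ, (finRotate (n + 1) ^ k) 0 = Fin.ofNat (n + 1) k := by
    intro k
    induction k with
    | zero => rfl
    | succ k ih =>
      rw [pow_succ', Equiv.Perm.mul_apply, ih, finRotate_apply]
      ext
      simp [Fin.val_add]
  rw [this]
  ext
  simp

lemma exchange_comp_rotate {n : ℕ} (i : Fin (n + 1)) (σ : Config N (n + 1)) :
    exchange i σ ∘ ⇑(finRotate (n + 1) ^ (i : ℕ)) =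
      exchange 0 (σ ∘ ⇑(finRotate (n + 1) ^ (i : ℕ))) := by
  have h1 : (finRotate (n + 1) ^ (i : ℕ)) (finRotate (n + 1) 0) = finRotate (n + 1) i := by
    conv_rhs => rw [← finRotate_pow_zero i]
    rw [← Equiv.Perm.mul_apply, ← Equiv.Perm.mul_apply, ← pow_succ, ← pow_succ']
  have h2 : Equiv.swap i (finRotate (n + 1) i) * finRotate (n + 1) ^ (i : ℕ) =
      finRotate (n + 1) ^ (i : ℕ) * Equiv.swap 0 (finRotate (n + 1) 0) := by
    rw [Equiv.mul_swap_eq_swap_mul, finRotate_pow_zero, h1]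
  funext j
  have h3 := congrArg (fun ρ : Equiv.Perm (Fin (n + 1)) => σ (ρ j)) h2
  exact h3

variable {K : Type*} [Field K] {t : K}

open Classical in
lemma markov_mulVec (f : Config N L → K) (σ : Config N L) :
    (markov t N L).mulVec f σ = ∑ i : Fin L,
      (t ^ (if σ (finRotate L i) < σ i then 1 else 0) * f (exchange i σ) -
        t ^ (if σ i < σ (finRotate L i) then 1 else 0) * f σ) := by
  rw [Matrix.mulVec, dotProduct]
  simp only [markov, Matrix.of_apply, Finset.sum_mul]
  rw [Finset.sum_comm]
  refine Finset.sum_congr rfl fun i _ => ?_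
  simp only [mul_sub, sub_mul, Finset.sum_sub_distrib]
  congr 1
  · rw [Finset.sum_eq_single (exchange i σ)]
    · rw [if_pos (exchange_exchange i σ).symm, mul_one, exchange_apply_left, exchange_apply_right]
    · intro τ _ hτ
      rw [if_neg (fun h => hτ ((eq_exchange_iff i σ τ).mp h)), mul_zero, zero_mul]
    · simp
  · rw [Finset.sum_eq_single σ]
    · rw [if_pos rfl, mul_one]
    · intro τ _ hτ
      rw [if_neg (Ne.symm hτ), mul_zero, zero_mul]
    · simp

lemma sum_mul_markov (f : Config N L → K) (τ : Config N L) :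
    ∑ τ', f τ' * markov t N L τ' τ = ∑ i : Fin L,
      t ^ (if τ i < τ (finRotate L i) then 1 else 0) * (f (exchange i τ) - f τ) := by
  simp only [markov, Matrix.of_apply, Finset.mul_sum]
  rw [Finset.sum_comm]
  refine Finset.sum_congr rfl fun i _ => ?_
  simp only [mul_sub, Finset.sum_sub_distrib, mul_ite, mul_one, mul_zero, Finset.sum_ite_eq',
    Finset.mem_univ, if_true]
  ring

lemma letter_single {y : Fin (N + 2)} (hy : y ≠ 0) (α γ : Fin (N + 2)) (e : ℕ) :
    letter t y α γ (Finsupp.single e 1) =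
      Finsupp.single (e + (if γ = y then 1 else 0) - (if α = y then 1 else 0))
        (letterCoef t y α γ e) := by
  by_cases hα0 : α = 0
  · subst hα0
    by_cases hγ : γ = y <;> simp [letter, letterCoef, bit, vertexWeight, hγ, Ne.symm hy]
  · rcases lt_trichotomy α y with h | h | h
    · by_cases hγ : γ = y <;>
        simp [letter, letterCoef, bit, vertexWeight, hγ, hα0, h, h.le, h.ne, h.not_gt]
    · subst h
      by_cases hγ : γ = α <;>
        simp [letter, letterCoef, bit, vertexWeight, hγ, hα0, -Finsupp.single_sub]
    · by_cases hγ : γ = y <;>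
        simp [letter, letterCoef, bit, vertexWeight, hγ, hα0, h, h.ne', h.not_gt, h.not_ge]

lemma letter_mul_letter_single {y : Fin (N + 2)} (hy : y ≠ 0) (α β γ δ : Fin (N + 2)) (e : ℕ) :
    letter t y α γ (letter t y β δ (Finsupp.single e 1)) =
      Finsupp.single (e + ((if γ = y then 1 else 0) + (if δ = y then 1 else 0)) -
        ((if α = y then 1 else 0) + (if β = y then 1 else 0)))
        (letterCoef t y α γ (e + (if δ = y then 1 else 0) - (if β = y then 1 else 0)) *
          letterCoef t y β δ e) := by
  rw [letter_single hy, ← Finsupp.smul_single_one, map_smul, letter_single hy, Finsupp.smul_single,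
    smul_eq_mul, mul_comm]
  by_cases h : letterCoef t y β δ e = 0
  · rw [h, mul_zero, Finsupp.single_zero, Finsupp.single_zero]
  · have hle : (if β = y then 1 else 0) ≤ e + (if δ = y then 1 else 0) := by
      by_cases hβ : β = y
      · by_cases hδ : δ = y
        · rw [if_pos hδ]
          split_ifs
          omega
        · rw [if_pos hβ]
          have : e ≠ 0 := by
            rintro rfl
            refine h ?_
            rw [letterCoef, if_neg (by rw [hβ]; simp [hy]), if_pos hβ, if_neg hδ, pow_zero,
              sub_self]
          omega
      · simp [hβ]
    congr 1
    omega

/-- The product of the traces at the vertices of one vertical line. -/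
def columnValue (t : K) (m : Fin (N + 2) → ℕ) (s : Fin N) (τ σ : Config N L) : K :=
  ∏ z ∈ Finset.Ici s, vertexValue t m s z τ σ

variable {E : Type*} [Field E] [TopologicalSpace E] [Algebra K E] [IsTopologicalRing E] [T3Space E]

lemma columnValue_rotate (hE : IsSummationField t E) (hm : ∀ α, 1 ≤ m α) {s : Fin N} {n : ℕ}
    {τ σ : Config N (n + 1)} (hσ : σ ∈ levelSector m s.castSucc) (k : ℕ) :
    columnValue t m s (τ ∘ ⇑(finRotate (n + 1) ^ k)) (σ ∘ ⇑(finRotate (n + 1) ^ k)) =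
      columnValue t m s τ σ := by
  induction k with
  | zero => rfl
  | succ k ih =>
    rw [← ih]
    refine Finset.prod_congr rfl fun z hz => ?_
    have hσ' : σ ∘ ⇑(finRotate (n + 1) ^ k) ∈ levelSector m s.castSucc :=
      (comp_mem_levelSector_iff σ _).mpr hσ
    have h1 := (hasTr_letterWord (E := E) hE hm (Finset.mem_Ici.mp hz)
      (τ := τ ∘ ⇑(finRotate (n + 1) ^ k)) hσ').letterWord_rotate
    have h2 := hasTr_letterWord (E := E) hE hm (Finset.mem_Ici.mp hz)
      (τ := (τ ∘ ⇑(finRotate (n + 1) ^ k)) ∘ finRotate (n + 1))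
      ((comp_mem_levelSector_iff _ (finRotate (n + 1))).mpr hσ')
    exact h2.unique h1

lemma hasSum_columnValue (hE : IsSummationField t E) (hm : ∀ α, 1 ≤ m α) {s : Fin N}
    (τ : Config N L) {σ : Config N L} (hσ : σ ∈ levelSector m s.castSucc) :
    HasSum (fun d : {z // z ∈ Finset.Ici s} → ℕ => algebraMap K E
      (∏ z : {z // z ∈ Finset.Ici s}, diag (letterWord t z.1.succ.succ τ σ) (d z)))
      (algebraMap K E (columnValue t m s τ σ)) := by
  have h := hasSum_pi hE (fun (z : {z // z ∈ Finset.Ici s}) d =>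
    algebraMap K E (diag (letterWord t z.1.succ.succ τ σ) d))
    (fun z => algebraMap K E (vertexValue t m s z.1 τ σ))
    fun z => hasTr_letterWord hE hm (Finset.mem_Ici.mp z.2) hσ
  rw [columnValue, ← Finset.prod_coe_sort]
  simpa only [map_prod] using h

/-- The dependence of the diagonal matrix elements on the colours in the first two columns, if in
both rows these are only permuted: the other columns contribute a common factor `r` and bring the
oscillators into the common state `e`. -/
lemma exists_diag_letterWord_eq {n : ℕ} (s : Fin N) (τ σ : Config N (n + 2))
    (d : {z // z ∈ Finset.Ici s} → ℕ) : ∃ (r : K) (e : Fin (N + 2) → ℕ),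
    ∀ τ' σ' : Config N (n + 2), (∀ k : Fin n, τ' k.succ.succ = τ k.succ.succ) →
      (∀ k : Fin n, σ' k.succ.succ = σ k.succ.succ) →
      ((τ' 0 = τ 0 ∧ τ' 1 = τ 1) ∨ (τ' 0 = τ 1 ∧ τ' 1 = τ 0)) →
      ((σ' 0 = σ 0 ∧ σ' 1 = σ 1) ∨ (σ' 0 = σ 1 ∧ σ' 1 = σ 0)) →
      ∏ z : {z // z ∈ Finset.Ici s}, diag (letterWord t z.1.succ.succ τ' σ') (d z) =
        r * (rowCoef t s.castSucc.succ (σ' 0) (τ' 0) (shift (σ' 1) (τ' 1) e) *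
          rowCoef t s.castSucc.succ (σ' 1) (τ' 1) e) := by
  classical
  -- the action of the remaining columns
  have hR : ∀ z : {z // z ∈ Finset.Ici s}, ∃ (e : ℕ) (x : K),
      (List.ofFn fun k : Fin n => letter t z.1.succ.succ (σ k.succ.succ) (τ k.succ.succ)).prod
        (Finsupp.single (d z) 1) = Finsupp.single e x := by
    intro z
    obtain ⟨e, x, h, -⟩ := prod_vertexWeight_single (t := t)
      (fun k : Fin n => bit (τ k.succ.succ = z.1.succ.succ))
      (fun k : Fin n => bit (σ k.succ.succ = z.1.succ.succ))
      (fun k : Fin n => bit (σ k.succ.succ ≠ 0 ∧ σ k.succ.succ ≤ z.1.succ.succ))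
      (fun k : Fin n => bit (σ k.succ.succ ≠ 0 ∧ σ k.succ.succ < z.1.succ.succ))
      (List.finRange n) (d z)
    rw [List.ofFn_eq_map]
    exact ⟨e, x, h⟩
  choose e x hex using hR
  let e' : Fin (N + 2) → ℕ := fun y =>
    if h : ∃ z : {z // z ∈ Finset.Ici s}, z.1.succ.succ = y then e h.choose else 0
  have he' : ∀ z : {z // z ∈ Finset.Ici s}, e' z.1.succ.succ = e z := by
    intro z
    have h : ∃ z' : {z // z ∈ Finset.Ici s}, z'.1.succ.succ = z.1.succ.succ := ⟨z, rfl⟩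
    have h2 : h.choose = z :=
      Subtype.ext (Fin.succ_injective _ (Fin.succ_injective _ h.choose_spec))
    simp only [e', dif_pos h, h2]
  let f : {z // z ∈ Finset.Ici s} → ℕ := fun z =>
    e z + ((if τ 0 = z.1.succ.succ then 1 else 0) + (if τ 1 = z.1.succ.succ then 1 else 0)) -
      ((if σ 0 = z.1.succ.succ then 1 else 0) + (if σ 1 = z.1.succ.succ then 1 else 0))
  refine ⟨∏ z, (x z * if f z = d z then 1 else 0), e', fun τ' σ' hτ hσ hτ' hσ' => ?_⟩
  rw [rowCoef, rowCoef, prod_Ioi_eq_prod_Ici, prod_Ioi_eq_prod_Ici, ← Finset.prod_mul_distrib]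
  refine Eq.trans ?_ (congrArg (_ * ·) (Finset.prod_coe_sort (Finset.Ici s) fun z =>
    letterCoef t z.succ.succ (σ' 0) (τ' 0) (shift (σ' 1) (τ' 1) e' z.succ.succ) *
      letterCoef t z.succ.succ (σ' 1) (τ' 1) (e' z.succ.succ)))
  rw [← Finset.prod_mul_distrib]
  refine Finset.prod_congr rfl fun z _ => ?_
  have hf : e z + ((if τ' 0 = z.1.succ.succ then 1 else 0) +
      (if τ' 1 = z.1.succ.succ then 1 else 0)) - ((if σ' 0 = z.1.succ.succ then 1 else 0) +
        (if σ' 1 = z.1.succ.succ then 1 else 0)) = f z := by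
    simp only [f]
    rcases hτ' with ⟨h1, h2⟩ | ⟨h1, h2⟩ <;> rcases hσ' with ⟨h3, h4⟩ | ⟨h3, h4⟩ <;>
      rw [h1, h2, h3, h4] <;> omega
  rw [letterWord, List.ofFn_succ, List.ofFn_succ, List.prod_cons, List.prod_cons, diag,
    Module.End.mul_apply, Module.End.mul_apply]
  simp only [hτ, hσ]
  rw [hex, ← Finsupp.smul_single_one, map_smul, map_smul, Fin.succ_zero_eq_one,
    letter_mul_letter_single (Fin.succ_ne_zero _), hf, Finsupp.smul_apply, Finsupp.single_apply,
    shift, he', smul_eq_mul]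
  split_ifs <;> ring

/-- The local exchange relation under the traces, for the first two columns. -/
lemma exchange_relation_zero (hE : IsSummationField t E) (hm : ∀ α, 1 ≤ m α) {s : Fin N} {n : ℕ}
    {τ σ : Config N (n + 2)} (hσ : σ ∈ levelSector m s.castSucc)
    (hτ : τ ∈ levelSector m s.succ) :
    t ^ (if σ 1 < σ 0 then 1 else 0) * columnValue t m s τ (exchange 0 σ) -
        t ^ (if σ 0 < σ 1 then 1 else 0) * columnValue t m s τ σ -
        t ^ (if τ 0 < τ 1 then 1 else 0) *
          (columnValue t m s (exchange 0 τ) σ - columnValue t m s τ σ) =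
      (1 - t) * (((if σ 1 ≠ 0 then 1 else 0) - (if σ 0 ≠ 0 then 1 else 0)) *
        columnValue t m s τ σ) := by
  have hA := hasSum_columnValue hE hm τ hσ
  have hB := hasSum_columnValue hE hm τ ((exchange_mem_levelSector_iff σ 0).mpr hσ)
  have hC := hasSum_columnValue hE hm (exchange 0 τ) hσ
  have hrot : finRotate (n + 2) 0 = 1 := by rw [finRotate_apply, zero_add]
  have e0 : ∀ ρ : Config N (n + 2), exchange 0 ρ 0 = ρ 1 := fun ρ => by
    rw [exchange_apply_left, hrot]
  have e1 : ∀ ρ : Config N (n + 2), exchange 0 ρ 1 = ρ 0 := fun ρ => by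
    rw [← hrot, exchange_apply_right]
  have e2 : ∀ (ρ : Config N (n + 2)) (k : Fin n), exchange 0 ρ k.succ.succ = ρ k.succ.succ := by
    intro ρ k
    rw [exchange, hrot, Function.comp_apply, Equiv.swap_apply_of_ne_of_ne (Fin.succ_ne_zero _)]
    rw [← Fin.succ_zero_eq_one, Ne, Fin.succ_inj]
    exact Fin.succ_ne_zero _
  have hα : σ 0 ≠ 0 → s.castSucc.succ ≤ σ 0 := fun h => levelSector_le hσ h
  have hβ : σ 1 ≠ 0 → s.castSucc.succ ≤ σ 1 := fun h => levelSector_le hσ h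
  have hne : ∀ j, τ j ≠ s.castSucc.succ := by
    intro j hj
    have := levelSector_le hτ (j := j) (by rw [hj]; exact Fin.succ_ne_zero _)
    rw [hj, Fin.le_def] at this
    simp at this
  have hpt : ∀ d : {z // z ∈ Finset.Ici s} → ℕ,
      t ^ (if σ 1 < σ 0 then 1 else 0) * ∏ z : {z // z ∈ Finset.Ici s},
          diag (letterWord t z.1.succ.succ τ (exchange 0 σ)) (d z) -
        t ^ (if σ 0 < σ 1 then 1 else 0) * ∏ z : {z // z ∈ Finset.Ici s},
          diag (letterWord t z.1.succ.succ τ σ) (d z) -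
        t ^ (if τ 0 < τ 1 then 1 else 0) * (∏ z : {z // z ∈ Finset.Ici s},
          diag (letterWord t z.1.succ.succ (exchange 0 τ) σ) (d z) -
          ∏ z : {z // z ∈ Finset.Ici s}, diag (letterWord t z.1.succ.succ τ σ) (d z)) =
      (1 - t) * (((if σ 1 ≠ 0 then 1 else 0) - (if σ 0 ≠ 0 then 1 else 0)) *
        ∏ z : {z // z ∈ Finset.Ici s}, diag (letterWord t z.1.succ.succ τ σ) (d z)) := by
    intro d
    obtain ⟨r, e, h⟩ := exists_diag_letterWord_eq (t := t) s τ σ d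
    rw [h τ (exchange 0 σ) (fun _ => rfl) (e2 σ) (Or.inl ⟨rfl, rfl⟩) (Or.inr ⟨e0 σ, e1 σ⟩),
      h τ σ (fun _ => rfl) (fun _ => rfl) (Or.inl ⟨rfl, rfl⟩) (Or.inl ⟨rfl, rfl⟩),
      h (exchange 0 τ) σ (e2 τ) (fun _ => rfl) (Or.inr ⟨e0 τ, e1 τ⟩) (Or.inl ⟨rfl, rfl⟩),
      e0, e1, e0, e1]
    have := rowCoef_exchange_relation (t := t) (e := e) hα hβ (hne 0) (hne 1)
    linear_combination r * this
  have hsum := (((hB.mul_left (algebraMap K E (t ^ (if σ 1 < σ 0 then 1 else 0)))).sub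
    (hA.mul_left (algebraMap K E (t ^ (if σ 0 < σ 1 then 1 else 0))))).sub
    ((hC.sub hA).mul_left (algebraMap K E (t ^ (if τ 0 < τ 1 then 1 else 0)))))
  have hsum' := hA.mul_left (algebraMap K E ((1 - t) *
    ((if σ 1 ≠ 0 then 1 else 0) - (if σ 0 ≠ 0 then 1 else 0))))
  simp only [← map_mul, ← map_sub, hpt] at hsum
  simp only [← map_mul, mul_assoc] at hsum'
  exact (algebraMap K E).injective (hsum.unique hsum')

/-- By cyclic invariance the exchange relation holds at all sites. -/
lemma exchange_relation (hE : IsSummationField t E) (hm : ∀ α, 1 ≤ m α) {s : Fin N} {n : ℕ}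
    {τ σ : Config N (n + 2)} (hσ : σ ∈ levelSector m s.castSucc)
    (hτ : τ ∈ levelSector m s.succ) (i : Fin (n + 2)) :
    t ^ (if σ (finRotate (n + 2) i) < σ i then 1 else 0) * columnValue t m s τ (exchange i σ) -
        t ^ (if σ i < σ (finRotate (n + 2) i) then 1 else 0) * columnValue t m s τ σ -
        t ^ (if τ i < τ (finRotate (n + 2) i) then 1 else 0) *
          (columnValue t m s (exchange i τ) σ - columnValue t m s τ σ) =
      (1 - t) * (((if σ (finRotate (n + 2) i) ≠ 0 then 1 else 0) - (if σ i ≠ 0 then 1 else 0)) *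
        columnValue t m s τ σ) := by
  have h := exchange_relation_zero (t := t) (E := E) hE hm
    (σ := σ ∘ ⇑(finRotate (n + 2) ^ (i : ℕ))) (τ := τ ∘ ⇑(finRotate (n + 2) ^ (i : ℕ)))
    ((comp_mem_levelSector_iff σ _).mpr hσ) ((comp_mem_levelSector_iff τ _).mpr hτ)
  have h1 : (finRotate (n + 2) ^ (i : ℕ)) 1 = finRotate (n + 2) i := by
    have hrot : finRotate (n + 2) 0 = 1 := by rw [finRotate_apply, zero_add]
    conv_rhs => rw [← finRotate_pow_zero i]
    rw [← hrot, ← Equiv.Perm.mul_apply, ← Equiv.Perm.mul_apply, ← pow_succ, ← pow_succ']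
  rw [← exchange_comp_rotate, ← exchange_comp_rotate, columnValue_rotate hE hm hσ,
    columnValue_rotate hE hm hσ,
    columnValue_rotate hE hm ((exchange_mem_levelSector_iff σ i).mpr hσ)] at h
  simpa only [Function.comp_apply, finRotate_pow_zero, h1] using h

open Classical in
/-- The transfer matrix from the row `s + 1` to the row `s`. -/
def rowTransfer (t : K) (m : Fin (N + 2) → ℕ) (L : ℕ) (s : Fin N) :
    Matrix (Config N L) (Config N L) K :=
  Matrix.of fun σ τ =>
    if σ ∈ levelSector m s.castSucc ∧ τ ∈ levelSector m s.succ then stepSum t s τ σ else 0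

lemma sum_rotate_sub {n : ℕ} {R : Type*} [AddCommGroup R] (f : Fin n → R) :
    ∑ i, (f (finRotate n i) - f i) = 0 := by
  rw [Finset.sum_sub_distrib, Equiv.sum_comp, sub_self]

/-- The transfer matrices between the rows commute with the Markov matrix: the right hand side of
the exchange relation telescopes in the sum over the sites. -/
theorem commute_markov_rowTransfer (hE : IsSummationField t E) (hm : ∀ α, 1 ≤ m α) {n : ℕ}
    (s : Fin N) : Commute (markov t N (n + 2)) (rowTransfer t m (n + 2) s) := by
  classical
  ext σ τ
  have hl : (markov t N (n + 2) * rowTransfer t m (n + 2) s) σ τ =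
      (markov t N (n + 2)).mulVec (fun σ' => rowTransfer t m (n + 2) s σ' τ) σ := rfl
  rw [hl, markov_mulVec, Matrix.mul_apply, sum_mul_markov]
  simp only [rowTransfer, Matrix.of_apply, exchange_mem_levelSector_iff]
  by_cases h : σ ∈ levelSector m s.castSucc ∧ τ ∈ levelSector m s.succ
  · simp only [if_pos h]
    have hstep : ∀ τ' σ' : Config N (n + 2), σ' ∈ levelSector m s.castSucc →
        τ' ∈ levelSector m s.succ → stepSum t s τ' σ' =
          (∏ z ∈ Finset.Ici s, (1 - t ^ leftOver m s z)) * columnValue t m s τ' σ' := by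
      intro τ' σ' h1 h2
      rw [stepSum_eq hE.pow_ne_one hm h1 h2, Finset.prod_mul_distrib, columnValue]
    rw [← sub_eq_zero, ← Finset.sum_sub_distrib]
    rw [Finset.sum_congr rfl (g := fun i => (∏ z ∈ Finset.Ici s, (1 - t ^ leftOver m s z)) *
      ((1 - t) * (((if σ (finRotate (n + 2) i) ≠ 0 then 1 else 0) - (if σ i ≠ 0 then 1 else 0)) *
        columnValue t m s τ σ)))]
    · rw [← Finset.mul_sum, ← Finset.mul_sum, ← Finset.sum_mul,
        sum_rotate_sub fun i => if σ i ≠ 0 then (1 : K) else 0]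
      ring
    · intro i _
      rw [← exchange_relation hE hm h.1 h.2 i, hstep _ _ h.1 h.2,
        hstep _ _ ((exchange_mem_levelSector_iff σ i).mpr h.1) h.2,
        hstep _ _ h.1 ((exchange_mem_levelSector_iff τ i).mpr h.2)]
      ring
  · simp only [if_neg h]
    simp

open Classical in
/-- On the configurations with only one kind of balls the constant vector is stationary. -/
lemma markov_mulVec_last (t : K) (m : Fin (N + 2) → ℕ) :
    (markov t N L).mulVec (fun σ => if σ ∈ levelSector m (Fin.last N) then 1 else 0) = 0 := by
  funext σ
  rw [markov_mulVec]
  simp only [exchange_mem_levelSector_iff]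
  by_cases h : σ ∈ levelSector m (Fin.last N)
  · simp only [if_pos h, mul_one, Pi.zero_apply]
    have h1 : ∀ j, σ j = 0 ∨ σ j = Fin.last (N + 1) := by
      intro j
      by_cases hj : σ j = 0
      · exact Or.inl hj
      · have := levelSector_le h hj
        rw [Fin.succ_last, Fin.last_le_iff] at this
        exact Or.inr this
    rw [Finset.sum_congr rfl (g := fun i => (1 - t) *
      ((if σ (finRotate L i) ≠ 0 then 1 else 0) - (if σ i ≠ 0 then 1 else 0)))]
    · rw [← Finset.mul_sum, sum_rotate_sub fun i => if σ i ≠ 0 then (1 : K) else 0, mul_zero]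
    · intro i _
      have hlast : Fin.last (N + 1) ≠ 0 := Fin.last_pos.ne'
      rcases h1 i with h2 | h2 <;> rcases h1 (finRotate L i) with h3 | h3 <;>
        simp [h2, h3, hlast, Fin.last_pos, -finRotate_apply]
  · simp only [if_neg h, mul_zero, sub_zero, Finset.sum_const_zero, Pi.zero_apply]

lemma prod_mulVec_apply {X : Type*} [Fintype X] [DecidableEq X] {l : ℕ} (W : Fin l → Matrix X X K)
    (u : X → K) (x : X) : (List.ofFn W).prod.mulVec u x =
      ∑ c : Fin (l + 1) → X, if c 0 = x then
        (∏ s : Fin l, W s (c s.castSucc) (c s.succ)) * u (c (Fin.last l)) else 0 := by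
  induction l generalizing x with
  | zero =>
    rw [← (Equiv.funUnique (Fin 1) X).symm.sum_comp]
    simp [uniqueElim_const]
  | succ l ih =>
    have hR : (∑ c : Fin (l + 2) → X, if c 0 = x then
        (∏ s : Fin (l + 1), W s (c s.castSucc) (c s.succ)) * u (c (Fin.last (l + 1))) else 0) =
        ∑ c : Fin (l + 1) → X, W 0 x (c 0) *
          ((∏ s : Fin l, W s.succ (c s.castSucc) (c s.succ)) * u (c (Fin.last l))) := by
      rw [← (Fin.consEquiv fun _ : Fin (l + 2) => X).sum_comp, Fintype.sum_prod_type,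
        Finset.sum_eq_single x]
      · refine Finset.sum_congr rfl fun c _ => ?_
        rw [if_pos (by rfl), Fin.prod_univ_succ, ← mul_assoc]
        rfl
      · intro y _ hy
        exact Finset.sum_eq_zero fun c _ => if_neg fun h => hy h
      · simp
    rw [hR, List.ofFn_succ, List.prod_cons, ← Matrix.mulVec_mulVec, Matrix.mulVec, dotProduct]
    simp only [ih, Finset.mul_sum]
    rw [Finset.sum_comm]
    refine Finset.sum_congr rfl fun c _ => ?_
    rw [Finset.sum_eq_single (c 0)]
    · rw [if_pos rfl]
    · intro y _ hy
      rw [if_neg (Ne.symm hy), mul_zero]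
    · simp

open Classical in
lemma mlqState_eq_mulVec (t : K) (m : Fin (N + 2) → ℕ) : mlqState t m =
    (List.ofFn (rowTransfer t m L)).prod.mulVec
      (fun σ => if σ ∈ levelSector m (Fin.last N) then 1 else 0) := by
  funext σ
  rw [mlqState_eq_sum, prod_mulVec_apply]
  refine Finset.sum_congr rfl fun c _ => ?_
  by_cases h0 : c 0 = σ
  · by_cases hc : ∀ r, c r ∈ levelSector m r
    · rw [if_pos ⟨h0, hc⟩, if_pos h0, if_pos (hc _), mul_one]
      exact Finset.prod_congr rfl fun s _ => (if_pos ⟨hc _, hc _⟩).symm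
    · rw [if_neg (fun h => hc h.2), if_pos h0]
      obtain ⟨r, hr⟩ := not_forall.mp hc
      cases r using Fin.lastCases with
      | last => rw [if_neg hr, mul_zero]
      | cast s =>
        rw [Finset.prod_eq_zero (Finset.mem_univ s), zero_mul]
        exact if_neg fun h => hr h.1
  · rw [if_neg (fun h => h0 h.1), if_neg h0]

/-- Stationarity of the multiline queue state, in the range of `t` in which traces converge. -/
theorem markov_mulVec_mlqState (hE : IsSummationField t E) (hm : ∀ α, 1 ≤ m α) {n : ℕ} :
    (markov t N (n + 2)).mulVec (mlqState t m) = 0 := by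
  classical
  have hcomm : Commute (markov t N (n + 2)) (List.ofFn (rowTransfer t m (n + 2))).prod :=
    Commute.list_prod_right _ _ fun W hW => by
      obtain ⟨s, rfl⟩ := List.mem_ofFn.mp hW
      exact commute_markov_rowTransfer hE hm s
  rw [mlqState_eq_mulVec, Matrix.mulVec_mulVec, hcomm.eq, ← Matrix.mulVec_mulVec,
    markov_mulVec_last, Matrix.mulVec_zero]

end

/-! ### The two fields of summation -/

open Filter Topology

lemma isSummationField_real {t : ℝ} (h0 : 0 ≤ t) (h1 : t < 1) : IsSummationField t ℝ where
  pow_ne_one c hc := (pow_lt_one₀ h0 h1 (by omega)).ne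
  hasSum_geometric c hc := by
    simpa using hasSum_geometric_of_lt_one (pow_nonneg h0 c) (pow_lt_one₀ h0 h1 (by omega))
  hasSum_mul f g a b hf hg := hf.mul hg
    (summable_mul_of_summable_norm hf.summable.norm hg.summable.norm)

lemma nonarchimedeanRing_of_valued (R : Type*) [Ring R] (Γ₀ : Type*)
    [LinearOrderedCommGroupWithZero Γ₀] [Valued R Γ₀] : NonarchimedeanRing R := by
  rw [Valued.toUniformSpace_eq R Γ₀]
  exact RingSubgroupsBasis.nonarchimedean _

lemma tendsto_pow_laurentSeries {x : LaurentSeries ℚ}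
    (hx : Valued.v x < (1 : WithZero (Multiplicative ℤ))) :
    Tendsto (fun d : ℕ => x ^ d) atTop (𝓝 0) := by
  rw [(Valued.hasBasis_nhds_zero (LaurentSeries ℚ) (WithZero (Multiplicative ℤ))).tendsto_right_iff]
  intro γ _
  obtain ⟨k, hk⟩ := exists_pow_lt₀ hx (Units.map (MonoidWithZeroHom.ValueGroup₀.embedding :
    _ →*₀ WithZero (Multiplicative ℤ)).toMonoidHom γ)
  filter_upwards [eventually_ge_atTop k] with d hd
  rw [Valuation.restrict_lt_iff_lt_embedding, map_pow]
  exact (pow_le_pow_of_le_one zero_le hx.le hd).trans_lt hk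

lemma isSummationField_ratFunc :
    IsSummationField (RatFunc.X : RatFunc ℚ) (LaurentSeries ℚ) := by
  have hna := nonarchimedeanRing_of_valued (LaurentSeries ℚ) (WithZero (Multiplicative ℤ))
  have hX : ∀ c : ℕ, 1 ≤ c →
      Valued.v (algebraMap (RatFunc ℚ) (LaurentSeries ℚ) (RatFunc.X ^ c)) <
        (1 : WithZero (Multiplicative ℤ)) := by
    intro c hc
    rw [map_pow, RatFunc.coe_X, ← PowerSeries.coe_X, LaurentSeries.valuation_X_pow,
      ← WithZero.exp_zero, WithZero.exp_lt_exp]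
    omega
  have hne : ∀ c : ℕ, 1 ≤ c → (RatFunc.X : RatFunc ℚ) ^ c ≠ 1 := by
    intro c hc h
    have := hX c hc
    rw [h, map_one, map_one] at this
    exact this.false
  refine ⟨hne, fun c hc => ?_, fun f g a b hf hg => hf.mul_of_nonarchimedean hg⟩
  have hs : Summable fun d : ℕ =>
      algebraMap (RatFunc ℚ) (LaurentSeries ℚ) (RatFunc.X ^ c) ^ d := by
    refine NonarchimedeanAddGroup.summable_of_tendsto_cofinite_zero ?_
    rw [Nat.cofinite_eq_atTop]
    exact tendsto_pow_laurentSeries (hX c hc)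
  obtain ⟨s, hs⟩ := hs
  have h1 := (hasSum_nat_add_iff' 1).mpr hs
  have h2 := hs.mul_left (algebraMap (RatFunc ℚ) (LaurentSeries ℚ) (RatFunc.X ^ c))
  simp only [← pow_succ'] at h2
  have h3 := h2.unique h1
  rw [Finset.sum_range_one, pow_zero] at h3
  have h4 : algebraMap (RatFunc ℚ) (LaurentSeries ℚ) (1 - RatFunc.X ^ c) * s = 1 := by
    rw [map_sub, map_one]
    linear_combination -h3
  rwa [← eq_inv_of_mul_eq_one_right h4]

/-! ### Change of the coefficient field and continuity in `t` -/

section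

variable {N L : ℕ} {m : Fin (N + 2) → ℕ}

lemma map_mlqState {K K' : Type*} [Field K] [Field K'] (f : K →+* K') (t : K) (σ : Config N L) :
    f (mlqState t m σ) = mlqState (f t) m σ := by
  rw [mlqState, mlqState, map_sum]
  refine Finset.sum_congr rfl fun Q _ => ?_
  split_ifs
  · simp only [MLQ.weight, map_prod]
    refine Finset.prod_congr rfl fun s _ => Finset.prod_congr rfl fun d _ => ?_
    split_ifs <;> simp
  · exact map_zero f

lemma map_markov_mulVec {K K' : Type*} [Field K] [Field K'] (f : K →+* K') (t : K)
    (v : Config N L → K) (σ : Config N L) :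
    f ((markov t N L).mulVec v σ) = (markov (f t) N L).mulVec (f ∘ v) σ := by
  simp only [markov_mulVec, map_sum, map_sub, map_mul, map_pow, Function.comp_apply]

/-- The embedding `ℚ(t) → ℝ` given by a transcendental value of `t`. -/
def evalTranscendental {x : ℝ} (hx : Transcendental ℚ x) : RatFunc ℚ →+* ℝ :=
  IsFractionRing.lift (A := Polynomial ℚ) (g := (Polynomial.aeval x).toRingHom)
    (transcendental_iff_injective.mp hx)

lemma evalTranscendental_X {x : ℝ} (hx : Transcendental ℚ x) :
    evalTranscendental hx RatFunc.X = x := by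
  rw [evalTranscendental, ← RatFunc.algebraMap_X, IsFractionRing.lift_algebraMap]
  simp

lemma dense_transcendental : Dense {x : ℝ | Transcendental ℚ x} :=
  (Algebraic.countable ℚ ℝ).dense_compl ℝ

lemma continuousAt_mlqState {t : ℝ} (ht : 0 ≤ t) (ht1 : t ≠ 1) (σ : Config N L) :
    ContinuousAt (fun x : ℝ => mlqState x m σ) t := by
  refine tendsto_finsetSum _ fun Q _ => ?_
  split_ifs
  · refine tendsto_finsetProd _ fun s _ => tendsto_finsetProd _ fun d _ => ?_
    split_ifs
    · exact tendsto_const_nhds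
    · rcases Nat.eq_zero_or_pos (free Q.row Q.pair s d).card with h0 | h0
      · -- a vanishing denominator makes the weight identically zero
        simp only [h0, pow_zero, sub_self, div_zero]
        exact tendsto_const_nhds
      · refine ContinuousAt.div (by fun_prop) (by fun_prop) ?_
        rw [sub_ne_zero]
        exact fun h => ht1 ((pow_eq_one_iff_of_nonneg ht h0.ne').mp h.symm)
  · exact tendsto_const_nhds

end

/-! ### Positivity and support of the multiline queue state -/

section

variable {N L : ℕ} {m : Fin (N + 2) → ℕ}

lemma sector_subset_levelSector : sector m ⊆ (levelSector m 0 : Set (Config N L)) := by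
  intro σ hσ y hy
  rw [if_pos]
  · exact hσ y
  · rw [Fin.succ_zero_eq_one]
    exact Fin.one_le_of_ne_zero hy

lemma levelSector_zero_eq_sector (hL : ∑ α, m α = L) :
    levelSector m 0 = (sector m : Set (Config N L)) := by
  refine Set.Subset.antisymm (fun σ hσ => ?_) sector_subset_levelSector
  have h1 : ∀ y, y ≠ 0 → (Finset.univ.filter (σ · = y)).card = m y := fun y hy => by
    rw [hσ y hy, if_pos]
    rw [Fin.succ_zero_eq_one]
    exact Fin.one_le_of_ne_zero hy
  intro α
  rcases eq_or_ne α 0 with rfl | hα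
  · have h2 : L = ∑ y, (Finset.univ.filter (σ · = y)).card := by
      rw [← Finset.card_eq_sum_card_fiberwise (fun _ _ => Finset.mem_univ _), Finset.card_univ,
        Fintype.card_fin]
    rw [← Finset.add_sum_erase _ _ (Finset.mem_univ (0 : Fin (N + 2)))] at h2 hL
    rw [Finset.sum_congr rfl fun y hy => h1 y (Finset.ne_of_mem_erase hy)] at h2
    exact add_right_cancel (h2.symm.trans hL.symm)
  · exact h1 α hα

lemma mlqState_eq_zero {K : Type*} [Field K] {t : K} (hL : ∑ α, m α = L) {σ : Config N L}
    (hσ : σ ∉ sector m) : mlqState t m σ = 0 := by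
  classical
  rw [mlqState_eq_sum]
  refine Finset.sum_eq_zero fun c _ => if_neg fun h => hσ ?_
  rw [← levelSector_zero_eq_sector hL, ← h.1]
  exact h.2 0

/-- For `f = 0` this is the junk value `(1 - t) / 0 = 0`. -/
lemma one_sub_div_one_sub_pow_nonneg {t : ℝ} (ht : 0 ≤ t) (f : ℕ) :
    0 ≤ (1 - t) / (1 - t ^ f) := by
  rcases le_total t 1 with h | h
  · exact div_nonneg (sub_nonneg.mpr h) (sub_nonneg.mpr (pow_le_one₀ ht h))
  · exact div_nonneg_of_nonpos (sub_nonpos.mpr h) (sub_nonpos.mpr (one_le_pow₀ h))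

lemma hopWeight_nonneg {t : ℝ} (ht : 0 ≤ t) (i j : Fin L) (J : Finset (Fin L)) :
    0 ≤ hopWeight t i j J := by
  rw [hopWeight, mul_comm, mul_div_assoc]
  exact mul_nonneg (pow_nonneg ht _) (one_sub_div_one_sub_pow_nonneg ht _)

lemma queueSum_nonneg {t : ℝ} (ht : 0 ≤ t) (b : Fin (N + 2)) (τ σ : Config N L)
    (is : List (Fin L)) (J : Finset (Fin L)) : 0 ≤ queueSum t b τ σ is J := by
  induction is generalizing J with
  | nil => rw [queueSum]; split_ifs <;> norm_num
  | cons i is ih =>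
    rw [queueSum]
    split_ifs
    · exact ih _
    · exact le_rfl
    · exact Finset.sum_nonneg fun j _ => mul_nonneg (hopWeight_nonneg ht _ _ _) (ih _)

/-- All balls choose the ball directly above. -/
lemma queueSum_eq_one {t : ℝ} {b : Fin (N + 2)} {τ σ : Config N L} {is : List (Fin L)}
    {J : Finset (Fin L)} (hnd : is.Nodup) (his : ∀ i ∈ is, i ∈ J ∧ σ i = τ i)
    (hJ : ∀ j ∈ J, j ∉ is → σ j = b) : queueSum t b τ σ is J = 1 := by
  induction is generalizing J with
  | nil => rw [queueSum, if_pos fun j hj => hJ j hj List.not_mem_nil]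
  | cons i is ih =>
    rw [List.nodup_cons] at hnd
    have hi := his i List.mem_cons_self
    rw [queueSum, if_pos hi.1, if_pos hi.2]
    refine ih hnd.2 (fun k hk => ?_) fun j hj hjis => ?_
    · have := his k (List.mem_cons_of_mem i hk)
      exact ⟨Finset.mem_erase.mpr ⟨fun h => hnd.1 (h ▸ hk), this.1⟩, this.2⟩
    · rw [Finset.mem_erase] at hj
      exact hJ j hj.2 fun h => (List.mem_cons.mp h).elim hj.1 hjis

/-- The queue in which every ball is paired with the ball directly above it has weight `1`, and all
other queues have a nonnegative weight. -/
theorem mlqState_pos {t : ℝ} (ht : 0 ≤ t) {σ : Config N L} (hσ : σ ∈ sector m) :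
    0 < mlqState t m σ := by
  classical
  rw [mlqState_eq_sum]
  let c : Fin (N + 1) → Config N L := fun r j => if r.succ ≤ σ j then σ j else 0
  have hc : ∀ r, c r ∈ levelSector m r := by
    intro r y hy
    split_ifs with h
    · rw [← hσ y]
      refine congrArg Finset.card (Finset.filter_congr fun j _ => ⟨fun hj => ?_, fun hj => ?_⟩)
      · simp only [c] at hj
        split_ifs at hj
        · exact hj
        · exact absurd hj.symm hy
      · simp only [c]
        rw [hj, if_pos h]
    · rw [Finset.card_eq_zero, Finset.filter_eq_empty_iff]
      intro j _ hj
      simp only [c] at hj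
      split_ifs at hj with h'
      · exact h (hj ▸ h')
      · exact hy hj.symm
  have hc0 : c 0 = σ := by
    funext j
    simp only [c]
    split_ifs with h
    · rfl
    · by_contra hne
      rw [Fin.succ_zero_eq_one] at h
      exact h (Fin.one_le_of_ne_zero (Ne.symm hne))
  refine Finset.sum_pos' (fun c' _ => ?_) ⟨c, Finset.mem_univ _, ?_⟩
  · split_ifs
    · exact Finset.prod_nonneg fun s _ => queueSum_nonneg ht _ _ _ _ _
    · exact le_rfl
  · rw [if_pos ⟨hc0, hc⟩, Finset.prod_eq_one fun s _ => ?_]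
    · exact zero_lt_one
    · have hlt : s.castSucc.succ < s.succ.succ := by
        rw [Fin.lt_def]
        simp
      refine queueSum_eq_one (nodup_chooserList _) (fun i hi => ?_) fun j hj hjl => ?_
      · rw [mem_chooserList] at hi
        have h1 : s.succ.succ ≤ σ i := by
          by_contra h
          exact hi (if_neg h)
        have h2 : c s.castSucc i = σ i := if_pos (hlt.le.trans h1)
        have h3 : c s.succ i = σ i := if_pos h1
        rw [supp, Finset.mem_filter, h2, h3]
        exact ⟨⟨Finset.mem_univ _, (Fin.succ_pos _).trans_le h1 |>.ne'⟩, rfl⟩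
      · rw [mem_chooserList, not_not] at hjl
        have hj' : c s.castSucc j ≠ 0 := (Finset.mem_filter.mp hj).2
        have h1 : s.castSucc.succ ≤ σ j := by
          by_contra h
          exact hj' (if_neg h)
        have h2 : c s.castSucc j = σ j := if_pos h1
        rw [h2]
        refine le_antisymm ?_ h1
        by_contra h
        have h3 : s.succ.succ ≤ σ j := by
          rw [Fin.le_def] at h ⊢
          simp only [Fin.val_succ, Fin.val_castSucc] at h ⊢
          omega
        have h4 : c s.succ j = σ j := if_pos h3
        exact hj' (h2.trans (h4.symm.trans hjl))

lemma normFactor_pos (hm : ∀ α, 1 ≤ m α) {t : ℝ} (ht : 0 ≤ t) (ht1 : t < 1) :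
    0 < normFactor t m := by
  refine Finset.prod_pos fun v _ => sub_pos.mpr (pow_lt_one₀ ht ht1 ?_)
  have h : v.1.1.succ.castSucc ∈ Finset.Icc v.1.1.succ.castSucc v.1.2.succ.castSucc :=
    Finset.left_mem_Icc.mpr (Fin.castSucc_le_castSucc_iff.mpr (Fin.succ_le_succ_iff.mpr v.2))
  have h1 : m v.1.1.succ.castSucc ≤ _ := Finset.single_le_sum (fun _ _ => Nat.zero_le _) h
  exact (Nat.lt_of_lt_of_le (hm _) h1).ne'

end

/-! ### Stationarity for all admissible values of `t` -/

section

variable {N L n : ℕ} {m : Fin (N + 2) → ℕ}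

lemma markov_mulVec_mlqState_ratFunc (hm : ∀ α, 1 ≤ m α) :
    (markov (RatFunc.X : RatFunc ℚ) N (n + 2)).mulVec (mlqState RatFunc.X m) = 0 :=
  markov_mulVec_mlqState isSummationField_ratFunc hm

/-- The identity over `ℚ(t)` gives the one for transcendental `t`, and these are dense. -/
theorem markov_mulVec_mlqState_real (hm : ∀ α, 1 ≤ m α) {t : ℝ} (ht : 0 ≤ t) (ht1 : t ≠ 1) :
    (markov t N (n + 2)).mulVec (mlqState t m) = 0 := by
  rcases ht1.lt_or_gt with h1 | h1
  · exact markov_mulVec_mlqState (isSummationField_real ht h1) hm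
  funext σ
  by_contra hne
  have hcont : ContinuousAt (fun x : ℝ => (markov x N (n + 2)).mulVec (mlqState x m) σ) t := by
    simp only [markov_mulVec]
    refine tendsto_finsetSum _ fun i _ => ContinuousAt.sub ?_ ?_
    · exact ContinuousAt.mul (by fun_prop) (continuousAt_mlqState ht ht1 _)
    · exact ContinuousAt.mul (by fun_prop) (continuousAt_mlqState ht ht1 _)
  obtain ⟨x, hx, hx'⟩ := dense_transcendental.inter_nhds_nonempty (hcont.eventually_ne hne)
  refine hx' ?_
  have h := congrArg (evalTranscendental hx) (congrFun (markov_mulVec_mlqState_ratFunc hm) σ)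
  rw [map_markov_mulVec, evalTranscendental_X, Pi.zero_apply, map_zero] at h
  have hs : evalTranscendental hx ∘ mlqState RatFunc.X m = (mlqState x m : Config N (n + 2) → ℝ) :=
    funext fun σ => by rw [Function.comp_apply, map_mlqState, evalTranscendental_X]
  rwa [hs] at h

lemma mlqState_ratFunc_ne_zero {σ : Config N L} (hσ : σ ∈ sector m) :
    mlqState (RatFunc.X : RatFunc ℚ) m σ ≠ 0 := by
  obtain ⟨x, hx, hx'⟩ := dense_transcendental.inter_nhds_nonempty (Ioi_mem_nhds one_pos)
  intro h
  have h1 := congrArg (evalTranscendental hx) h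
  rw [map_mlqState, evalTranscendental_X, map_zero] at h1
  exact (mlqState_pos (le_of_lt hx') hσ).ne' h1

end

/-! ### Uniqueness of the stationary state -/

section

variable {N L n : ℕ} {m : Fin (N + 2) → ℕ}

lemma exchange_mem_sector_iff (i : Fin L) (σ : Config N L) :
    exchange i σ ∈ sector m ↔ σ ∈ sector m := by
  refine forall_congr' fun y => ?_
  rw [Finset.card_bij (t := Finset.univ.filter fun j => σ j = y)
    (fun j _ => Equiv.swap i (finRotate L i) j) (fun j hj => by simpa [exchange] using hj)
    (fun _ _ _ _ h => (Equiv.injective _) h) fun j hj =>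
      ⟨Equiv.swap i (finRotate L i) j, by simpa [exchange] using hj, by simp⟩]

lemma exists_perm_of_mem_sector {σ σ' : Config N L} (hσ : σ ∈ sector m) (hσ' : σ' ∈ sector m) :
    ∃ ρ : Equiv.Perm (Fin L), σ' = σ ∘ ρ := by
  have h : ∀ α, Nonempty ({j // σ' j = α} ≃ {j // σ j = α}) := fun α => by
    rw [← Fintype.card_eq, Fintype.card_subtype, Fintype.card_subtype, hσ' α, hσ α]
  let e := fun α => (h α).some
  exact ⟨Equiv.ofFiberEquiv e, funext fun j => (Equiv.ofFiberEquiv_map e j).symm⟩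

/-- The exchanges of neighbours connect the sector. -/
lemma sector_subset_of_exchange_mem {Z : Set (Config N (n + 1))}
    (hZ : ∀ σ ∈ Z, ∀ i, exchange i σ ∈ Z) {σ : Config N (n + 1)} (hσ : σ ∈ sector m)
    (hσZ : σ ∈ Z) : sector m ⊆ Z := by
  have key : ∀ ρ : Equiv.Perm (Fin (n + 1)), ∀ τ ∈ Z, τ ∘ ρ ∈ Z := by
    intro ρ
    have hρ : ρ ∈ Submonoid.closure
        (Set.range fun i : Fin n => Equiv.swap i.castSucc i.succ) := by
      rw [Equiv.Perm.mclosure_swap_castSucc_succ]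
      exact Submonoid.mem_top ρ
    induction hρ using Submonoid.closure_induction with
    | mem x hx =>
      obtain ⟨i, rfl⟩ := hx
      intro τ hτ
      have h := hZ τ hτ i.castSucc
      rwa [exchange, finRotate_apply, Fin.coeSucc_eq_succ] at h
    | one => exact fun τ hτ => hτ
    | mul x y _ _ hx hy => exact fun τ hτ => hy _ (hx τ hτ)
  intro σ' hσ'
  obtain ⟨ρ, rfl⟩ := exists_perm_of_mem_sector hσ hσ'
  exact key ρ σ hσZ

lemma sum_markov_mulVec {K : Type*} [Field K] (t : K) (f : Config N L → K) :
    ∑ σ, (markov t N L).mulVec f σ = 0 := by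
  simp only [Matrix.mulVec, dotProduct]
  rw [Finset.sum_comm]
  refine Finset.sum_eq_zero fun τ _ => ?_
  have h := sum_mul_markov (t := t) (fun _ => 1) τ
  simp only [one_mul, sub_self, mul_zero, Finset.sum_const_zero] at h
  rw [← Finset.sum_mul, h, zero_mul]

/-- A nonnegative stationary vector `q` that vanishes at one configuration of the sector vanishes on
the whole sector. By stationarity of `q` nothing flows into the set of zeros, and by stationarity of
the positive vector `π` nothing flows out of it; so it is closed under all exchanges. -/
lemma eq_zero_of_markov_mulVec_eq_zero {t : ℝ} (ht : 0 ≤ t) {π q : Config N (n + 1) → ℝ}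
    (hπ : ∀ σ ∈ sector m, 0 < π σ) (hHπ : (markov t N (n + 1)).mulVec π = 0) (hq : ∀ σ, 0 ≤ q σ)
    (hHq : (markov t N (n + 1)).mulVec q = 0) {σ₀ : Config N (n + 1)} (hσ₀ : σ₀ ∈ sector m)
    (hqσ₀ : q σ₀ = 0) {σ : Config N (n + 1)} (hσ : σ ∈ sector m) : q σ = 0 := by
  classical
  let Z : Set (Config N (n + 1)) := {σ | σ ∈ sector m ∧ q σ = 0}
  -- nothing flows into the set of zeros
  have hin : ∀ σ ∈ Z, ∀ i, exchange i σ ∉ Z →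
      t ^ (if σ (finRotate _ i) < σ i then 1 else 0) = 0 := by
    intro σ hσ i hi
    have h := congrFun hHq σ
    rw [markov_mulVec] at h
    simp only [hσ.2, mul_zero, sub_zero, Pi.zero_apply] at h
    have h1 := (Finset.sum_eq_zero_iff_of_nonneg
      (fun i _ => mul_nonneg (pow_nonneg ht _) (hq _))).mp h i (Finset.mem_univ i)
    exact (mul_eq_zero.mp h1).resolve_right fun h2 =>
      hi ⟨(exchange_mem_sector_iff i σ).mpr hσ.1, h2⟩
  -- the restriction of `π` to the set of zeros
  let r : Config N (n + 1) → ℝ := fun σ => if σ ∈ Z then π σ else 0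
  have hr0 : ∀ σ, 0 ≤ r σ := by
    intro σ
    simp only [r]
    split_ifs with h
    · exact (hπ σ h.1).le
    · exact le_rfl
  have hr1 : ∀ σ ∈ Z, (markov t N (n + 1)).mulVec r σ = 0 := by
    intro σ hσ
    refine Eq.trans ?_ (congrFun hHπ σ)
    rw [markov_mulVec, markov_mulVec]
    refine Finset.sum_congr rfl fun i _ => ?_
    have h1 : r σ = π σ := if_pos hσ
    rw [h1]
    by_cases hi : exchange i σ ∈ Z
    · have h2 : r (exchange i σ) = π (exchange i σ) := if_pos hi
      rw [h2]
    · rw [hin σ hσ i hi, zero_mul, zero_mul]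
  have hr2 : ∀ σ ∉ Z, (markov t N (n + 1)).mulVec r σ =
      ∑ i, t ^ (if σ (finRotate _ i) < σ i then 1 else 0) * r (exchange i σ) := by
    intro σ hσ
    have h1 : r σ = 0 := if_neg hσ
    simp only [markov_mulVec, h1, mul_zero, sub_zero]
  have hr3 : ∀ σ, 0 ≤ (markov t N (n + 1)).mulVec r σ := by
    intro σ
    by_cases hσ : σ ∈ Z
    · exact (hr1 σ hσ).ge
    · rw [hr2 σ hσ]
      exact Finset.sum_nonneg fun i _ => mul_nonneg (pow_nonneg ht _) (hr0 _)
  have hr4 : ∀ σ, (markov t N (n + 1)).mulVec r σ = 0 := fun σ =>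
    (Finset.sum_eq_zero_iff_of_nonneg fun σ _ => hr3 σ).mp (sum_markov_mulVec t r) σ
      (Finset.mem_univ σ)
  have hZ : ∀ σ ∈ Z, ∀ i, exchange i σ ∈ Z := by
    intro σ hσ i
    by_contra hi
    have h := hr4 (exchange i σ)
    rw [hr2 _ hi] at h
    have h1 := (Finset.sum_eq_zero_iff_of_nonneg
      (fun i _ => mul_nonneg (pow_nonneg ht _) (hr0 _))).mp h i (Finset.mem_univ i)
    have h2 : r (exchange i (exchange i σ)) = π σ := by
      rw [exchange_exchange]
      exact if_pos hσ
    rw [h2, exchange_apply_left, exchange_apply_right] at h1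
    have h3 := (mul_eq_zero.mp h1).resolve_right (hπ σ hσ.1).ne'
    have h4 := hin σ hσ i hi
    -- one of the two rates is `t ^ 0`
    rcases lt_or_ge (σ (finRotate _ i)) (σ i) with h5 | h5
    · rw [if_neg h5.not_gt] at h3
      exact one_ne_zero h3
    · rw [if_neg h5.not_gt] at h4
      exact one_ne_zero h4
  exact (sector_subset_of_exchange_mem hZ hσ₀ ⟨hσ₀, hqσ₀⟩ hσ).2

/-- A positive stationary vector spans the stationary vectors on the sector. -/
theorem exists_eq_smul_of_markov_mulVec_eq_zero {t : ℝ} (ht : 0 ≤ t)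
    {π p : Config N (n + 1) → ℝ} (hπ : ∀ σ ∈ sector m, 0 < π σ) (hπ0 : ∀ σ ∉ sector m, π σ = 0)
    (hHπ : (markov t N (n + 1)).mulVec π = 0) (hp0 : ∀ σ ∉ sector m, p σ = 0)
    (hHp : (markov t N (n + 1)).mulVec p = 0) : ∃ c : ℝ, p = c • π := by
  classical
  by_cases hS : ∃ σ : Config N (n + 1), σ ∈ sector m
  swap
  · exact ⟨0, funext fun σ => by rw [hp0 σ fun h => hS ⟨σ, h⟩]; simp⟩
  obtain ⟨σ₁, hσ₁⟩ := hS
  obtain ⟨σ₀, hσ₀, hmax⟩ :=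
    (Finset.univ.filter (· ∈ (sector m : Set (Config N (n + 1))))).exists_max_image
      (fun σ => p σ / π σ) ⟨σ₁, Finset.mem_filter.mpr ⟨Finset.mem_univ _, hσ₁⟩⟩
  have hσ₀ := (Finset.mem_filter.mp hσ₀).2
  refine ⟨p σ₀ / π σ₀, funext fun σ => ?_⟩
  by_cases hσ : σ ∈ sector m
  · have h := eq_zero_of_markov_mulVec_eq_zero ht (q := (p σ₀ / π σ₀) • π - p) hπ hHπ ?_ ?_
      hσ₀ ?_ hσ
    · exact (sub_eq_zero.mp h).symm
    · intro τ
      by_cases hτ : τ ∈ sector m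
      · have := hmax τ (Finset.mem_filter.mpr ⟨Finset.mem_univ _, hτ⟩)
        rw [div_le_iff₀ (hπ τ hτ)] at this
        exact sub_nonneg.mpr this
      · rw [Pi.sub_apply, Pi.smul_apply, hπ0 τ hτ, hp0 τ hτ, smul_zero, sub_zero]
    · rw [Matrix.mulVec_sub, Matrix.mulVec_smul, hHπ, hHp, smul_zero, sub_zero]
    · rw [Pi.sub_apply, Pi.smul_apply, smul_eq_mul, div_mul_cancel₀ _ (hπ σ₀ hσ₀).ne', sub_self]
  · rw [Pi.smul_apply, hπ0 σ hσ, hp0 σ hσ, smul_zero]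

end

end

end ASEP

theorem theorem4p6 (N L : ℕ) (m : Fin (N + 2) → ℕ) (hm : ∀ α, 1 ≤ m α)
    (hL : ∑ α, m α = L) :
    -- `t` an indeterminate: operators over `ℚ(t)`, traces in formal Laurent series in `t`
    ((ASEP.markov (RatFunc.X : RatFunc ℚ) N L).mulVec (ASEP.mlqState RatFunc.X m) = 0 ∧
      (∀ σ : ASEP.Config N L, σ ∈ ASEP.sector m →
        ASEP.mlqState (RatFunc.X : RatFunc ℚ) m σ ≠ 0 ∧
        ASEP.HasFockTrace (ASEP.ctmProduct (RatFunc.X : RatFunc ℚ) σ)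
          (algebraMap (RatFunc ℚ) (LaurentSeries ℚ)
            (ASEP.mlqState RatFunc.X m σ / ASEP.normFactor RatFunc.X m)) ∧
        ASEP.HasPartitionFunction (RatFunc.X : RatFunc ℚ) σ
          (algebraMap (RatFunc ℚ) (LaurentSeries ℚ)
            (ASEP.mlqState RatFunc.X m σ / ASEP.normFactor RatFunc.X m)))) ∧
    -- `t` a real number
    (∀ t : ℝ, 0 ≤ t → t ≠ 1 →
      (∀ σ : ASEP.Config N L, σ ∈ ASEP.sector m → 0 < ASEP.mlqState t m σ) ∧
      (∀ p : ASEP.Config N L → ℝ,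
        ((∀ σ, σ ∉ ASEP.sector m → p σ = 0) ∧ (ASEP.markov t N L).mulVec p = 0) ↔
          ∃ c : ℝ, p = c • ASEP.mlqState t m) ∧
      (t < 1 → 0 < ASEP.normFactor t m ∧
        ∀ σ : ASEP.Config N L, σ ∈ ASEP.sector m →
          ASEP.HasFockTrace (ASEP.ctmProduct t σ)
            (ASEP.mlqState t m σ / ASEP.normFactor t m) ∧
          ASEP.HasPartitionFunction t σ
            (ASEP.mlqState t m σ / ASEP.normFactor t m))) := by
  obtain ⟨n, rfl⟩ : ∃ n, L = n + 2 := by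
    have h := Finset.sum_le_sum fun (α : Fin (N + 2)) (_ : α ∈ Finset.univ) => hm α
    rw [hL, Finset.sum_const, Finset.card_univ, Fintype.card_fin, smul_eq_mul, mul_one] at h
    exact ⟨L - 2, by omega⟩
  refine ⟨⟨ASEP.markov_mulVec_mlqState_ratFunc hm, fun σ hσ =>
    ⟨ASEP.mlqState_ratFunc_ne_zero hσ,
      ASEP.hasFockTrace_ctmProduct ASEP.isSummationField_ratFunc hm hσ,
      ASEP.hasPartitionFunction ASEP.isSummationField_ratFunc hm hL hσ⟩⟩, fun t ht ht1 => ?_⟩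
  have hpos : ∀ σ : ASEP.Config N (n + 2), σ ∈ ASEP.sector m → 0 < ASEP.mlqState t m σ :=
    fun σ hσ => ASEP.mlqState_pos ht hσ
  have hzero : ∀ σ : ASEP.Config N (n + 2), σ ∉ ASEP.sector m → ASEP.mlqState t m σ = 0 :=
    fun σ hσ => ASEP.mlqState_eq_zero hL hσ
  have hstat := ASEP.markov_mulVec_mlqState_real (n := n) hm ht ht1
  refine ⟨hpos, fun p => ⟨fun h => ?_, ?_⟩, fun hlt => ⟨ASEP.normFactor_pos hm ht hlt,
    fun σ hσ => ⟨?_, ?_⟩⟩⟩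
  · exact ASEP.exists_eq_smul_of_markov_mulVec_eq_zero ht hpos hzero hstat h.1 h.2
  · rintro ⟨c, rfl⟩
    refine ⟨fun σ hσ => ?_, ?_⟩
    · rw [Pi.smul_apply, hzero σ hσ, smul_zero]
    · rw [Matrix.mulVec_smul, hstat, smul_zero]
  · exact ASEP.hasFockTrace_ctmProduct (ASEP.isSummationField_real ht hlt) hm hσ
  · exact ASEP.hasPartitionFunction (ASEP.isSummationField_real ht hlt) hm hL hσ
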